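/- Fix $n\ge 2$ and write $[n]=\{1,\dots,n\}$. **Definitions.** For $k\in[n-1]$ let $\mathbb X_k=\mathrm{Gr}(k,n)\times\mathbb C^\times$, with points written $N|t$, where $N$ is a $k$-dimensional subspace of $\mathbb C^n$. Let $P_I(N)$ be the Plücker coordinates of $N$ (maximal minors of a matrix whose columns form a basis of $N$, defined up to a common scalar; $P_I(N)=0$ if $|I|\ne k$; indices are read modulo $n$). Let $\lambda$ be an indeterminate and let $g(N|t)$ be the $n\times n$ matrix over $\mathbb C[\lambda]$ with entries $$g(N|t)_{ij}=c_{ij}\,\frac{P_{[j-k+1,j-1]\cup\{i\}}(N)}{P_{[j-k,j-1]}(N)},\qquad c_{ij}=\begin{cases}1 & j\le k\\ t & j>k,\ i\ge j\\ \lambda & j>k,\ i<j,\end{cases}$$ defined when all the denominators are nonzero. For $z\in\mathbb C^\times$ let $\pi^k_z(A)=N|z$, where $N$ is the span of the first $k$ columns of $A|_{\lambda=(-1)^{k-1}z}$ (defined when these columns are independent). Let $\mathrm{fl}(A)_{ij}=A_{n-j+1,n-i+1}$, let $S(N|t)=\pi^k_t(\mathrm{fl}(g(N|t)))$, and on a product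 let $S(u,v)=(S(v),S(u))$. For $\ell,k\in[n-1]$ let $\Psi_{k,\ell}:\mathbb X_\ell\times\mathbb X_k\to\mathbb X_k$ be the rational map $\Psi_{k,\ell}(M|s,N|t)=\pi^k_t(g(M|s)\,g(N|t))$. The geometric $R$-matrix is the rational map $$R=(\Psi_{k,\ell},\ S\circ\Psi_{\ell,k}\circ S):\ \mathbb X_\ell\times\mathbb X_k\to\mathbb X_k\times\mathbb X_\ell .$$ The Gelfand–Tsetlin parametrization $\Theta_k$ of $\mathbb X_k$ is the map from the torus with coordinates $X_{ij}\in\mathbb C^\times$ ($1\le i\le n-k$, $i\le j\le i+k-1$) and $t\in\mathbb C^\times$ to $\mathbb X_k$ given by $$\Theta_k(X_{ij},t)=\pi^k_t\big(M_{n-k}M_{n-k-1}\cdots M_1\big).$$ Here $M_i$ is the $n\times n$ matrix with diagonal entries $x_{ij}=X_{ij}/X_{i,j-1}$ in the positions $j=i,\dots,i+k$ (with $X_{i,i-1}=1$ and $X_{i,i+k}=t$) and $1$ in the other diagonal positions, with entries $1$ in the positions $(p,p-1)$ for $i+1\le p\le i+k$, and with all other entries $0$. A rational function on a torus is *positive*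 if it is a ratio of two nonzero polynomials with positive integer coefficients, and *non-negative* if it is positive or identically zero. A rational map between products of the $\mathbb X_k$ is *positive* if, after composition with the Gelfand–Tsetlin parametrizations on the source and their inverses on the target, it is defined as a rational map of tori and each of its components is positive. A rational map $f=\sum_{i=0}^d f_i\lambda^i:\mathbb X_k\to\mathbb C[\lambda]$ is *$r$-non-negative* if for each $i$ the rational function $(-1)^{(r-1)i}f_i$, written in Gelfand–Tsetlin coordinates, is non-negative. A *cyclic interval* is a set of elements of $[n]$ that are consecutive modulo $n$; the cyclic intervals of a set $I\subset[n]$ are the maximal nonempty subsets of $I$ that are cyclic intervals. **Theorem.** (a) For all $\ell,k\in[n-1]$, the geometric $R$-matrix $R:\mathbb X_\ell\times\mathbb X_k\to\mathbb X_k\times\mathbb X_\ell$ is positive. That is, the map $$(\Theta_k^{-1}\times\Theta_\ell^{-1})\circ R\circ(\Theta_\ell\times\Theta_k):\ ((X_{ij},s),(Y_{ij},t))\mapsto((Y'_{ij},t),(X'_{ij},s))$$ is given by subtraction-free rational functions in $X_{ij},Y_{ij},s,t$. (b) Let $k\in[n-1]$, and let $I,J\subset[n]$ be two subsets of size $r$,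 at least one of which has no more than two cyclic intervals. Let $\Delta_{I,J}:\mathbb X_k\to\mathbb C[\lambda]$ be the rational map that sends $N|t$ to the minor of $g(N|t)$ with rows $I$ and columns $J$. If $r\le k$, then $\Delta_{I,J}$ is $r$-non-negative. If $r>k$, then $\Delta_{I,J}=(t+(-1)^k\lambda)^{r-k}f_{I,J}$ for some $r$-non-negative rational map $f_{I,J}:\mathbb X_k\to\mathbb C[\lambda]$. -/

import Mathlib

open Polynomial

noncomputable section

namespace GeomR

/-! Indices in `[n] = {1, ..., n}` are represented by `Fin n`: the element `i : Fin n` stands for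
`i + 1`.  Rational maps are represented by partial functions `→.`; composition of partial
functions keeps track of the domains. -/

/-- The Grassmannian of `k`-dimensional subspaces of `ℂ^n`. -/
def Gr (k n : ℕ) : Type := {N : Submodule ℂ (Fin n → ℂ) // Module.finrank ℂ N = k}

/-- The variety `𝕏_k = Gr(k,n) × ℂˣ`; a point `(N, t)` is written `N|t`. -/
abbrev XVar (n k : ℕ) : Type := Gr k n × ℂˣ

/-- A full-rank `n × k` matrix whose columns form a basis of `N`. -/
def Gr.rep {k n : ℕ} (N : Gr k n) : Matrix (Fin n) (Fin k) ℂ :=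
  Matrix.of fun i a => (Module.finBasisOfFinrankEq ℂ N.1 N.2 a : Fin n → ℂ) i

/-- The Plücker coordinate `P_I(N)`, computed from the representative `N.rep` (so that all
`P_I(N)` are defined up to one common nonzero scalar, and only ratios are meaningful).
It is zero if `I` does not have exactly `k` elements. -/
def Gr.plucker {k n : ℕ} (N : Gr k n) (I : Finset (Fin n)) : ℂ :=
  if h : I.card = k then (N.rep.submatrix (I.orderEmbOfFin h) id).det else 0

/-- The set of residues modulo `n` of `j - m, j - m + 1, ..., j - 1`. -/
def arc {n : ℕ} (j : Fin n) (m : ℕ) : Finset (Fin n) :=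
  Finset.univ.filter fun i => ∃ a ∈ Finset.range m, i.val + a + 1 ≡ j.val [MOD n]

/-- The rational map `g` from `𝕏_k` to matrices over `ℂ[λ]` (the polynomial variable is `λ`):
`g(N|t)_{ij} = c_{ij} P_{[j-k+1,j-1] ∪ {i}}(N) / P_{[j-k,j-1]}(N)`, defined exactly when all
the denominators are nonzero, where `c_{ij} = 1` for `j ≤ k`, and for `j > k`, `c_{ij} = t` if
`i ≥ j` and `c_{ij} = λ` if `i < j` (indices starting from `1`). -/
def g (n k : ℕ) : XVar n k →. Matrix (Fin n) (Fin n) ℂ[X] := fun p =>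
  ⟨∀ j : Fin n, p.1.plucker (arc j k) ≠ 0, fun _ =>
    Matrix.of fun i j =>
      (if j.val < k then 1 else if j ≤ i then C (p.2 : ℂ) else X) *
        C (p.1.plucker (insert i (arc j (k - 1))) / p.1.plucker (arc j k))⟩

/-- `π^k_z(A) = N|z`, where `N` is the span of the first `k` columns of `A` evaluated at
`λ = (-1)^(k-1) z`; undefined if these columns do not have full rank.  (The sign is written
`(-1)^(k+1)`.) -/
def piMap (n k : ℕ) (z : ℂˣ) : Matrix (Fin n) (Fin n) ℂ[X] →. XVar n k := fun A =>
  let N : Submodule ℂ (Fin n → ℂ) := Submodule.span ℂ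
    {v | ∃ j : Fin n, j.val < k ∧ v = fun i => (A i j).eval ((-1) ^ (k + 1) * (z : ℂ))}
  ⟨Module.finrank ℂ N = k, fun h => (⟨N, h⟩, z)⟩

/-- The flip map, reflecting a matrix over the anti-diagonal. -/
def flip {n : ℕ} (A : Matrix (Fin n) (Fin n) ℂ[X]) : Matrix (Fin n) (Fin n) ℂ[X] :=
  Matrix.of fun i j => A j.rev i.rev

/-- The geometric Schützenberger involution `S(N|t) = π^k_t (fl (g (N|t)))`. -/
def schutz (n k : ℕ) : XVar n k →. XVar n k := fun p =>
  (g n k p).bind fun A => piMap n k p.2 (flip A)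

/-- `S` on a product of two factors: `S(u, v) = (S v, S u)`. -/
def schutz₂ (n ℓ k : ℕ) : XVar n ℓ × XVar n k →. XVar n k × XVar n ℓ := fun p =>
  (schutz n k p.2).bind fun v => (schutz n ℓ p.1).map fun u => (v, u)

/-- `Ψ_{k,ℓ} : 𝕏_ℓ × 𝕏_k → 𝕏_k`, `Ψ_{k,ℓ}(M|s, N|t) = π^k_t (g(M|s) g(N|t))`. -/
def Psi (n k ℓ : ℕ) : XVar n ℓ × XVar n k →. XVar n k := fun p =>
  (g n ℓ p.1).bind fun A => (g n k p.2).bind fun B => piMap n k p.2.2 (A * B)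

/-- The geometric `R`-matrix `R = (Ψ_{k,ℓ}, S ∘ Ψ_{ℓ,k} ∘ S) : 𝕏_ℓ × 𝕏_k → 𝕏_k × 𝕏_ℓ`. -/
def geomR (n ℓ k : ℕ) : XVar n ℓ × XVar n k →. XVar n k × XVar n ℓ := fun p =>
  (Psi n k ℓ p).bind fun v' =>
    (((schutz₂ n ℓ k p).bind (Psi n ℓ k)).bind (schutz n ℓ)).map fun u' => (v', u')

/-- The index set of the coordinates `(X_{ij}, t)` of rational `(n-k)`-rectangles:
`inl (a, b)` stands for the pair `(i, j)` with `i = a + 1`, `j = i + b`, so that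
`1 ≤ i ≤ n - k` and `i ≤ j ≤ i + k - 1`; `inr ()` stands for `t`. -/
abbrev GTIdx (n k : ℕ) : Type := (Fin (n - k) × Fin k) ⊕ Unit

/-- With `i = a + 1`: `X_{i,i+m-1}`, with the conventions `X_{i,i-1} = 1`, `X_{i,i+k} = t`. -/
def gtX {n k : ℕ} (z : GTIdx n k → ℂˣ) (a : Fin (n - k)) : ℕ → ℂˣ
  | 0 => 1
  | b + 1 => if h : b < k then z (Sum.inl (a, ⟨b, h⟩)) else z (Sum.inr ())

/-- With `i = a + 1`: `x_{i,i+b} = X_{i,i+b} / X_{i,i+b-1}`, for `0 ≤ b ≤ k`. -/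
def gtx {n k : ℕ} (z : GTIdx n k → ℂˣ) (a : Fin (n - k)) (b : ℕ) : ℂˣ :=
  gtX z a (b + 1) / gtX z a b

/-- With `i = a + 1`: the matrix `M_{[i,i+k]}(x_{ii}, ..., x_{i,i+k})`, with diagonal entries
`x_{ii}, ..., x_{i,i+k}` in positions `i, ..., i + k` and `1` elsewhere on the diagonal, and with
entries `1` in the positions `(p, p - 1)` for `p = i + 1, ..., i + k`. -/
def chevM {n k : ℕ} (z : GTIdx n k → ℂˣ) (a : Fin (n - k)) : Matrix (Fin n) (Fin n) ℂ :=
  Matrix.of fun p q =>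
    if p = q then
      (if a.val ≤ p.val ∧ p.val ≤ a.val + k then (gtx z a (p.val - a.val) : ℂ) else 1)
    else if p.val = q.val + 1 ∧ a.val < p.val ∧ p.val ≤ a.val + k then 1 else 0

/-- The tableau matrix `Φ_{n-k}`: the product of the `M_{[i,i+k]}`, from left to right in
decreasing order of `i`. -/
def tableauMatrix {n k : ℕ} (z : GTIdx n k → ℂˣ) : Matrix (Fin n) (Fin n) ℂ :=
  ((List.finRange (n - k)).reverse.map (chevM z)).prod

/-- The Gelfand–Tsetlin parametrization `Θ_k = π^k_t ∘ Φ_{n-k}` of `𝕏_k`. -/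
def Theta (n k : ℕ) : (GTIdx n k → ℂˣ) →. XVar n k := fun z =>
  piMap n k (z (Sum.inr ())) ((tableauMatrix z).map C)

/-- The product of two parametrizations. -/
def prodParam {σ τ A B : Type} (f : (σ → ℂˣ) →. A) (h : (τ → ℂˣ) →. B) :
    (σ ⊕ τ → ℂˣ) →. A × B := fun z =>
  (f fun i => z (Sum.inl i)).bind fun a => (h fun i => z (Sum.inr i)).map fun b => (a, b)

/-- The inverse of a partial map, defined at the points with exactly one preimage. -/
def partialInv {A B : Type} (f : A →. B) : B →. A := fun y =>
  ⟨∃! x, y ∈ f x, fun h => Classical.choose h⟩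

/-- The property `P` holds on a nonempty Zariski-open subset of the torus `(ℂˣ)^σ`. -/
def Generically {σ : Type} (P : (σ → ℂˣ) → Prop) : Prop :=
  ∃ D : MvPolynomial σ ℂ, D ≠ 0 ∧
    ∀ z : σ → ℂˣ, MvPolynomial.eval (fun i => (z i : ℂ)) D ≠ 0 → P z

/-- The value at a point of a torus of a polynomial with non-negative integer coefficients. -/
def evalNat {σ : Type} (z : σ → ℂˣ) (p : MvPolynomial σ ℕ) : ℂ :=
  MvPolynomial.aeval (fun i => (z i : ℂ)) p

/-- A rational function on a torus is positive if it is the quotient of two nonzero polynomials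
with positive integer coefficients. -/
def IsPositiveFun {σ : Type} (f : (σ → ℂˣ) →. ℂ) : Prop :=
  ∃ p q : MvPolynomial σ ℕ, p ≠ 0 ∧ q ≠ 0 ∧
    Generically fun z => evalNat z q ≠ 0 ∧ evalNat z p / evalNat z q ∈ f z

/-- A rational function on a torus is non-negative if it is positive or identically zero. -/
def IsNonnegFun {σ : Type} (f : (σ → ℂˣ) →. ℂ) : Prop :=
  IsPositiveFun f ∨ Generically fun z => 0 ∈ f z

/-- A positive map of tori: (generically defined and) every component is positive. -/
def IsPositiveTorusMap {σ τ : Type} (f : (σ → ℂˣ) →. (τ → ℂˣ)) : Prop :=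
  (Generically fun z => (f z).Dom) ∧
    ∀ i : τ, IsPositiveFun fun z => (f z).map fun w => (w i : ℂ)

/-- A rational map `h : A → B` between varieties with parametrizations `ΘA`, `ΘB` is positive if
`ΘB⁻¹ ∘ h ∘ ΘA` is a positive map of tori. -/
def IsPositiveMap {σ τ A B : Type} (ΘA : (σ → ℂˣ) →. A) (ΘB : (τ → ℂˣ) →. B) (h : A →. B) :
    Prop :=
  IsPositiveTorusMap fun z => ((ΘA z).bind h).bind (partialInv ΘB)

/-- A rational map `f = f_0 + f_1 λ + ... + f_d λ^d` from a variety with parametrization `ΘA` to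
`ℂ[λ]` is `r`-non-negative if every `(-1)^((r-1)i) f_i` is non-negative.  (The sign is written
`(-1)^((r+1)i)`.) -/
def IsRNonneg {σ A : Type} (ΘA : (σ → ℂˣ) →. A) (r : ℕ) (f : A →. ℂ[X]) : Prop :=
  (∃ d : ℕ, Generically fun z => ∃ F ∈ (ΘA z).bind f, F.natDegree ≤ d) ∧
    ∀ i : ℕ, IsNonnegFun fun z =>
      ((ΘA z).bind f).map fun F => (-1) ^ ((r + 1) * i) * F.coeff i

/-- The rational map `N|t ↦ Δ_{I,J}(g(N|t))`, for two `r`-subsets `I` and `J`. -/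
def minorG (n k : ℕ) {r : ℕ} (I J : Finset (Fin n)) (hI : I.card = r) (hJ : J.card = r) :
    XVar n k →. ℂ[X] := fun p =>
  (g n k p).map fun A => (A.submatrix (I.orderEmbOfFin hI) (J.orderEmbOfFin hJ)).det

/-- A cyclic interval: a set of elements which are consecutive modulo `n`. -/
def IsCyclicInterval {n : ℕ} (S : Finset (Fin n)) : Prop := ∃ (j : Fin n) (m : ℕ), S = arc j m

/-- The cyclic intervals of `I`: the maximal (nonempty) subsets of `I` which are cyclic
intervals. -/
def cyclicIntervals {n : ℕ} (I : Finset (Fin n)) : Set (Finset (Fin n)) :=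
  {S | Maximal (fun T => T ⊆ I ∧ T.Nonempty ∧ IsCyclicInterval T) S}

end GeomR

end

namespace GeomR

/-! ### Positive and non-negative families over a torus -/

section Families

variable {σ : Type}

/-! Both parts rest on a positivity statement for products of two Plücker coordinates, of
Temperley–Lieb type. For a point `N` given by Gelfand–Tsetlin coordinates, `P_S(N) P_T(N)` is a sum
over noncrossing partial matchings `τ` with marked or unmarked free points: a subtraction-free
coefficient times the indicator that `(S, T)` is compatible with `τ`. This holds for the span of the
first `k` basis vectors, and it survives scaling a row and adding to a row the preceding one
(`rowAddOp_mem_tlCone`). The tableau matrix is a product of such operations (`IsTL.bidiagMul`).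

Consider a minor of `g` whose `r ≤ k` columns form two intervals `[0, b)` and `[c, d)`. Rescaling
the columns and `λ` replaces `g` by `hMat`. A minor of `hMat` with columns in one interval is a
single Plücker coordinate up to sign, powers of `λ` and subtraction-free factors (`rowDet_om`), so
Laplace expansion along the two blocks turns each coefficient in `λ` into a signed sum of products
of two Plücker coordinates (`coeff_minor_hMat`). On the indicator of a single matching this sum
either cancels or has all terms of the predicted sign (`twoArc_sum_mem`). Cyclic rotation then gives
all pairs of cyclic intervals. For `r > k`, Jacobi's identity passes to minors of size `n - r` for
the orthogonal complement, a point of `Gr(n - k, n)`; the two matrices multiply, after signs and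
rescaling, to the scalar `1 + (-1)^k λ`, which is the source of the extra factor
(`minor_hMat_dual`). Finally `fl(g(N|t)) = g(S(N|t))` (`flip_gMat`) exchanges the roles of rows and
columns, and (b) follows.

For (a), the Gelfand–Tsetlin coordinates are ratios of the Plücker coordinates on the basic sets
`[i, i + m) ∪ [n - k + m, n)`, and conversely these coordinates are monomials (`pl_gtMat_basicSet`).
A map is therefore positive once its normalised basic coordinates are. For `Ψ` these are ratios of
minors of `g(M|s) g(N|t)` at `λ = (-1)^(k-1) t`. By Cauchy–Binet each is a sum of products of minors
covered by (b), hence non-negative up to one common factor that drops out of the ratios, and one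
term is visibly positive (`PosPoint.exists_Psi`). For `S` the basic coordinates come from minors of
`g` itself (`PosPoint.exists_schutz`). The map `R` is a composite of these. -/

theorem evalNat_add (z : σ → ℂˣ) (p q : MvPolynomial σ ℕ) :
    evalNat z (p + q) = evalNat z p + evalNat z q := map_add _ _ _

theorem evalNat_mul (z : σ → ℂˣ) (p q : MvPolynomial σ ℕ) :
    evalNat z (p * q) = evalNat z p * evalNat z q := map_mul _ _ _

/-- The filter of sets containing a nonempty Zariski-open subset of the torus. -/
def generic (σ : Type) : Filter (σ → ℂˣ) where
  sets := {s | Generically (· ∈ s)}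
  univ_sets := ⟨1, one_ne_zero, fun _ _ => trivial⟩
  sets_of_superset := by
    rintro s t ⟨D, hD, h⟩ hst
    exact ⟨D, hD, fun z hz => hst (h z hz)⟩
  inter_sets := by
    rintro s t ⟨D, hD, h⟩ ⟨E, hE, h'⟩
    refine ⟨D * E, mul_ne_zero hD hE, fun z hz => ?_⟩
    rw [map_mul] at hz
    exact ⟨h z (left_ne_zero_of_mul hz), h' z (right_ne_zero_of_mul hz)⟩

theorem eventually_generic {P : (σ → ℂˣ) → Prop} :
    (∀ᶠ z in generic σ, P z) ↔ Generically P := Iff.rfl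

theorem eventually_evalNat_ne_zero {q : MvPolynomial σ ℕ} (hq : q ≠ 0) :
    ∀ᶠ z in generic σ, evalNat z q ≠ 0 := by
  refine ⟨MvPolynomial.map (Nat.castRingHom ℂ) q, ?_, fun z hz => ?_⟩
  · intro h
    apply hq
    apply MvPolynomial.map_injective (Nat.castRingHom ℂ) Nat.cast_injective
    rw [h, map_zero]
  · change evalNat z q ≠ 0
    rw [MvPolynomial.eval_map] at hz
    unfold evalNat
    rw [MvPolynomial.aeval_def]
    convert hz using 2
    rfl

/-- A family of complex numbers over the torus given generically by a ratio of polynomials with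
non-negative integer coefficients. -/
def NonnegFam (f : (σ → ℂˣ) → ℂ) : Prop :=
  ∃ p q : MvPolynomial σ ℕ, q ≠ 0 ∧ ∀ᶠ z in generic σ, f z = evalNat z p / evalNat z q

/-- A family of complex numbers over the torus given generically by a ratio of nonzero polynomials
with non-negative integer coefficients. -/
def PosFam (f : (σ → ℂˣ) → ℂ) : Prop :=
  ∃ p q : MvPolynomial σ ℕ, p ≠ 0 ∧ q ≠ 0 ∧
    ∀ᶠ z in generic σ, f z = evalNat z p / evalNat z q

theorem PosFam.nonneg {f : (σ → ℂˣ) → ℂ} (h : PosFam f) : NonnegFam f := by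
  obtain ⟨p, q, -, hq, h⟩ := h
  exact ⟨p, q, hq, h⟩

theorem PosFam.ne_zero {f : (σ → ℂˣ) → ℂ} (h : PosFam f) : ∀ᶠ z in generic σ, f z ≠ 0 := by
  obtain ⟨p, q, hp, hq, h⟩ := h
  filter_upwards [h, eventually_evalNat_ne_zero hp, eventually_evalNat_ne_zero hq] with z h hp hq
  rw [h]
  exact div_ne_zero hp hq

theorem NonnegFam.congr {f g : (σ → ℂˣ) → ℂ} (h : NonnegFam f)
    (hfg : ∀ᶠ z in generic σ, g z = f z) : NonnegFam g := by
  obtain ⟨p, q, hq, h⟩ := h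
  refine ⟨p, q, hq, ?_⟩
  filter_upwards [h, hfg] with z h hfg
  rw [hfg, h]

theorem PosFam.congr {f g : (σ → ℂˣ) → ℂ} (h : PosFam f)
    (hfg : ∀ᶠ z in generic σ, g z = f z) : PosFam g := by
  obtain ⟨p, q, hp, hq, h⟩ := h
  refine ⟨p, q, hp, hq, ?_⟩
  filter_upwards [h, hfg] with z h hfg
  rw [hfg, h]

theorem NonnegFam.pos {f : (σ → ℂˣ) → ℂ} (h : NonnegFam f)
    (h0 : ∀ᶠ z in generic σ, f z ≠ 0) : PosFam f := by
  obtain ⟨p, q, hq, h⟩ := h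
  by_cases hp : p = 0
  -- With numerator zero, `f` would generically be both zero and nonzero, so the required identity
  -- holds vacuously for any witness.
  · refine ⟨1, 1, one_ne_zero, one_ne_zero, ?_⟩
    filter_upwards [h, h0] with _ h h0
    rw [hp, evalNat, map_zero, zero_div] at h
    exact absurd h h0
  · exact ⟨p, q, hp, hq, h⟩

theorem NonnegFam.eq_zero_or_pos {f : (σ → ℂˣ) → ℂ} (h : NonnegFam f) :
    (∀ᶠ z in generic σ, f z = 0) ∨ PosFam f := by
  obtain ⟨p, q, hq, h⟩ := h
  by_cases hp : p = 0
  · left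
    filter_upwards [h] with z h
    rw [h, hp, evalNat, map_zero, zero_div]
  · exact Or.inr ⟨p, q, hp, hq, h⟩

theorem PosFam.add_nonneg {f g : (σ → ℂˣ) → ℂ} (hf : PosFam f) (hg : NonnegFam g) :
    PosFam (f + g) := by
  obtain ⟨p, q, hp, hq, h⟩ := hf
  obtain ⟨p', q', hq', h'⟩ := hg
  refine ⟨p * q' + q * p', q * q', ?_, mul_ne_zero hq hq', ?_⟩
  · intro h0
    -- The coefficients are natural numbers, so a sum vanishes only if both summands do: no
    -- cancellation is possible.
    have hpq : p * q' ≠ 0 := mul_ne_zero hp hq'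
    apply hpq
    ext m
    have := congrArg (MvPolynomial.coeff m) h0
    rw [MvPolynomial.coeff_add, MvPolynomial.coeff_zero] at this
    rw [MvPolynomial.coeff_zero]
    omega
  · filter_upwards [h, h', eventually_evalNat_ne_zero hq, eventually_evalNat_ne_zero hq']
      with z h h' hq hq'
    rw [Pi.add_apply, h, h', evalNat_add, evalNat_mul, evalNat_mul, evalNat_mul,
      div_add_div _ _ hq hq']

theorem NonnegFam.add {f g : (σ → ℂˣ) → ℂ} (hf : NonnegFam f) (hg : NonnegFam g) :
    NonnegFam (f + g) := by
  rcases hf.eq_zero_or_pos with h | h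
  · refine hg.congr ?_
    filter_upwards [h] with z h
    rw [Pi.add_apply, h, zero_add]
  · exact (h.add_nonneg hg).nonneg

theorem NonnegFam.mul {f g : (σ → ℂˣ) → ℂ} (hf : NonnegFam f) (hg : NonnegFam g) :
    NonnegFam (f * g) := by
  obtain ⟨p, q, hq, h⟩ := hf
  obtain ⟨p', q', hq', h'⟩ := hg
  refine ⟨p * p', q * q', mul_ne_zero hq hq', ?_⟩
  filter_upwards [h, h'] with z h h'
  rw [Pi.mul_apply, h, h', evalNat_mul, evalNat_mul, div_mul_div_comm]

theorem PosFam.mul {f g : (σ → ℂˣ) → ℂ} (hf : PosFam f) (hg : PosFam g) : PosFam (f * g) := by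
  refine (hf.nonneg.mul hg.nonneg).pos ?_
  filter_upwards [hf.ne_zero, hg.ne_zero] with z h h'
  exact mul_ne_zero h h'

theorem PosFam.inv {f : (σ → ℂˣ) → ℂ} (hf : PosFam f) : PosFam (fun z => (f z)⁻¹) := by
  obtain ⟨p, q, hp, hq, h⟩ := hf
  refine ⟨q, p, hq, hp, ?_⟩
  filter_upwards [h] with z h
  rw [h, inv_div]

theorem PosFam.div {f g : (σ → ℂˣ) → ℂ} (hf : PosFam f) (hg : PosFam g) :
    PosFam (fun z => f z / g z) :=
  (hf.mul hg.inv).congr (.of_forall fun _ => div_eq_mul_inv _ _)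

theorem posFam_one : PosFam (fun _ : σ → ℂˣ => (1 : ℂ)) :=
  ⟨1, 1, one_ne_zero, one_ne_zero, .of_forall fun z => by simp [evalNat]⟩

theorem nonnegFam_zero : NonnegFam (fun _ : σ → ℂˣ => (0 : ℂ)) :=
  ⟨0, 1, one_ne_zero, .of_forall fun z => by simp [evalNat]⟩

theorem posFam_coord (i : σ) : PosFam (fun z : σ → ℂˣ => (z i : ℂ)) :=
  ⟨MvPolynomial.X i, 1, MvPolynomial.X_ne_zero i, one_ne_zero,
    .of_forall fun z => by simp [evalNat]⟩

/-- The semiring of non-negative families. -/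
def nonnegFamilies (σ : Type) : Subsemiring ((σ → ℂˣ) → ℂ) where
  carrier := {f | NonnegFam f}
  mul_mem' := NonnegFam.mul
  one_mem' := posFam_one.nonneg
  add_mem' := NonnegFam.add
  zero_mem' := nonnegFam_zero

theorem NonnegFam.sum {ι : Type*} {s : Finset ι} {f : ι → (σ → ℂˣ) → ℂ}
    (h : ∀ i ∈ s, NonnegFam (f i)) : NonnegFam (fun z => ∑ i ∈ s, f i z) := by
  have := (nonnegFamilies σ).sum_mem h
  refine NonnegFam.congr this (.of_forall fun z => ?_)
  rw [Finset.sum_apply]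

theorem PosFam.prod {ι : Type*} {s : Finset ι} {f : ι → (σ → ℂˣ) → ℂ}
    (h : ∀ i ∈ s, PosFam (f i)) : PosFam (fun z => ∏ i ∈ s, f i z) := by
  classical
  induction s using Finset.induction_on with
  | empty => simpa using posFam_one
  | insert a s ha ih =>
    refine ((h a (by simp)).mul (ih fun i hi => h i (by simp [hi]))).congr (.of_forall fun z => ?_)
    rw [Finset.prod_insert ha]
    rfl

theorem PosFam.pow {f : (σ → ℂˣ) → ℂ} (h : PosFam f) (m : ℕ) : PosFam (fun z => f z ^ m) := by
  refine (PosFam.prod (s := Finset.range m) (f := fun _ => f) fun _ _ => h).congr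
    (.of_forall fun z => ?_)
  simp

theorem PosFam.isPositiveFun {f : (σ → ℂˣ) →. ℂ} {g : (σ → ℂˣ) → ℂ} (hg : PosFam g)
    (hf : ∀ᶠ z in generic σ, g z ∈ f z) : IsPositiveFun f := by
  obtain ⟨p, q, hp, hq, h⟩ := hg
  refine ⟨p, q, hp, hq, eventually_generic.1 ?_⟩
  filter_upwards [h, hf, eventually_evalNat_ne_zero hq] with z h hf hq
  exact ⟨hq, h ▸ hf⟩

theorem NonnegFam.isNonnegFun {f : (σ → ℂˣ) →. ℂ} {g : (σ → ℂˣ) → ℂ} (hg : NonnegFam g)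
    (hf : ∀ᶠ z in generic σ, g z ∈ f z) : IsNonnegFun f := by
  rcases hg.eq_zero_or_pos with h | h
  · right
    refine eventually_generic.1 ?_
    filter_upwards [h, hf] with z h hf
    exact h ▸ hf
  · exact Or.inl (h.isPositiveFun hf)

end Families

/-! ### Determinants with rows indexed by finite sets -/

section RowDet

variable {α K : Type*} [LinearOrder α] [CommRing K]

/-- The determinant with rows in `I` (in increasing order) and the given list of columns. -/
def rowDet : List (α → K) → Finset α → K
  | [], I => if I = ∅ then 1 else 0
  | c :: cs, I => ∑ i ∈ I, (-1) ^ (I.filter (· < i)).card * c i * rowDet cs (I.erase i)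

/-- The number of pairs `(x, y)` with `x ∈ Y`, `y ∈ X` and `x < y`. -/
def crossings (X Y : Finset α) : ℕ := ∑ y ∈ X, (Y.filter (· < y)).card

/-- Generalised Laplace expansion, the sign counting inversions between the two row sets. Choosing
the row `i` of the first column and then a set `S` in `I \ {i}` for the rest of the block amounts to
choosing `insert i S` with the marked element `i`. -/
theorem rowDet_append (cs ds : List (α → K)) (I : Finset α) :
    rowDet (cs ++ ds) I =
      ∑ S ∈ I.powerset, (-1) ^ crossings S (I \ S) * rowDet cs S * rowDet ds (I \ S) := by
  induction cs generalizing I with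
  | nil =>
    rw [Finset.sum_eq_single ∅]
    · simp [rowDet, crossings]
    · intro S _ hS
      simp [rowDet, hS]
    · simp
  | cons c cs ih =>
    simp only [List.cons_append, rowDet, ih, Finset.mul_sum, Finset.sum_mul]
    rw [Finset.sum_sigma', Finset.sum_sigma']
    refine Finset.sum_bij' (fun p _ => ⟨insert p.1 p.2, p.1⟩) (fun p _ => ⟨p.2, p.1.erase p.2⟩)
      ?_ ?_ ?_ ?_ ?_
    · rintro ⟨i, S⟩ h
      simp only [Finset.mem_sigma, Finset.mem_powerset] at h ⊢
      exact ⟨Finset.insert_subset h.1 (h.2.trans (Finset.erase_subset _ _)),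
        Finset.mem_insert_self _ _⟩
    · rintro ⟨S, i⟩ h
      simp only [Finset.mem_sigma, Finset.mem_powerset] at h ⊢
      exact ⟨h.1 h.2, Finset.erase_subset_erase _ h.1⟩
    · rintro ⟨i, S⟩ h
      simp only [Finset.mem_sigma, Finset.mem_powerset] at h
      have hi : i ∉ S := fun hi => (Finset.mem_erase.1 (h.2 hi)).1 rfl
      simp [Finset.erase_insert hi]
    · rintro ⟨S, i⟩ h
      simp only [Finset.mem_sigma, Finset.mem_powerset] at h
      simp [Finset.insert_erase h.2]
    · rintro ⟨i, S⟩ h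
      simp only [Finset.mem_sigma, Finset.mem_powerset] at h
      have hi : i ∉ S := fun hi => (Finset.mem_erase.1 (h.2 hi)).1 rfl
      have hS : S ⊆ I := h.2.trans (Finset.erase_subset _ _)
      have e1 : I.erase i \ S = I \ insert i S := by
        ext x
        simp only [Finset.mem_sdiff, Finset.mem_erase, Finset.mem_insert]
        tauto
      have e2 : (I.filter (· < i)).card =
          ((insert i S).filter (· < i)).card + ((I \ insert i S).filter (· < i)).card := by
        rw [← Finset.card_union_of_disjoint, ← Finset.filter_union, Finset.union_sdiff_of_subset
          (Finset.insert_subset h.1 hS)]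
        exact Finset.disjoint_filter_filter Finset.disjoint_sdiff
      have e3 : crossings (insert i S) (I \ insert i S) =
          ((I \ insert i S).filter (· < i)).card + crossings S (I \ insert i S) := by
        rw [crossings, Finset.sum_insert hi, crossings]
      simp only [e1, e2, e3, Finset.erase_insert hi, pow_add]
      ring

theorem rowDet_eq_zero_of_card {cs : List (α → K)} {I : Finset α} (h : I.card ≠ cs.length) :
    rowDet cs I = 0 := by
  induction cs generalizing I with
  | nil =>
    have hI : I ≠ ∅ := by
      rintro rfl
      exact h rfl
    exact if_neg hI
  | cons c cs ih =>
    refine Finset.sum_eq_zero fun i hi => ?_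
    rw [ih, mul_zero]
    rw [Finset.card_erase_of_mem hi]
    have := Finset.card_pos.2 ⟨i, hi⟩
    simp only [List.length_cons] at h
    omega

theorem rowDet_eq_zero_of_row {cs : List (α → K)} {I : Finset α} {i : α} (hi : i ∈ I)
    (h : ∀ c ∈ cs, c i = 0) : rowDet cs I = 0 := by
  induction cs generalizing I with
  | nil => simp [rowDet, Finset.ne_empty_of_mem hi]
  | cons c cs ih =>
    refine Finset.sum_eq_zero fun j _ => ?_
    by_cases hj : j = i
    · rw [hj, h c (by simp), mul_zero, zero_mul]
    · rw [ih (Finset.mem_erase.2 ⟨Ne.symm hj, hi⟩) fun c hc => h c (by simp [hc]), mul_zero]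

theorem rowDet_scale_rows (v : α → K) (cs : List (α → K)) (I : Finset α) :
    rowDet (cs.map fun c i => v i * c i) I = (∏ i ∈ I, v i) * rowDet cs I := by
  induction cs generalizing I with
  | nil =>
    by_cases h : I = ∅ <;> simp [rowDet, h]
  | cons c cs ih =>
    simp only [List.map_cons, rowDet, ih, Finset.mul_sum]
    refine Finset.sum_congr rfl fun i hi => ?_
    rw [← Finset.mul_prod_erase I v hi]
    ring

theorem card_filter_lt_image {r : ℕ} {f : Fin r → α} (hf : StrictMono f) (s : Fin r) :
    ((Finset.univ.image f).filter (· < f s)).card = s := by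
  rw [Finset.filter_image, Finset.card_image_of_injective _ hf.injective]
  simp only [hf.lt_iff_lt]
  rw [Finset.filter_gt_eq_Iio]
  simp

theorem rowDet_ofFn {r : ℕ} {f : Fin r → α} (hf : StrictMono f) (c : Fin r → α → K) :
    rowDet (List.ofFn c) (Finset.univ.image f) = (Matrix.of fun s u => c u (f s)).det := by
  induction r with
  | zero => simp [rowDet]
  | succ r ih =>
    rw [List.ofFn_succ, rowDet, Finset.sum_image fun _ _ _ _ h => hf.injective h,
      Matrix.det_succ_column_zero]
    refine Finset.sum_congr rfl fun s _ => ?_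
    rw [card_filter_lt_image hf]
    have e : (Finset.univ.image f).erase (f s) =
        Finset.univ.image (f ∘ s.succAbove) := by
      ext x
      simp only [Finset.mem_erase, Finset.mem_image, Finset.mem_univ, true_and,
        Function.comp_apply]
      constructor
      · rintro ⟨h, u, rfl⟩
        obtain ⟨v, hv⟩ := Fin.exists_succAbove_eq (x := u) (y := s) (fun hu => h (by rw [hu]))
        exact ⟨v, by rw [hv]⟩
      · rintro ⟨v, rfl⟩
        exact ⟨fun h => Fin.succAbove_ne s v (hf.injective h), _, rfl⟩
    rw [e, ih (hf.comp (Fin.strictMono_succAbove s))]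
    rfl

theorem image_orderEmbOfFin {I : Finset α} {r : ℕ} (h : I.card = r) :
    Finset.univ.image (I.orderEmbOfFin h) = I := Finset.image_orderEmbOfFin_univ I h

theorem rowDet_ofFn_orderEmb {I : Finset α} {r : ℕ} (h : I.card = r) (c : Fin r → α → K) :
    rowDet (List.ofFn c) I = (Matrix.of fun s u => c u (I.orderEmbOfFin h s)).det := by
  rw [← rowDet_ofFn (I.orderEmbOfFin h).strictMono, image_orderEmbOfFin]

end RowDet

/-! ### Plücker coordinates as maximal minors, Jacobi's identity and Cauchy–Binet. -/

section Plucker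

variable {n k : ℕ} {K : Type*} [CommRing K]

/-- The maximal minor of `V` with rows `S`, or zero if `S` does not have `k` elements. -/
def pl (V : Matrix (Fin n) (Fin k) K) (S : Finset (Fin n)) : K :=
  if h : S.card = k then (V.submatrix (S.orderEmbOfFin h) id).det else 0

theorem pl_of_card {V : Matrix (Fin n) (Fin k) K} {S : Finset (Fin n)} (h : S.card = k) :
    pl V S = (V.submatrix (S.orderEmbOfFin h) id).det := dif_pos h

theorem pl_of_card_ne {V : Matrix (Fin n) (Fin k) K} {S : Finset (Fin n)} (h : S.card ≠ k) :
    pl V S = 0 := dif_neg h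

theorem orderEmbOfFin_image {f : Fin k → Fin n} (hf : StrictMono f) {S : Finset (Fin n)}
    (hS : S = Finset.univ.image f) (h : S.card = k) : ⇑(S.orderEmbOfFin h) = f :=
  (Finset.orderEmbOfFin_unique h (fun x => by simp [hS]) hf).symm

theorem card_image_strictMono {f : Fin k → Fin n} (hf : StrictMono f) :
    (Finset.univ.image f).card = k := by
  rw [Finset.card_image_of_injective _ hf.injective, Finset.card_univ, Fintype.card_fin]

theorem pl_image (V : Matrix (Fin n) (Fin k) K) {f : Fin k → Fin n} (hf : StrictMono f) :
    pl V (Finset.univ.image f) = (V.submatrix f id).det := by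
  rw [pl_of_card (card_image_strictMono hf), orderEmbOfFin_image hf rfl]

theorem pl_map {L : Type*} [CommRing L] (φ : K →+* L) (V : Matrix (Fin n) (Fin k) K)
    (S : Finset (Fin n)) : pl (V.map φ) S = φ (pl V S) := by
  by_cases h : S.card = k
  · rw [pl_of_card h, pl_of_card h, RingHom.map_det]
    rfl
  · rw [pl_of_card_ne h, pl_of_card_ne h, map_zero]

theorem pl_mul (V : Matrix (Fin n) (Fin k) K) (W : Matrix (Fin k) (Fin k) K)
    (S : Finset (Fin n)) : pl (V * W) S = pl V S * W.det := by
  by_cases h : S.card = k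
  · rw [pl_of_card h, pl_of_card h, ← Matrix.det_mul]
    rfl
  · rw [pl_of_card_ne h, pl_of_card_ne h, zero_mul]

/-- Any `k` vectors in the column space of `V` have maximal minors proportional to the Plücker
coordinates of `V`, with a factor independent of the row set. This is how determinants built from
`om` are recognised as Plücker coordinates. -/
theorem rowDet_mulVec (V : Matrix (Fin n) (Fin k) K) (ws : List (Fin k → K))
    (hw : ws.length = k) (S : Finset (Fin n)) :
    rowDet (ws.map V.mulVec) S = pl V S * rowDet ws Finset.univ := by
  by_cases h : S.card = k
  · obtain ⟨w, rfl⟩ : ∃ w : Fin k → Fin k → K, ws = List.ofFn w := by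
      exact ⟨fun u => ws.get (u.cast hw.symm),
        List.ext_getElem (by simp [hw]) fun i _ _ => by simp⟩
    have e : (List.ofFn w).map V.mulVec = List.ofFn fun u => V.mulVec (w u) := by
      rw [List.map_ofFn]
      rfl
    have e' : (Finset.univ : Finset (Fin k)) = Finset.univ.image (id : Fin k → Fin k) := by simp
    rw [e, rowDet_ofFn_orderEmb h, pl_of_card h, e', rowDet_ofFn strictMono_id, ← Matrix.det_mul]
    rfl
  · rw [pl_of_card_ne h, zero_mul, rowDet_eq_zero_of_card]
    rwa [List.length_map, hw]

/-- An element `y` of `I` has `y` elements below it, some in `I` and some in the complement; those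
in `I` add up to a binomial coefficient, whose sign may be moved across the equality. -/
theorem crossings_compl (I : Finset (Fin n)) :
    (-1 : K) ^ crossings I Iᶜ = (-1) ^ (I.card.choose 2) * ∏ i ∈ I, (-1) ^ (i : ℕ) := by
  have h1 : ∑ y ∈ I, ((I.filter (· < y)).card + (Iᶜ.filter (· < y)).card) =
      ∑ y ∈ I, (y : ℕ) := by
    refine Finset.sum_congr rfl fun y _ => ?_
    rw [← Finset.card_union_of_disjoint, ← Finset.filter_union, Finset.union_compl,
      Finset.filter_gt_eq_Iio, Fin.card_Iio]
    exact Finset.disjoint_filter_filter disjoint_compl_right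
  have h2 : ∑ y ∈ I, (I.filter (· < y)).card = I.card.choose 2 := by
    have e : I = Finset.univ.image (I.orderEmbOfFin rfl) := (image_orderEmbOfFin rfl).symm
    conv_lhs => rw [e]
    rw [Finset.sum_image fun _ _ _ _ h => (I.orderEmbOfFin rfl).injective h]
    simp only [card_filter_lt_image (I.orderEmbOfFin rfl).strictMono]
    rw [Fin.sum_univ_eq_sum_range (fun i => i), Finset.sum_range_id, Nat.choose_two_right]
  rw [Finset.prod_pow_eq_pow_sum, ← h1, Finset.sum_add_distrib, h2, crossings, ← pow_add,
    ← add_assoc, pow_add _ (_ + _), ← two_mul, pow_mul]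
  simp

theorem rowDet_pi_single {r : ℕ} {J : Finset (Fin n)} (hJ : J.card = r) :
    rowDet (List.ofFn fun u => (Pi.single (J.orderEmbOfFin hJ u) 1 : Fin n → K)) J = 1 := by
  have e : (Matrix.of fun s u => (Pi.single (J.orderEmbOfFin hJ u) 1 : Fin n → K)
      (J.orderEmbOfFin hJ s)) = 1 := by
    ext s u
    simp only [Matrix.of_apply, Matrix.one_apply, Pi.single_apply,
      (J.orderEmbOfFin hJ).injective.eq_iff]
  rw [rowDet_ofFn_orderEmb hJ, e, Matrix.det_one]

/-- Jacobi's complementary minor theorem. -/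
theorem jacobi_minor {A B : Matrix (Fin n) (Fin n) K} {c : K} (hAB : A * B = c • 1) {r s : ℕ}
    {I J : Finset (Fin n)} (hI : I.card = r) (hJ : J.card = r) (hI' : Iᶜ.card = s)
    (hJ' : Jᶜ.card = s) :
    A.det * ((∏ j ∈ J, (-1) ^ (j : ℕ)) *
        (B.submatrix (Jᶜ.orderEmbOfFin hJ') (Iᶜ.orderEmbOfFin hI')).det) =
      (∏ i ∈ I, (-1) ^ (i : ℕ)) *
        (c ^ s * (A.submatrix (I.orderEmbOfFin hI) (J.orderEmbOfFin hJ)).det) := by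
  have hrs : r + s = n := by rw [← hI, ← hI', Finset.card_add_card_compl, Fintype.card_fin]
  -- The columns are the unit vectors of `J` followed by the columns of `B` outside `I`.
  -- Multiplication by `A` sends them to the columns `J` of `A` and to `c` times the unit vectors
  -- outside `I`. Laplace expansion before and after has a single surviving term each time, and
  -- comparing the two gives the identity.
  set cs : List (Fin n → K) := List.ofFn fun u => Pi.single (J.orderEmbOfFin hJ u) 1 with hcs
  set ds : List (Fin n → K) := List.ofFn fun u => B.col (Iᶜ.orderEmbOfFin hI' u) with hds
  have hlen : (cs ++ ds).length = n := by simp [hcs, hds, hrs]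
  have key := rowDet_mulVec A (cs ++ ds) hlen Finset.univ
  have hA : pl A Finset.univ = A.det := by
    have := pl_image A strictMono_id
    rwa [Finset.image_id, Matrix.submatrix_id_id] at this
  have h1 : rowDet (cs ++ ds) Finset.univ = (-1) ^ crossings J Jᶜ *
      (B.submatrix (Jᶜ.orderEmbOfFin hJ') (Iᶜ.orderEmbOfFin hI')).det := by
    rw [rowDet_append, Finset.sum_eq_single J]
    · rw [← Finset.compl_eq_univ_sdiff, hcs, rowDet_pi_single, mul_one, hds,
        rowDet_ofFn_orderEmb hJ']
      rfl
    · intro S _ hS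
      by_cases hc : S.card = r
      · obtain ⟨i, hi, hi'⟩ : ∃ i ∈ S, i ∉ J := by
          by_contra! hsub
          exact hS (Finset.eq_of_subset_of_card_le hsub (by omega))
        rw [rowDet_eq_zero_of_row hi, mul_zero, zero_mul]
        intro c hc
        obtain ⟨u, rfl⟩ := List.mem_ofFn.1 hc
        refine Pi.single_eq_of_ne ?_ _
        rintro rfl
        exact hi' (Finset.orderEmbOfFin_mem _ _ _)
      · rw [rowDet_eq_zero_of_card (by simpa [hcs] using hc), mul_zero, zero_mul]
    · simp
  have h2 : rowDet ((cs ++ ds).map A.mulVec) Finset.univ = (-1) ^ crossings I Iᶜ *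
      (A.submatrix (I.orderEmbOfFin hI) (J.orderEmbOfFin hJ)).det * c ^ s := by
    have e1 : cs.map A.mulVec = List.ofFn fun u => A.col (J.orderEmbOfFin hJ u) := by
      rw [hcs, List.map_ofFn]
      congr 1
      funext u
      simp
    have e2 : ds.map A.mulVec =
        List.ofFn fun u => (c • Pi.single (Iᶜ.orderEmbOfFin hI' u) 1 : Fin n → K) := by
      rw [hds, List.map_ofFn]
      congr 1
      funext u
      ext i
      have := congrFun (congrFun hAB i) (Iᶜ.orderEmbOfFin hI' u)
      simp only [Matrix.smul_apply, Matrix.one_apply] at this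
      simp only [Function.comp_apply, Pi.smul_apply, Pi.single_apply]
      exact this
    rw [List.map_append, e1, e2, rowDet_append, Finset.sum_eq_single I]
    · rw [← Finset.compl_eq_univ_sdiff]
      congr 1
      · rw [rowDet_ofFn_orderEmb hI]
        rfl
      · have := rowDet_pi_single (K := K) hI'
        rw [rowDet_ofFn_orderEmb hI'] at this ⊢
        have h3 := Matrix.det_smul (Matrix.of fun t u =>
          (Pi.single (Iᶜ.orderEmbOfFin hI' u) 1 : Fin n → K) (Iᶜ.orderEmbOfFin hI' t)) c
        rw [Fintype.card_fin] at h3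
        exact h3.trans ((congrArg (c ^ s * ·) this).trans (mul_one _))
    · intro S _ hS
      by_cases hc : S.card = r
      · obtain ⟨i, hi, hi'⟩ : ∃ i ∈ I, i ∉ S := by
          by_contra! hsub
          exact hS (Finset.eq_of_subset_of_card_le hsub (by omega)).symm
        refine mul_eq_zero_of_right _ (rowDet_eq_zero_of_row (i := i) (by simp [hi']) ?_)
        intro d hd
        obtain ⟨u, rfl⟩ := List.mem_ofFn.1 hd
        have : i ≠ Iᶜ.orderEmbOfFin hI' u := by
          rintro rfl
          exact Finset.mem_compl.1 (Finset.orderEmbOfFin_mem _ _ _) hi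
        simp [this]
      · rw [rowDet_eq_zero_of_card (cs := List.ofFn _) (by simpa using hc), mul_zero, zero_mul]
    · simp
  rw [hA, h1, h2, crossings_compl, crossings_compl, hI, hJ] at key
  have hu : (-1 : K) ^ r.choose 2 * (-1) ^ r.choose 2 = 1 := by
    rw [← mul_pow]; simp
  calc _ = (-1 : K) ^ r.choose 2 * (-1) ^ r.choose 2 * (A.det * ((∏ j ∈ J, (-1) ^ (j : ℕ)) *
        (B.submatrix (Jᶜ.orderEmbOfFin hJ') (Iᶜ.orderEmbOfFin hI')).det)) := by rw [hu, one_mul]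
    _ = (-1 : K) ^ r.choose 2 * ((-1 : K) ^ r.choose 2 * (∏ i ∈ I, (-1) ^ (i : ℕ)) *
        (A.submatrix (I.orderEmbOfFin hI) (J.orderEmbOfFin hJ)).det * c ^ s) := by
        rw [key]; ring
    _ = (-1 : K) ^ r.choose 2 * (-1) ^ r.choose 2 * ((∏ i ∈ I, (-1) ^ (i : ℕ)) *
        (c ^ s * (A.submatrix (I.orderEmbOfFin hI) (J.orderEmbOfFin hJ)).det)) := by ring
    _ = _ := by rw [hu, one_mul]

/-- The Cauchy–Binet formula, in symmetrized form. -/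
theorem factorial_mul_det_mul {ι : Type*} [Fintype ι] [DecidableEq ι]
    (A : Matrix (Fin k) ι K) (B : Matrix ι (Fin k) K) :
    (k.factorial : K) * (A * B).det =
      ∑ f : Fin k → ι, (A.submatrix id f).det * (B.submatrix f id).det := by
  -- Multilinearity in the columns gives a sum over maps `f`; reindexing `f` by `τ` inserts the sign
  -- of `τ`. Summing over all `τ` assembles the determinant of `B` and produces the factor `k!`,
  -- which is harmless for positivity and spares a choice of representatives of the image sets.
  have h : ∀ τ : Equiv.Perm (Fin k), (A * B).det =
      ∑ f : Fin k → ι, (∏ s, B (f (τ s)) s) * ((Equiv.Perm.sign τ : ℤ) : K) *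
        (A.submatrix id f).det := by
    intro τ
    have h1 : (A * B).det = ∑ f : Fin k → ι, (∏ s, B (f s) s) * (A.submatrix id f).det := by
      rw [← Matrix.det_transpose]
      have : (A * B).transpose = fun s => ∑ i : ι, B i s • A.transpose i := by
        ext s t
        simp [Matrix.mul_apply, Finset.sum_apply, mul_comm]
      rw [this]
      have := (Matrix.detRowAlternating (n := Fin k) (R := K)).map_sum
        (g := fun s i => B i s • A.transpose i)
      refine this.trans (Finset.sum_congr rfl fun f _ => ?_)
      have h2 := (Matrix.detRowAlternating (n := Fin k) (R := K)).map_smul_univ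
        (fun s => B (f s) s) (fun s => A.transpose (f s))
      refine h2.trans ?_
      rw [smul_eq_mul, ← Matrix.det_transpose (A.submatrix id f)]
      rfl
    rw [h1]
    refine Fintype.sum_equiv (Equiv.arrowCongr τ (Equiv.refl ι)) _ _ fun f => ?_
    have e1 : ∀ s, (Equiv.arrowCongr τ (Equiv.refl ι)) f (τ s) = f s := by
      intro s
      simp
    have e2 : A.submatrix id ((Equiv.arrowCongr τ (Equiv.refl ι)) f) =
        (A.submatrix id f).submatrix id τ.symm := by
      ext s u
      simp
    simp only [e1]
    have hs : ((Equiv.Perm.sign τ : ℤ) : K) * ((Equiv.Perm.sign τ : ℤ) : K) = 1 := by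
      rw [← Int.cast_mul, ← Units.val_mul, Int.units_mul_self]
      simp
    rw [e2, Matrix.det_permute', Equiv.Perm.sign_symm, mul_assoc,
      ← mul_assoc ((Equiv.Perm.sign τ : ℤ) : K), hs, one_mul]
  have h' : ∑ _τ : Equiv.Perm (Fin k), (A * B).det = ∑ τ : Equiv.Perm (Fin k),
      ∑ f : Fin k → ι, (∏ s, B (f (τ s)) s) * ((Equiv.Perm.sign τ : ℤ) : K) *
        (A.submatrix id f).det := Finset.sum_congr rfl fun τ _ => h τ
  rw [Finset.sum_const, Finset.card_univ, Fintype.card_perm, Fintype.card_fin, nsmul_eq_mul] at h'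
  rw [h', Finset.sum_comm]
  refine Finset.sum_congr rfl fun f _ => ?_
  rw [← Finset.sum_mul, mul_comm, Matrix.det_apply' (B.submatrix f id)]
  congr 1
  refine Finset.sum_congr rfl fun τ _ => ?_
  rw [mul_comm]
  rfl

end Plucker

/-! ### Noncrossing matchings and products of two Plücker coordinates -/

section Matchings

variable {n : ℕ}

/-- A noncrossing partial matching of `Fin n` (the involution `m`), together with a marking `d` of
the unmatched elements. -/
structure Matching (n : ℕ) where
  /-- the matching -/
  m : Fin n → Fin n
  /-- the marking -/
  d : Fin n → Prop
  invol : ∀ x, m (m x) = x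
  noncrossing : ∀ x y, x < y → y < m x → m x < m y → False

/-- A pair of sets is compatible with a marked noncrossing matching if both sets contain the marked
points, neither contains the other unmatched points, and each contains exactly one end of every arc,
not the same one. -/
def Matching.Compat (τ : Matching n) (S T : Finset (Fin n)) : Prop :=
  ∀ x, (τ.m x = x → (x ∈ S ↔ τ.d x) ∧ (x ∈ T ↔ τ.d x)) ∧
    (τ.m x ≠ x → (x ∈ S ↔ x ∉ T) ∧ (x ∈ S ↔ τ.m x ∈ T))

open Classical in
/-- The indicator function of compatibility. -/
noncomputable def Matching.ind (K : Type*) [CommRing K] (τ : Matching n)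
    (S T : Finset (Fin n)) : K :=
  if τ.Compat S T then 1 else 0

/-- The cone spanned by the compatibility indicators, with coefficients in a semiring `Q`. -/
def tlCone {K : Type*} [CommRing K] (n : ℕ) (Q : Subsemiring K) :
    AddSubmonoid (Finset (Fin n) → Finset (Fin n) → K) :=
  AddSubmonoid.closure {φ | ∃ c ∈ Q, ∃ τ : Matching n, φ = fun S T => c * τ.ind K S T}

variable {K : Type*} [CommRing K] {Q : Subsemiring K}

theorem smul_ind_mem_tlCone {c : K} (hc : c ∈ Q) (τ : Matching n) :
    (fun S T => c * τ.ind K S T) ∈ tlCone n Q :=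
  AddSubmonoid.subset_closure ⟨c, hc, τ, rfl⟩

/-- Reduces a statement about the cone to a single matching: closure properties and the positivity
of signed sums are all tested on generators through a suitable additive map `E`. -/
theorem tlCone_induction {L : Type*} [AddCommMonoid L]
    (E : (Finset (Fin n) → Finset (Fin n) → K) →+ L) (M : AddSubmonoid L)
    (h : ∀ c ∈ Q, ∀ τ : Matching n, E (fun S T => c * τ.ind K S T) ∈ M)
    {φ : Finset (Fin n) → Finset (Fin n) → K} (hφ : φ ∈ tlCone n Q) : E φ ∈ M := by
  have : tlCone n Q ≤ M.comap E := by
    refine (AddSubmonoid.closure_le).2 ?_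
    rintro _ ⟨c, hc, τ, rfl⟩
    exact h c hc τ
  exact this hφ

/-- The function `(S, T) ↦ P S * P T` on `k`-element sets lies in the cone. -/
def IsTL (k : ℕ) (Q : Subsemiring K) (P : Finset (Fin n) → K) : Prop :=
  ∃ φ ∈ tlCone n Q, ∀ S T, S.card = k → T.card = k → P S * P T = φ S T

/-- Conjugation of a matching by a permutation which preserves noncrossing. -/
def Matching.conj (τ : Matching n) (e : Equiv.Perm (Fin n))
    (h : ∀ x y, x < y → y < e (τ.m (e.symm x)) →
      e (τ.m (e.symm x)) < e (τ.m (e.symm y)) → False) : Matching n where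
  m x := e (τ.m (e.symm x))
  d x := τ.d (e.symm x)
  invol x := by simp [τ.invol]
  noncrossing := h

theorem Matching.compat_conj (τ : Matching n) (e : Equiv.Perm (Fin n)) (h) (S T : Finset (Fin n)) :
    (τ.conj e h).Compat (S.map e.toEmbedding) (T.map e.toEmbedding) ↔ τ.Compat S T := by
  unfold Matching.Compat
  refine (e.forall_congr fun {x} => ?_).symm
  simp only [Matching.conj, Equiv.symm_apply_apply, ne_eq, EmbeddingLike.apply_eq_iff_eq]
  have hm : ∀ (y : Fin n) (U : Finset (Fin n)), e y ∈ U.map e.toEmbedding ↔ y ∈ U := by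
    intro y U
    simp
  simp only [hm]

theorem Matching.compat_conj' (τ : Matching n) (e : Equiv.Perm (Fin n)) (h) (S T : Finset (Fin n)) :
    (τ.conj e h).Compat S T ↔ τ.Compat (S.map e.symm.toEmbedding) (T.map e.symm.toEmbedding) := by
  rw [← τ.compat_conj e h]
  simp [Finset.map_map, ← Equiv.coe_trans]

/-- Moving the element `p` of a set to `p'`. -/
def moveElem (p p' : Fin n) (S : Finset (Fin n)) : Finset (Fin n) := insert p' (S.erase p)

/-- `S` can be changed by moving `p` to `p'`. -/
def Movable (p p' : Fin n) (S : Finset (Fin n)) : Prop := p ∈ S ∧ p' ∉ S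

section RowAdd

variable {p p' : Fin n} (τ : Matching n)

/-- The matching with the adjacent unmatched points `p'`, `p` joined. -/
def Matching.join (hp : p'.val + 1 = p.val) (h' : τ.m p' = p') (h : τ.m p = p) : Matching n where
  m x := if x = p then p' else if x = p' then p else τ.m x
  d := τ.d
  invol x := by
    have := τ.invol
    grind
  noncrossing x y h1 h2 h3 := by
    have := τ.noncrossing x y
    have hi := τ.invol
    have e : ∀ a b : Fin n, a < b ↔ a.val < b.val := fun _ _ => Iff.rfl
    have e' : ∀ a b : Fin n, a = b ↔ a.val = b.val := fun _ _ => Fin.ext_iff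
    grind

/-- At most one of the two neighbours is matched, so the swap preserves the order of any two matched
points, and only matched points can take part in a crossing. -/
theorem Matching.swap_noncrossing (hp : p'.val + 1 = p.val) (h : τ.m p' = p' ∨ τ.m p = p)
    (x y : Fin n) (h1 : x < y) (h2 : y < Equiv.swap p p' (τ.m ((Equiv.swap p p').symm x)))
    (h3 : Equiv.swap p p' (τ.m ((Equiv.swap p p').symm x)) <
      Equiv.swap p p' (τ.m ((Equiv.swap p p').symm y))) : False := by
  have hi := τ.invol
  have e : ∀ a b : Fin n, a < b ↔ a.val < b.val := fun _ _ => Iff.rfl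
  have e' : ∀ a b : Fin n, a = b ↔ a.val = b.val := fun _ _ => Fin.ext_iff
  have key : ∀ a b, τ.m a ≠ a → τ.m b ≠ b → Equiv.swap p p' a < Equiv.swap p p' b → a < b := by
    intro a b ha hb hab
    simp only [Equiv.swap_apply_def] at hab
    grind
  rw [Equiv.symm_swap] at h2 h3
  obtain ⟨a, rfl⟩ : ∃ a, Equiv.swap p p' a = x := ⟨Equiv.swap p p' x, by simp⟩
  obtain ⟨b, rfl⟩ : ∃ a, Equiv.swap p p' a = y := ⟨Equiv.swap p p' y, by simp⟩
  simp only [Equiv.swap_apply_self] at h2 h3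
  have ha : τ.m a ≠ a := by
    intro ha
    rw [ha] at h2
    exact lt_asymm h1 h2
  have hb : τ.m b ≠ b := by
    intro hb
    rw [hb] at h3
    exact lt_asymm h2 h3
  have ha' : τ.m (τ.m a) ≠ τ.m a := by rw [hi]; exact ha.symm
  have hb' : τ.m (τ.m b) ≠ τ.m b := by rw [hi]; exact hb.symm
  exact τ.noncrossing a b (key _ _ ha hb h1) (key _ _ hb ha' h2) (key _ _ ha' hb' h3)

/-- The matching in which the points matched to the adjacent points `p'` and `p` are joined, `p`
is marked and `p'` is not. -/
def Matching.reconnect (hp : p'.val + 1 = p.val) (h' : τ.m p' ≠ p') (h : τ.m p ≠ p) :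
    Matching n where
  m x := if x = p ∨ x = p' then x else if τ.m x = p then τ.m p'
    else if τ.m x = p' then τ.m p else τ.m x
  d x := x = p ∨ (x ≠ p' ∧ τ.d x)
  invol x := by
    have := τ.invol
    grind
  noncrossing x y h1 h2 h3 := by
    have hi := τ.invol
    have e : ∀ a b : Fin n, a < b ↔ a.val < b.val := fun _ _ => Iff.rfl
    have e' : ∀ a b : Fin n, a = b ↔ a.val = b.val := fun _ _ => Fin.ext_iff
    have hx : ¬(x = p ∨ x = p') := by
      intro hx
      rw [if_pos hx] at h2
      exact lt_asymm h1 h2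
    have hy : ¬(y = p ∨ y = p') := by
      intro hy
      rw [if_pos hy] at h3
      exact lt_asymm h2 h3
    rw [if_neg hx] at h2 h3
    rw [if_neg hy] at h3
    have mp : ∀ z, τ.m z = p → z = τ.m p := fun z hz => by rw [← hz, hi]
    have mp' : ∀ z, τ.m z = p' → z = τ.m p' := fun z hz => by rw [← hz, hi]
    have v : ∀ {a b : Fin n}, a ≠ b → a.val ≠ b.val := fun h h' => h (Fin.ext h')
    have hxp := v fun h => hx (Or.inl h)
    have hxp' := v fun h => hx (Or.inr h)
    have hyp := v fun h => hy (Or.inl h)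
    have hyp' := v fun h => hy (Or.inr h)
    have h1' : x.val < y.val := h1
    -- The only new arc joins the former partners of `p` and `p'`. Since `p'` and `p` are adjacent,
    -- an arc crossing it would already cross one of the old arcs ending at `p` or `p'`; the cases
    -- record which one.
    by_cases c1 : τ.m x = p
    · rw [if_pos c1] at h2 h3
      by_cases c3 : τ.m y = p
      · exact absurd ((mp x c1).trans (mp y c3).symm) h1.ne
      by_cases c4 : τ.m y = p'
      · exact absurd (mp' y c4) h2.ne
      rw [if_neg c3, if_neg c4] at h3
      have n1 := τ.noncrossing x y h1
      rw [c1] at n1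
      have n2 := τ.noncrossing y (τ.m p') h2 h3
      rw [hi] at n2
      have n3 := τ.noncrossing p' y
      have e3 := v c3
      have e4 := v c4
      rcases lt_or_gt_of_ne c3 with c5 | c5
      · refine n2 (Fin.lt_def.2 ?_)
        have := Fin.lt_def.1 c5
        omega
      rcases lt_or_gt_of_ne (fun h => hy (Or.inl h) : y ≠ p) with c6 | c6
      · refine n1 (Fin.lt_def.2 ?_) (Fin.lt_def.2 ?_)
        all_goals
          have := Fin.lt_def.1 c5
          have := Fin.lt_def.1 c6
          omega
      · refine n3 (Fin.lt_def.2 ?_) h2 h3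
        have := Fin.lt_def.1 c6
        omega
    rw [if_neg c1] at h2 h3
    by_cases c2 : τ.m x = p'
    · rw [if_pos c2] at h2 h3
      by_cases c3 : τ.m y = p
      · exact absurd (mp y c3) h2.ne
      by_cases c4 : τ.m y = p'
      · exact absurd ((mp' x c2).trans (mp' y c4).symm) h1.ne
      rw [if_neg c3, if_neg c4] at h3
      have n1 := τ.noncrossing x y h1
      rw [c2] at n1
      have n2 := τ.noncrossing y (τ.m p) h2 h3
      rw [hi] at n2
      have n3 := τ.noncrossing p y
      have e3 := v c3
      have e4 := v c4
      rcases lt_or_gt_of_ne c3 with c5 | c5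
      · refine n2 (Fin.lt_def.2 ?_)
        have := Fin.lt_def.1 c5
        omega
      rcases lt_or_gt_of_ne (fun h => hy (Or.inl h) : y ≠ p) with c6 | c6
      · refine n1 (Fin.lt_def.2 ?_) (Fin.lt_def.2 ?_)
        all_goals
          have := Fin.lt_def.1 c5
          have := Fin.lt_def.1 c6
          omega
      · refine n3 (Fin.lt_def.2 ?_) h2 h3
        have := Fin.lt_def.1 c6
        omega
    rw [if_neg c2] at h2 h3
    have := v c1
    have := v c2
    by_cases c3 : τ.m y = p
    · rw [if_pos c3] at h3
      have n1 := τ.noncrossing x y h1 h2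
      rw [c3] at n1
      have n2 := τ.noncrossing x p'
      have n3 := τ.noncrossing p x
      have e : τ.m p = y := by rw [← c3, hi]
      rw [e] at n3
      have c5 : ¬(τ.m x).val < (p : Fin n).val := fun h => n1 (Fin.lt_def.2 h)
      rcases lt_or_gt_of_ne (fun h => hx (by simp [h]) : x ≠ p') with c6 | c6
      · refine n2 c6 (Fin.lt_def.2 ?_) h3
        omega
      · refine n3 (Fin.lt_def.2 ?_) h1 h2
        have := Fin.lt_def.1 c6
        omega
    rw [if_neg c3] at h3
    by_cases c4 : τ.m y = p'
    · rw [if_pos c4] at h3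
      have n1 := τ.noncrossing x y h1 h2
      rw [c4] at n1
      have n2 := τ.noncrossing x p
      have n3 := τ.noncrossing p' x
      have e : τ.m p' = y := by rw [← c4, hi]
      rw [e] at n3
      have c5 : ¬(τ.m x).val < (p' : Fin n).val := fun h => n1 (Fin.lt_def.2 h)
      rcases lt_or_gt_of_ne (fun h => hx (by simp [h]) : x ≠ p) with c6 | c6
      · refine n2 c6 (Fin.lt_def.2 ?_) h3
        omega
      · refine n3 (Fin.lt_def.2 ?_) h1 h2
        have := Fin.lt_def.1 c6
        omega
    rw [if_neg c4] at h3
    exact τ.noncrossing x y h1 h2 h3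

/-- The effect of adding the row `p'` to the row `p` on products of two maximal minors. -/
noncomputable def rowAddOp (K : Type*) [CommRing K] (p p' : Fin n) :
    (Finset (Fin n) → Finset (Fin n) → K) →+ (Finset (Fin n) → Finset (Fin n) → K) :=
  open Classical in
  { toFun := fun φ S T => φ S T + (if Movable p p' S then φ (moveElem p p' S) T else 0) +
      (if Movable p p' T then φ S (moveElem p p' T) else 0) +
      (if Movable p p' S ∧ Movable p p' T then φ (moveElem p p' S) (moveElem p p' T) else 0)
    map_zero' := by
      funext S T
      simp
    map_add' := fun φ ψ => by
      funext S T
      simp only [Pi.add_apply]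
      split_ifs <;> ring }

theorem mem_moveElem {p p' x : Fin n} {S : Finset (Fin n)} :
    x ∈ moveElem p p' S ↔ x = p' ∨ (x ≠ p ∧ x ∈ S) := by
  simp [moveElem]

open Classical in
theorem rowAddOp_ind (S T : Finset (Fin n)) (c : K) : rowAddOp K p p' (fun S T => c * τ.ind K S T) S T =
    c * (τ.ind K S T + (if Movable p p' S ∧ τ.Compat (moveElem p p' S) T then 1 else 0) +
      (if Movable p p' T ∧ τ.Compat S (moveElem p p' T) then 1 else 0) +
      (if (Movable p p' S ∧ Movable p p' T) ∧
        τ.Compat (moveElem p p' S) (moveElem p p' T) then 1 else 0)) := by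
  simp only [rowAddOp, AddMonoidHom.coe_mk, ZeroHom.coe_mk, Matching.ind, ite_and, mul_add]
  split_ifs <;> simp

theorem Matching.compat_fixed {τ : Matching n} {S T : Finset (Fin n)} (h : τ.Compat S T)
    {x : Fin n} (hx : τ.m x = x) : (x ∈ S ↔ τ.d x) ∧ (x ∈ T ↔ τ.d x) := (h x).1 hx

/-- A moved set contains `p'` and not `p`. If `p'` is free and unmarked, or `p` is free and marked,
no compatible pair contains such a set, and only the unmoved term remains. -/
theorem rowAddOp_unchanged (hpp : p ≠ p')
    (h : (τ.m p' = p' ∧ ¬τ.d p') ∨ (τ.m p = p ∧ τ.d p)) (c : K) :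
    rowAddOp K p p' (fun S T => c * τ.ind K S T) = fun S T => c * τ.ind K S T := by
  have key : ∀ U W, p' ∈ U → p ∉ U → ¬τ.Compat U W ∧ ¬τ.Compat W U := by
    intro U W h1 h2
    constructor <;> intro hc <;> rcases h with ⟨h, h'⟩ | ⟨h, h'⟩ <;>
      have := τ.compat_fixed hc h <;> tauto
  have key' : ∀ S W, ¬τ.Compat (moveElem p p' S) W ∧ ¬τ.Compat W (moveElem p p' S) := by
    intro S W
    refine key _ W ?_ ?_ <;> rw [mem_moveElem]
    · exact Or.inl rfl
    · tauto
  funext S T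
  rw [rowAddOp_ind]
  simp [(key' _ _).1, (key' _ _).2]

theorem Matching.compat_comm {τ : Matching n} {S T : Finset (Fin n)} :
    τ.Compat S T ↔ τ.Compat T S := by
  have key : ∀ S T : Finset (Fin n), τ.Compat S T → τ.Compat T S := by
    intro S T h x
    refine ⟨fun hx => ((h x).1 hx).symm, fun hx => ?_⟩
    have h1 := (h x).2 hx
    have h2 := (h (τ.m x)).2 (by rw [τ.invol]; exact hx.symm)
    rw [τ.invol] at h2
    tauto
  exact ⟨key S T, key T S⟩

theorem mem_map_swap {p p' x : Fin n} {S : Finset (Fin n)} :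
    x ∈ S.map (Equiv.swap p p').toEmbedding ↔ (if x = p then p' else if x = p' then p else x) ∈ S := by
  rw [← Equiv.swap_apply_def]
  constructor
  · intro h
    obtain ⟨y, hy, rfl⟩ := Finset.mem_map.1 h
    simpa using hy
  · intro h
    exact Finset.mem_map.2 ⟨_, h, by simp⟩

section Reconnect

variable (hp : p'.val + 1 = p.val) (h' : τ.m p' ≠ p') (h : τ.m p ≠ p)
include hp h' h

theorem Matching.movable_compat_iff_reconnect (hne : τ.m p ≠ p') (S T : Finset (Fin n)) :
    Movable p p' S ∧ τ.Compat (moveElem p p' S) T ↔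
      (τ.reconnect hp h' h).Compat S T ∧ τ.m p ∈ S := by
  have hi := τ.invol
  have hpp : p ≠ p' := fun h => by rw [h] at hp; omega
  have e1 := hi p
  have e2 := hi p'
  constructor
  · rintro ⟨⟨h1, h2⟩, hc⟩
    have c1 := hc p
    have c2 := hc p'
    have c3 := hc (τ.m p)
    have c4 := hc (τ.m p')
    simp only [mem_moveElem] at c1 c2 c3 c4
    refine ⟨fun x => ?_, by grind⟩
    have c5 := hc x
    have e3 := hi x
    simp only [mem_moveElem] at c5
    simp only [Matching.reconnect]
    grind
  · rintro ⟨hc, hm⟩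
    have c1 := hc p
    have c2 := hc p'
    have c3 := hc (τ.m p)
    have c4 := hc (τ.m p')
    simp only [Matching.reconnect] at c1 c2 c3 c4
    refine ⟨⟨by grind, by grind⟩, fun x => ?_⟩
    have c5 := hc x
    have e3 := hi x
    simp only [Matching.reconnect] at c5
    simp only [mem_moveElem]
    grind

/-- Moving `p` to `p'` in one of the two sets forces `p` into both original sets and `p'` into
neither. The two single moves split the pairs compatible with the reconnected matching according to
which set contains `τ.m p`; a double move puts `p'` in both sets and is impossible. -/
theorem rowAddOp_reconnect (hne : τ.m p ≠ p') (c : K) :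
    rowAddOp K p p' (fun S T => c * τ.ind K S T) =
      (fun S T => c * τ.ind K S T) + fun S T => c * (τ.reconnect hp h' h).ind K S T := by
  classical
  have key := τ.movable_compat_iff_reconnect hp h' h hne
  funext S T
  have k1 := key S T
  have k2 := key T S
  rw [Matching.compat_comm, (τ.reconnect hp h' h).compat_comm] at k2
  have k3 : ¬((Movable p p' S ∧ Movable p p' T) ∧
      τ.Compat (moveElem p p' S) (moveElem p p' T)) := by
    rintro ⟨-, hc⟩
    have := (hc p').2 h'
    simp [mem_moveElem] at this
  have k4 : (τ.reconnect hp h' h).Compat S T → (τ.m p ∈ S ↔ τ.m p ∉ T) := by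
    intro hc
    have hpp : p ≠ p' := fun h => by rw [h] at hp; omega
    have hi := τ.invol
    refine ((hc (τ.m p)).2 ?_).1
    simp only [Matching.reconnect]
    grind
  rw [rowAddOp_ind, if_neg k3, Pi.add_apply, Pi.add_apply, ← mul_add]
  simp only [k1, k2]
  simp only [Matching.ind]
  by_cases hc : (τ.reconnect hp h' h).Compat S T
  · have := k4 hc
    by_cases hm : τ.m p ∈ S <;> simp [hc, hm] <;> simp_all
  · simp [hc]

theorem Matching.movable_compat_iff_pair (hne : τ.m p = p') (S T : Finset (Fin n)) :
    Movable p p' S ∧ τ.Compat (moveElem p p' S) T ↔ (τ.reconnect hp h' h).Compat S T := by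
  have hi := τ.invol
  have hpp : p ≠ p' := fun h => by rw [h] at hp; omega
  have e1 := hi p
  have e2 := hi p'
  constructor
  · rintro ⟨⟨h1, h2⟩, hc⟩
    have c1 := hc p
    have c2 := hc p'
    simp only [mem_moveElem] at c1 c2
    refine fun x => ?_
    have c5 := hc x
    have e3 := hi x
    simp only [mem_moveElem] at c5
    simp only [Matching.reconnect]
    grind
  · intro hc
    have c1 := hc p
    have c2 := hc p'
    simp only [Matching.reconnect] at c1 c2
    refine ⟨⟨by grind, by grind⟩, fun x => ?_⟩
    have c5 := hc x
    have e3 := hi x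
    simp only [Matching.reconnect] at c5
    simp only [mem_moveElem]
    grind

/-- Here the partners of `p` and `p'` are these points themselves, so each of the two single moves
contributes the whole indicator of the reconnected matching. It therefore occurs twice, like the
closed loop of the Temperley–Lieb algebra. -/
theorem rowAddOp_pair (hne : τ.m p = p') (c : K) :
    rowAddOp K p p' (fun S T => c * τ.ind K S T) =
      (fun S T => c * τ.ind K S T) + (fun S T => c * (τ.reconnect hp h' h).ind K S T) +
        fun S T => c * (τ.reconnect hp h' h).ind K S T := by
  classical
  have key := τ.movable_compat_iff_pair hp h' h hne
  funext S T
  have k1 := key S T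
  have k2 := key T S
  rw [Matching.compat_comm, (τ.reconnect hp h' h).compat_comm] at k2
  have k3 : ¬((Movable p p' S ∧ Movable p p' T) ∧
      τ.Compat (moveElem p p' S) (moveElem p p' T)) := by
    rintro ⟨-, hc⟩
    have := (hc p').2 h'
    simp [mem_moveElem] at this
  rw [rowAddOp_ind, if_neg k3, Pi.add_apply, Pi.add_apply, Pi.add_apply, Pi.add_apply, ← mul_add,
    ← mul_add, add_zero]
  simp only [k1, k2, Matching.ind]

end Reconnect

/-- For a pair compatible with the swapped matching exactly one of the two sets is movable, and
moving it has the effect of swapping `p` and `p'` in both sets. -/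
theorem rowAddOp_swap (hp : p'.val + 1 = p.val)
    (h : (τ.m p' = p' ∧ τ.d p' ∧ τ.m p ≠ p) ∨ (τ.m p' ≠ p' ∧ τ.m p = p ∧ ¬τ.d p)) (c : K) :
    rowAddOp K p p' (fun S T => c * τ.ind K S T) =
      (fun S T => c * τ.ind K S T) + fun S T => c * (τ.conj (Equiv.swap p p')
        (τ.swap_noncrossing hp (by tauto))).ind K S T := by
  classical
  set τ' := τ.conj (Equiv.swap p p') (τ.swap_noncrossing hp (by tauto)) with hτ'
  have hi := τ.invol
  have hpp : p ≠ p' := fun h => by rw [h] at hp; omega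
  have hc' : ∀ S T, τ'.Compat S T ↔ τ.Compat (S.map (Equiv.swap p p').toEmbedding)
      (T.map (Equiv.swap p p').toEmbedding) := by
    intro S T
    rw [hτ', Matching.compat_conj', Equiv.symm_swap]
  have key : ∀ S T, Movable p p' S ∧ τ.Compat (moveElem p p' S) T ↔
      τ'.Compat S T ∧ Movable p p' S := by
    intro S T
    rw [hc', and_comm]
    refine and_congr_left fun hm => ?_
    unfold Movable at hm
    constructor
    · intro hc x
      have c1 := hc p
      have c2 := hc p'
      have c3 := hc x
      simp only [mem_moveElem] at c1 c2 c3
      simp only [mem_map_swap]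
      grind
    · intro hc x
      have c1 := hc p
      have c2 := hc p'
      have c3 := hc x
      simp only [mem_map_swap] at c1 c2 c3
      simp only [mem_moveElem]
      grind
  funext S T
  have k1 := key S T
  have k2 := key T S
  rw [Matching.compat_comm, τ'.compat_comm] at k2
  have k3 : ¬((Movable p p' S ∧ Movable p p' T) ∧
      τ.Compat (moveElem p p' S) (moveElem p p' T)) := by
    rintro ⟨-, hc⟩
    have c1 := hc p
    have c2 := hc p'
    simp only [mem_moveElem] at c1 c2
    grind
  have k4 : τ'.Compat S T → (Movable p p' S ↔ ¬Movable p p' T) := by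
    rw [hc']
    intro hc
    have c1 := hc p
    have c2 := hc p'
    simp only [mem_map_swap] at c1 c2
    unfold Movable
    grind
  rw [rowAddOp_ind, if_neg k3, Pi.add_apply, Pi.add_apply, ← mul_add]
  simp only [k1, k2]
  simp only [Matching.ind]
  by_cases hc : τ'.Compat S T
  · have := k4 hc
    by_cases hm : Movable p p' S <;> simp [hc, hm] <;> simp_all
  · simp [hc]

/-- With `p'` marked and `p` not, a single move is possible when `p` lies in one original set and
`p'` in the other, which is an arc from `p'` to `p`. The double move accounts for the pairs with `p`
in both sets and `p'` in neither, where the marks are swapped. -/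
theorem rowAddOp_join (hp : p'.val + 1 = p.val) (h' : τ.m p' = p') (h : τ.m p = p)
    (hd' : τ.d p') (hd : ¬τ.d p) (c : K) :
    rowAddOp K p p' (fun S T => c * τ.ind K S T) =
      (fun S T => c * τ.ind K S T) + (fun S T => c * (τ.join hp h' h).ind K S T) +
        fun S T => c * (τ.conj (Equiv.swap p p')
          (τ.swap_noncrossing hp (Or.inl h'))).ind K S T := by
  classical
  set τ' := τ.conj (Equiv.swap p p') (τ.swap_noncrossing hp (Or.inl h')) with hτ'
  have hi := τ.invol
  have hpp : p ≠ p' := fun h => by rw [h] at hp; omega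
  have hc' : ∀ S T, τ'.Compat S T ↔ τ.Compat (S.map (Equiv.swap p p').toEmbedding)
      (T.map (Equiv.swap p p').toEmbedding) := by
    intro S T
    rw [hτ', Matching.compat_conj', Equiv.symm_swap]
  have key : ∀ S T, Movable p p' S ∧ τ.Compat (moveElem p p' S) T ↔
      (τ.join hp h' h).Compat S T ∧ Movable p p' S := by
    intro S T
    rw [and_comm]
    refine and_congr_left fun hm => ?_
    unfold Movable at hm
    constructor
    · intro hc x
      have c1 := hc p
      have c2 := hc p'
      have c3 := hc x
      have c4 := hi x
      simp only [mem_moveElem] at c1 c2 c3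
      simp only [Matching.join]
      grind
    · intro hc x
      have c1 := hc p
      have c2 := hc p'
      have c3 := hc x
      have c4 := hi x
      simp only [Matching.join] at c1 c2 c3
      simp only [mem_moveElem]
      grind
  funext S T
  have k1 := key S T
  have k2 := key T S
  rw [Matching.compat_comm, (τ.join hp h' h).compat_comm] at k2
  have k3 : ((Movable p p' S ∧ Movable p p' T) ∧
      τ.Compat (moveElem p p' S) (moveElem p p' T)) ↔ τ'.Compat S T := by
    rw [hc']
    constructor
    · rintro ⟨⟨h1, h2⟩, hc⟩ x
      have c1 := hc p
      have c2 := hc p'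
      have c3 := hc x
      unfold Movable at h1 h2
      simp only [mem_moveElem] at c1 c2 c3
      simp only [mem_map_swap]
      grind
    · intro hc
      have c1 := hc p
      have c2 := hc p'
      simp only [mem_map_swap] at c1 c2
      unfold Movable
      refine ⟨by grind, fun x => ?_⟩
      have c3 := hc x
      simp only [mem_map_swap] at c3
      simp only [mem_moveElem]
      grind
  have k4 : (τ.join hp h' h).Compat S T → (Movable p p' S ↔ ¬Movable p p' T) := by
    intro hc
    have c1 := hc p
    have c2 := hc p'
    simp only [Matching.join] at c1 c2
    unfold Movable
    grind
  rw [rowAddOp_ind, Pi.add_apply, Pi.add_apply, Pi.add_apply, Pi.add_apply, ← mul_add, ← mul_add]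
  simp only [k1, k2, k3]
  simp only [Matching.ind]
  by_cases hc : (τ.join hp h' h).Compat S T
  · have := k4 hc
    by_cases hm : Movable p p' S <;> simp [hc, hm] <;> simp_all
  · simp [hc]

/-- The heart of the positivity: in each configuration of the two adjacent points, a generator is
sent to a sum of at most three generators with the same coefficient. -/
theorem rowAddOp_mem_tlCone (hp : p'.val + 1 = p.val)
    {φ : Finset (Fin n) → Finset (Fin n) → K} (hφ : φ ∈ tlCone n Q) :
    rowAddOp K p p' φ ∈ tlCone n Q := by
  refine tlCone_induction _ _ (fun c hc τ => ?_) hφ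
  have hpp : p ≠ p' := fun h => by rw [h] at hp; omega
  have hm := fun τ => smul_ind_mem_tlCone (n := n) hc τ
  by_cases h' : τ.m p' = p' <;> by_cases h : τ.m p = p
  · by_cases hd' : τ.d p'
    · by_cases hd : τ.d p
      · rw [rowAddOp_unchanged τ hpp (Or.inr ⟨h, hd⟩)]
        exact hm _
      · rw [rowAddOp_join τ hp h' h hd' hd]
        exact add_mem (add_mem (hm _) (hm _)) (hm _)
    · rw [rowAddOp_unchanged τ hpp (Or.inl ⟨h', hd'⟩)]
      exact hm _
  · by_cases hd' : τ.d p'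
    · rw [rowAddOp_swap τ hp (Or.inl ⟨h', hd', h⟩)]
      exact add_mem (hm _) (hm _)
    · rw [rowAddOp_unchanged τ hpp (Or.inl ⟨h', hd'⟩)]
      exact hm _
  · by_cases hd : τ.d p
    · rw [rowAddOp_unchanged τ hpp (Or.inr ⟨h, hd⟩)]
      exact hm _
    · rw [rowAddOp_swap τ hp (Or.inr ⟨h', h, hd⟩)]
      exact add_mem (hm _) (hm _)
  · by_cases hne : τ.m p = p'
    · rw [rowAddOp_pair τ hp h' h hne]
      exact add_mem (add_mem (hm _) (hm _)) (hm _)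
    · rw [rowAddOp_reconnect τ hp h' h hne]
      exact add_mem (hm _) (hm _)

end RowAdd

end Matchings

/-! ### Stability of the cone under symmetries and row operations. -/

section Cones

variable {n k : ℕ} {K : Type*} [CommRing K] {Q : Subsemiring K}

/-! #### Symmetries of the cone -/

theorem IsTL.comp_map {P : Finset (Fin n) → K} (h : IsTL k Q P) (e : Equiv.Perm (Fin n))
    (he : ∀ (τ : Matching n) (x y : Fin n), x < y → y < e.symm (τ.m (e x)) →
      e.symm (τ.m (e x)) < e.symm (τ.m (e y)) → False) :
    IsTL k Q fun S => P (S.map e.toEmbedding) := by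
  obtain ⟨φ, hφ, hP⟩ := h
  refine ⟨fun S T => φ (S.map e.toEmbedding) (T.map e.toEmbedding), ?_, fun S T hS hT =>
    hP _ _ (by simpa) (by simpa)⟩
  let E : (Finset (Fin n) → Finset (Fin n) → K) →+ (Finset (Fin n) → Finset (Fin n) → K) :=
    { toFun := fun φ S T => φ (S.map e.toEmbedding) (T.map e.toEmbedding)
      map_zero' := rfl
      map_add' := fun _ _ => rfl }
  refine tlCone_induction E _ (fun c hc τ => ?_) hφ
  convert smul_ind_mem_tlCone hc (τ.conj e.symm (he τ)) using 4 with S T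
  classical
  refine congrArg (c * ·) (if_congr ?_ rfl rfl)
  rw [Matching.compat_conj', Equiv.symm_symm]

theorem finRotate_val (i : Fin n) :
    (finRotate n i).val = if i.val + 1 = n then 0 else i.val + 1 := by
  cases n with
  | zero => exact i.elim0
  | succ m =>
    split_ifs with h
    · have : i = Fin.last m := Fin.ext (by simpa using h)
      rw [this, finRotate_last]
      rfl
    · rw [finRotate_of_lt (by omega)]

theorem IsTL.rotate {P : Finset (Fin n) → K} (h : IsTL k Q P) :
    IsTL k Q fun S => P (S.map (finRotate n).toEmbedding) := by
  refine h.comp_map _ fun τ x y h1 h2 h3 => ?_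
  obtain ⟨a, ha⟩ : ∃ a, finRotate n a = τ.m (finRotate n x) := ⟨_, Equiv.apply_symm_apply _ _⟩
  obtain ⟨b, hb⟩ : ∃ a, finRotate n a = τ.m (finRotate n y) := ⟨_, Equiv.apply_symm_apply _ _⟩
  rw [← ha, Equiv.symm_apply_apply] at h2 h3
  rw [← hb, Equiv.symm_apply_apply] at h3
  have n1 := τ.noncrossing (finRotate n x) (finRotate n y)
  have n2 := τ.noncrossing (finRotate n b) (finRotate n x)
  have hb' : τ.m (finRotate n b) = finRotate n y := by rw [hb, τ.invol]
  rw [hb', ← ha] at n2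
  rw [← ha, ← hb] at n1
  simp only [Fin.lt_def, finRotate_val] at n1 n2 h1 h2 h3
  -- Among crossing ends `x < y < a < b` only `b` can be carried from the last position to the
  -- first; the four images then cross in the order `b, x, y, a`.
  by_cases hbn : b.val + 1 = n
  · refine n2 ?_ ?_ ?_ <;> split_ifs <;> omega
  · refine n1 ?_ ?_ ?_ <;> split_ifs <;> omega

theorem IsTL.rev {P : Finset (Fin n) → K} (h : IsTL k Q P) :
    IsTL k Q fun S => P (S.map Fin.revPerm.toEmbedding) := by
  refine h.comp_map _ fun τ x y h1 h2 h3 => ?_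
  simp only [Fin.revPerm_symm, Fin.revPerm_apply] at h2 h3
  have n1 := τ.noncrossing (τ.m y.rev) (τ.m x.rev)
  rw [τ.invol, τ.invol] at n1
  refine n1 ?_ ?_ ?_
  · rwa [← Fin.rev_lt_rev]
  · rw [← Fin.rev_lt_rev, Fin.rev_rev]
    exact h2
  · rwa [Fin.rev_lt_rev]

/-- The matching with the complementary marking. -/
def Matching.compl (τ : Matching n) : Matching n where
  m := τ.m
  d x := ¬τ.d x
  invol := τ.invol
  noncrossing := τ.noncrossing

/-- Complementing both sets still leaves one end of every arc in each, and turns marked free points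
into unmarked ones. -/
theorem IsTL.compl {P : Finset (Fin n) → K} (h : IsTL k Q P) (hk : k ≤ n) :
    IsTL (n - k) Q fun S => P Sᶜ := by
  obtain ⟨φ, hφ, hP⟩ := h
  refine ⟨fun S T => φ Sᶜ Tᶜ, ?_, fun S T hS hT =>
    hP _ _ (by rw [Finset.card_compl, hS, Fintype.card_fin]; omega)
      (by rw [Finset.card_compl, hT, Fintype.card_fin]; omega)⟩
  let E : (Finset (Fin n) → Finset (Fin n) → K) →+ (Finset (Fin n) → Finset (Fin n) → K) :=
    { toFun := fun φ S T => φ Sᶜ Tᶜ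
      map_zero' := rfl
      map_add' := fun _ _ => rfl }
  refine tlCone_induction E _ (fun c hc τ => ?_) hφ
  convert smul_ind_mem_tlCone hc τ.compl using 4 with S T
  have : τ.Compat Sᶜ Tᶜ ↔ τ.compl.Compat S T := by
    refine forall_congr' fun x => ?_
    simp only [Finset.mem_compl, Matching.compl]
    tauto
  classical
  exact congrArg (c * ·) (if_congr this rfl rfl)

/-! #### Row operations -/

theorem submatrix_updateRow_of_notMem (V : Matrix (Fin n) (Fin k) K) {p : Fin n} (r : Fin k → K)
    {f : Fin k → Fin n} (h : ∀ s, f s ≠ p) :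
    (V.updateRow p r).submatrix f id = V.submatrix f id := by
  ext s t
  simp [Matrix.updateRow_ne (h s)]

theorem submatrix_updateRow_of_eq (V : Matrix (Fin n) (Fin k) K) {p : Fin n} (r : Fin k → K)
    {f : Fin k → Fin n} (hf : Function.Injective f) {s : Fin k} (h : f s = p) :
    (V.updateRow p r).submatrix f id = (V.submatrix f id).updateRow s r := by
  ext t u
  by_cases ht : t = s
  · subst ht
    simp [h]
  · have : f t ≠ p := fun h' => ht (hf (h'.trans h.symm))
    simp [Matrix.updateRow_ne ht, Matrix.updateRow_ne this]

theorem pl_scaleRow (V : Matrix (Fin n) (Fin k) K) (p : Fin n) (x : K) (S : Finset (Fin n)) :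
    pl (V.updateRow p (x • V p)) S = (if p ∈ S then x else 1) * pl V S := by
  by_cases h : S.card = k
  · rw [pl_of_card h, pl_of_card h]
    have hf := (S.orderEmbOfFin h).injective
    split_ifs with hp
    · obtain ⟨s, hs⟩ : ∃ s, S.orderEmbOfFin h s = p := by
        have : p ∈ Set.range (S.orderEmbOfFin h) := by simpa using hp
        exact this
      rw [submatrix_updateRow_of_eq V _ hf hs]
      have e : V p = (V.submatrix (S.orderEmbOfFin h) id) s := by
        rw [← hs]
        rfl
      rw [e, Matrix.det_updateRow_smul, Matrix.updateRow_eq_self]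
    · rw [submatrix_updateRow_of_notMem V _, one_mul]
      rintro s rfl
      exact hp (Finset.orderEmbOfFin_mem _ _ _)
  · rw [pl_of_card_ne h, pl_of_card_ne h, mul_zero]

theorem card_moveElem {p p' : Fin n} {S : Finset (Fin n)} (h : Movable p p' S) :
    (moveElem p p' S).card = S.card := by
  have hp : p' ∉ S.erase p := fun hp => h.2 (Finset.mem_of_mem_erase hp)
  rw [moveElem, Finset.card_insert_of_notMem hp, Finset.card_erase_of_mem h.1]
  have := Finset.card_pos.2 ⟨p, h.1⟩
  omega

-- Linearity in the row `p`. Replacing `p` by its predecessor `p'` leaves the order of the rows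
-- unchanged, so no sign appears; if `p'` already belongs to `S` there are two equal rows.
open Classical in
theorem pl_addRow (V : Matrix (Fin n) (Fin k) K) {p p' : Fin n} (hp : p'.val + 1 = p.val)
    (S : Finset (Fin n)) :
    pl (V.updateRow p (V p + V p')) S =
      pl V S + if Movable p p' S then pl V (moveElem p p' S) else 0 := by
  by_cases h : S.card = k
  · have hf := (S.orderEmbOfFin h).strictMono
    by_cases hpS : p ∈ S
    · obtain ⟨s, hs⟩ : ∃ s, S.orderEmbOfFin h s = p := by
        have : p ∈ Set.range (S.orderEmbOfFin h) := by simpa using hpS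
        exact this
      have e : V p = (V.submatrix (S.orderEmbOfFin h) id) s := by
        rw [← hs]
        rfl
      rw [pl_of_card h, pl_of_card h, submatrix_updateRow_of_eq V _ hf.injective hs,
        Matrix.det_updateRow_add]
      congr 1
      · rw [e, Matrix.updateRow_eq_self]
      · split_ifs with hm
        · rw [pl_of_card ((card_moveElem hm).trans h)]
          have hg : ∀ t, t ≠ s → S.orderEmbOfFin h t ≠ p' := fun t _ h' => hm.2 (by
            rw [← h']; exact Finset.orderEmbOfFin_mem _ _ _)
          have e2 : ⇑((moveElem p p' S).orderEmbOfFin ((card_moveElem hm).trans h)) =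
              Function.update (S.orderEmbOfFin h) s p' := by
            refine orderEmbOfFin_image ?_ ?_ _
            · intro t u htu
              have h1 := hf htu
              by_cases ht : t = s
              · subst ht
                have hu : u ≠ t := htu.ne'
                rw [Function.update_self, Function.update_of_ne hu]
                rw [hs] at h1
                rw [Fin.lt_def] at h1 ⊢
                omega
              · rw [Function.update_of_ne ht]
                by_cases hu : u = s
                · subst hu
                  rw [Function.update_self]
                  have h2 := hg t ht
                  rw [hs] at h1
                  rw [Fin.lt_def] at h1 ⊢
                  have : (S.orderEmbOfFin h t).val ≠ p'.val := fun h' => h2 (Fin.ext h')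
                  omega
                · rw [Function.update_of_ne hu]
                  exact h1
            · ext x
              rw [mem_moveElem]
              simp only [Finset.mem_image, Finset.mem_univ, true_and]
              constructor
              · rintro (rfl | ⟨h1, h2⟩)
                · exact ⟨s, Function.update_self _ _ _⟩
                · obtain ⟨t, ht⟩ : ∃ t, S.orderEmbOfFin h t = x := by
                    have : x ∈ Set.range (S.orderEmbOfFin h) := by simpa using h2
                    exact this
                  refine ⟨t, ?_⟩
                  rw [Function.update_of_ne, ht]
                  rintro rfl
                  exact h1 (ht.symm.trans hs)
              · rintro ⟨t, rfl⟩
                by_cases ht : t = s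
                · subst ht
                  exact Or.inl (Function.update_self _ _ _)
                · rw [Function.update_of_ne ht]
                  refine Or.inr ⟨fun h' => ht (hf.injective (h'.trans hs.symm)),
                    Finset.orderEmbOfFin_mem _ _ _⟩
          rw [e2]
          congr 1
          ext t u
          by_cases ht : t = s
          · subst ht
            simp
          · simp [Matrix.updateRow_ne ht, Function.update_of_ne ht]
        · have hp' : p' ∈ S := by
            by_contra hp'
            exact hm ⟨hpS, hp'⟩
          obtain ⟨t, ht⟩ : ∃ t, S.orderEmbOfFin h t = p' := by
            have : p' ∈ Set.range (S.orderEmbOfFin h) := by simpa using hp'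
            exact this
          have hts : t ≠ s := by
            rintro rfl
            rw [hs] at ht
            rw [ht] at hp
            omega
          refine Matrix.det_zero_of_row_eq hts ?_
          rw [Matrix.updateRow_ne hts, Matrix.updateRow_self, ← ht]
          rfl
    · rw [if_neg fun hm => hpS hm.1, add_zero, pl_of_card h, pl_of_card h,
        submatrix_updateRow_of_notMem V _]
      rintro s rfl
      exact hpS (Finset.orderEmbOfFin_mem _ _ _)
  · rw [pl_of_card_ne h, pl_of_card_ne h]
    split_ifs with hm
    · rw [pl_of_card_ne (by rwa [card_moveElem hm]), add_zero]
    · rw [add_zero]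

theorem IsTL.addRow {V : Matrix (Fin n) (Fin k) K} (h : IsTL k Q (pl V)) {p p' : Fin n}
    (hp : p'.val + 1 = p.val) : IsTL k Q (pl (V.updateRow p (V p + V p'))) := by
  classical
  obtain ⟨φ, hφ, hP⟩ := h
  refine ⟨_, rowAddOp_mem_tlCone hp hφ, fun S T hS hT => ?_⟩
  have hS' : Movable p p' S → (moveElem p p' S).card = k := fun h => (card_moveElem h).trans hS
  have hT' : Movable p p' T → (moveElem p p' T).card = k := fun h => (card_moveElem h).trans hT
  rw [pl_addRow V hp, pl_addRow V hp]
  simp only [rowAddOp, AddMonoidHom.coe_mk, ZeroHom.coe_mk]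
  by_cases h1 : Movable p p' S <;> by_cases h2 : Movable p p' T <;>
    simp only [h1, h2, if_true, if_false, and_true, and_false]
  · rw [← hP _ _ hS hT, ← hP _ _ (hS' h1) hT, ← hP _ _ hS (hT' h2), ← hP _ _ (hS' h1) (hT' h2)]
    ring
  · rw [← hP _ _ hS hT, ← hP _ _ (hS' h1) hT]
    ring
  · rw [← hP _ _ hS hT, ← hP _ _ hS (hT' h2)]
    ring
  · rw [← hP _ _ hS hT]
    ring

/-- The weight produced by scaling is constant on the pairs compatible with one matching: `x²` or
`1` if `p` is free, according to its mark, and `x` if `p` is matched, since then exactly one set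
contains it. -/
theorem IsTL.scaleRow {V : Matrix (Fin n) (Fin k) K} (h : IsTL k Q (pl V)) (p : Fin n) {x : K}
    (hx : x ∈ Q) : IsTL k Q (pl (V.updateRow p (x • V p))) := by
  classical
  obtain ⟨φ, hφ, hP⟩ := h
  let E : (Finset (Fin n) → Finset (Fin n) → K) →+ (Finset (Fin n) → Finset (Fin n) → K) :=
    { toFun := fun φ S T => (if p ∈ S then x else 1) * (if p ∈ T then x else 1) * φ S T
      map_zero' := by
        funext S T
        simp
      map_add' := fun φ ψ => by
        funext S T
        simp only [Pi.add_apply]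
        ring }
  refine ⟨E φ, ?_, fun S T hS hT => ?_⟩
  · refine tlCone_induction E _ (fun c hc τ => ?_) hφ
    have key : ∀ a ∈ Q, (∀ S T, τ.Compat S T →
        (if p ∈ S then x else 1) * (if p ∈ T then x else 1) = a) →
        E (fun S T => c * τ.ind K S T) ∈ tlCone n Q := by
      intro a ha hE
      convert smul_ind_mem_tlCone (Q.mul_mem ha hc) τ using 1
      funext S T
      simp only [E, AddMonoidHom.coe_mk, ZeroHom.coe_mk, Matching.ind]
      by_cases hST : τ.Compat S T
      · rw [if_pos hST, hE S T hST]
        ring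
      · rw [if_neg hST, mul_zero, mul_zero, mul_zero]
    by_cases hm : τ.m p = p
    · by_cases hd : τ.d p
      · refine key _ (Q.mul_mem hx hx) fun S T hST => ?_
        have := (hST p).1 hm
        rw [if_pos (this.1.2 hd), if_pos (this.2.2 hd)]
      · refine key _ Q.one_mem fun S T hST => ?_
        have := (hST p).1 hm
        rw [if_neg (fun h => hd (this.1.1 h)), if_neg (fun h => hd (this.2.1 h)), mul_one]
    · refine key _ hx fun S T hST => ?_
      have := ((hST p).2 hm).1
      by_cases hpS : p ∈ S
      · rw [if_pos hpS, if_neg (this.1 hpS), mul_one]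
      · rw [if_neg hpS, if_pos (by tauto), one_mul]
  · rw [pl_scaleRow, pl_scaleRow]
    simp only [E, AddMonoidHom.coe_mk, ZeroHom.coe_mk]
    rw [← hP _ _ hS hT]
    ring

/-! #### Bidiagonal products -/

/-- The product of a lower bidiagonal matrix (with diagonal entries `x p`, and subdiagonal entries
one in the rows satisfying `y` and zero elsewhere) with `V`. -/
def bidiagMul (x : Fin n → K) (y : ℕ → Prop) [DecidablePred y] (V : Matrix (Fin n) (Fin k) K) :
    Matrix (Fin n) (Fin k) K := Matrix.of fun p s =>
  x p * V p s + if y p.val ∧ 0 < p.val then V ⟨p.val - 1, by omega⟩ s else 0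

theorem IsTL.bidiagMul {V : Matrix (Fin n) (Fin k) K} (h : IsTL k Q (pl V)) {x : Fin n → K}
    (hx : ∀ p, x p ∈ Q) (y : ℕ → Prop) [DecidablePred y] :
    IsTL k Q (pl (bidiagMul x y V)) := by
  -- The rows are treated from the bottom up, `q` being the number already done, so that the row
  -- above is still an original row of `V` when it is added.
  have key : ∀ q : ℕ, q ≤ n → IsTL k Q (pl (Matrix.of fun p s =>
      if n ≤ p.val + q then GeomR.bidiagMul x y V p s else V p s)) := by
    intro q
    induction q with
    | zero =>
      intro _
      convert h using 2
      ext p s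
      rw [Matrix.of_apply, if_neg (by omega)]
    | succ q ih =>
      intro hq
      have h1 := ih (by omega)
      set W : Matrix (Fin n) (Fin k) K := Matrix.of fun p s =>
        if n ≤ p.val + q then GeomR.bidiagMul x y V p s else V p s with hW
      set p₀ : Fin n := ⟨n - q - 1, by omega⟩ with hp₀
      have hp₀v : p₀.val = n - q - 1 := rfl
      have h2 := h1.scaleRow p₀ (hx p₀)
      have hW0 : ∀ s, W p₀ s = V p₀ s := fun s => by
        rw [hW, Matrix.of_apply, if_neg (by omega)]
      by_cases hy : y p₀.val ∧ 0 < p₀.val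
      · have h3 := h2.addRow (p := p₀) (p' := ⟨p₀.val - 1, by omega⟩)
          (by simp only; omega)
        convert h3 using 2
        ext p s
        by_cases hp : p = p₀
        · subst hp
          rw [Matrix.of_apply, if_pos (by omega), Matrix.updateRow_self, Pi.add_apply,
            Matrix.updateRow_self, Matrix.updateRow_ne (by
              intro h'
              have := congrArg Fin.val h'
              simp only at this
              omega), Pi.smul_apply, hW0, GeomR.bidiagMul, Matrix.of_apply, if_pos hy, hW,
            Matrix.of_apply, if_neg (by simp only; omega)]
          rfl
        · have : p.val ≠ p₀.val := fun h' => hp (Fin.ext h')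
          rw [Matrix.updateRow_ne hp, Matrix.updateRow_ne hp, hW, Matrix.of_apply, Matrix.of_apply]
          by_cases hpq : n ≤ p.val + q
          · rw [if_pos hpq, if_pos (by omega)]
          · rw [if_neg hpq, if_neg (by omega)]
      · convert h2 using 2
        ext p s
        by_cases hp : p = p₀
        · subst hp
          rw [Matrix.of_apply, if_pos (by omega), Matrix.updateRow_self, Pi.smul_apply, hW0,
            GeomR.bidiagMul, Matrix.of_apply, if_neg hy, add_zero]
          rfl
        · have : p.val ≠ p₀.val := fun h' => hp (Fin.ext h')
          rw [Matrix.updateRow_ne hp, hW, Matrix.of_apply, Matrix.of_apply]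
          by_cases hpq : n ≤ p.val + q
          · rw [if_pos hpq, if_pos (by omega)]
          · rw [if_neg hpq, if_neg (by omega)]
  convert key n le_rfl using 2
  ext p s
  rw [Matrix.of_apply, if_pos (by omega)]

/-- The `n × k` matrix with the identity matrix on top and zeros below. -/
def topIdentity (n k : ℕ) (K : Type*) [CommRing K] : Matrix (Fin n) (Fin k) K :=
  Matrix.of fun i s => if i.val = s.val then 1 else 0

theorem card_filter_val_lt (hk : k ≤ n) :
    (Finset.univ.filter fun i : Fin n => i.val < k).card = k := by
  have : (Finset.univ.filter fun i : Fin n => i.val < k) =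
      Finset.univ.image (Fin.castLE hk) := by
    ext x
    simp only [Finset.mem_filter, Finset.mem_univ, true_and, Finset.mem_image]
    constructor
    · intro h
      exact ⟨⟨x, h⟩, rfl⟩
    · rintro ⟨y, rfl⟩
      exact y.2
  rw [this, card_image_strictMono (Fin.strictMono_castLE hk)]

open Classical in
theorem pl_topIdentity (hk : k ≤ n) (S : Finset (Fin n)) (hS : S.card = k) :
    pl (topIdentity n k K) S = if S = Finset.univ.filter (fun i => i.val < k) then 1 else 0 := by
  split_ifs with h
  · have e : S = Finset.univ.image (Fin.castLE hk) := by
      rw [h]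
      ext x
      simp only [Finset.mem_filter, Finset.mem_univ, true_and, Finset.mem_image]
      constructor
      · intro h
        exact ⟨⟨x, h⟩, rfl⟩
      · rintro ⟨y, rfl⟩
        exact y.2
    rw [e, pl_image _ (Fin.strictMono_castLE hk)]
    convert Matrix.det_one (n := Fin k) (R := K) using 2
    ext s t
    simp [topIdentity, Matrix.one_apply, Fin.ext_iff]
  · obtain ⟨i, hi, hik⟩ : ∃ i ∈ S, k ≤ i.val := by
      by_contra! hS'
      refine h (Finset.eq_of_subset_of_card_le (fun i hi => by simp [hS' i hi]) ?_)
      rw [card_filter_val_lt hk, hS]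
    rw [pl_of_card hS]
    obtain ⟨s, hs⟩ : ∃ s, S.orderEmbOfFin hS s = i := by
      have : i ∈ Set.range (S.orderEmbOfFin hS) := by simpa using hi
      exact this
    refine Matrix.det_eq_zero_of_row_eq_zero s fun t => ?_
    rw [Matrix.submatrix_apply, hs, topIdentity, Matrix.of_apply, if_neg]
    have := t.2
    simp only [id]
    omega

/-- Only the set of the first `k` rows has a nonzero minor, so one matching without arcs, marking
these points, is enough. -/
theorem isTL_topIdentity (hk : k ≤ n) : IsTL k Q (pl (topIdentity n k K)) := by
  classical
  let τ : Matching n :=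
    { m := id
      d := fun x => x.val < k
      invol := fun _ => rfl
      noncrossing := fun x y h1 h2 _ => lt_asymm h1 h2 }
  refine ⟨_, smul_ind_mem_tlCone Q.one_mem τ, fun S T hS hT => ?_⟩
  have : τ.Compat S T ↔ S = Finset.univ.filter (fun i => i.val < k) ∧
      T = Finset.univ.filter (fun i => i.val < k) := by
    simp only [Matching.Compat, τ, Finset.ext_iff, Finset.mem_filter, Finset.mem_univ, true_and]
    constructor
    · intro h
      exact ⟨fun x => ((h x).1 rfl).1, fun x => ((h x).1 rfl).2⟩
    · intro h x
      exact ⟨fun _ => ⟨h.1 x, h.2 x⟩, fun h => absurd rfl h⟩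
  rw [pl_topIdentity hk S hS, pl_topIdentity hk T hT, Matching.ind, one_mul, ite_zero_mul_ite_zero,
    one_mul]
  simp only [this]

end Cones

/-! ### Signed sums over splittings of the row set, evaluated on one matching. -/

section TwoArcSum

variable {n : ℕ} {K : Type*} [CommRing K]

theorem crossings_sdiff {I S : Finset (Fin n)} (hS : S ⊆ I) :
    (-1 : K) ^ crossings S (I \ S) =
      (-1) ^ (S.card.choose 2) * ∏ i ∈ S, (-1) ^ (I.filter (· < i)).card := by
  have h1 : ∑ y ∈ S, ((S.filter (· < y)).card + ((I \ S).filter (· < y)).card) =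
      ∑ y ∈ S, (I.filter (· < y)).card := by
    refine Finset.sum_congr rfl fun y _ => ?_
    rw [← Finset.card_union_of_disjoint, ← Finset.filter_union, Finset.union_sdiff_of_subset hS]
    exact Finset.disjoint_filter_filter Finset.disjoint_sdiff
  have h2 : ∑ y ∈ S, (S.filter (· < y)).card = S.card.choose 2 := by
    have e : S = Finset.univ.image (S.orderEmbOfFin rfl) := (image_orderEmbOfFin rfl).symm
    conv_lhs => rw [e]
    rw [Finset.sum_image fun _ _ _ _ h => (S.orderEmbOfFin rfl).injective h]
    simp only [card_filter_lt_image (S.orderEmbOfFin rfl).strictMono]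
    rw [Fin.sum_univ_eq_sum_range (fun i => i), Finset.sum_range_id, Nat.choose_two_right]
  rw [Finset.prod_pow_eq_pow_sum, ← h1, Finset.sum_add_distrib, h2, crossings, ← pow_add,
    ← add_assoc, pow_add _ (_ + _), ← two_mul, pow_mul]
  simp

/-- The complement of `[0, b)` in the cyclic interval of length `k` ending at `b`. -/
def compA (n k b : ℕ) : Finset (Fin n) := Finset.univ.filter fun i => n + b ≤ i.val + k

/-- The complement of `[c, d)` in the cyclic interval of length `k` ending at `d`. -/
def compB (n k c d : ℕ) : Finset (Fin n) :=
  Finset.univ.filter fun i => (d ≤ i.val + k ∧ i.val < c) ∨ n + d ≤ i.val + k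

theorem mem_compA {k b : ℕ} {i : Fin n} : i ∈ compA n k b ↔ n + b ≤ i.val + k := by
  simp [compA]

theorem mem_compB {k c d : ℕ} {i : Fin n} :
    i ∈ compB n k c d ↔ (d ≤ i.val + k ∧ i.val < c) ∨ n + d ≤ i.val + k := by
  simp [compB]

theorem card_compA {k b : ℕ} (hb : b ≤ k) (hk : k ≤ n) : (compA n k b).card = k - b := by
  have h := Finset.card_filter_add_card_filter_not (s := (Finset.univ : Finset (Fin n)))
    (fun i : Fin n => n + b ≤ i.val + k)
  have h2 := card_filter_val_lt (n := n) (k := n + b - k) (by omega)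
  have h3 : (Finset.univ.filter fun i : Fin n => ¬(n + b ≤ i.val + k)) =
      Finset.univ.filter fun i : Fin n => i.val < n + b - k := by
    ext i
    simp only [Finset.mem_filter, Finset.mem_univ, true_and]
    omega
  rw [h3, h2, Finset.card_univ, Fintype.card_fin] at h
  unfold compA
  omega

/-- The ways of splitting `I` in the Laplace expansion along the columns `[0, b)` and `[c, d)`. -/
def splits (k b c d m : ℕ) (I : Finset (Fin n)) : Finset (Finset (Fin n)) :=
  I.powerset.filter fun S => S.card = b ∧ Disjoint (compA n k b) S ∧
    Disjoint (compB n k c d) (I \ S) ∧ ((I \ S).filter fun i => i.val < c).card = m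

variable {k b c d m : ℕ} {I : Finset (Fin n)} {τ : Matching n}

/-- Matched points strictly under an arc are matched among themselves, so `τ.m` is an involution
without fixed points on them; the parity is read off in `ZMod 2`. -/
theorem even_card_between (τ : Matching n) {x y : Fin n} (hxy : τ.m x = y) :
    Even (Finset.univ.filter fun z => x < z ∧ z < y ∧ τ.m z ≠ z).card := by
  have h : ∑ z ∈ Finset.univ.filter (fun z => x < z ∧ z < y ∧ τ.m z ≠ z), (1 : ZMod 2) = 0 := by
    refine Finset.sum_involution (fun z _ => τ.m z) (fun _ _ => by decide) ?_ ?_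
      fun z _ => τ.invol z
    · intro z hz _
      exact (Finset.mem_filter.1 hz).2.2.2
    · intro z hz
      simp only [Finset.mem_filter, Finset.mem_univ, true_and] at hz ⊢
      obtain ⟨h1, h2, h3⟩ := hz
      have n1 := τ.noncrossing x z h1 (hxy ▸ h2)
      have n2 := τ.noncrossing (τ.m z) x
      rw [τ.invol, hxy] at n2
      rw [hxy] at n1
      refine ⟨?_, ?_, ?_⟩
      · by_contra h
        rcases lt_or_eq_of_le (not_lt.1 h) with h | h
        · exact n2 h h1 h2
        · have := τ.invol z
          rw [h, hxy] at this
          exact absurd this h2.ne'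
      · by_contra h
        rcases lt_or_eq_of_le (not_lt.1 h) with h | h
        · exact n1 h
        · have := τ.invol z
          rw [← h, ← hxy, τ.invol] at this
          exact absurd this h1.ne
      · rw [τ.invol]
        exact h3.symm
  rw [Finset.sum_const, nsmul_eq_mul, mul_one, ZMod.natCast_eq_zero_iff] at h
  exact even_iff_two_dvd.2 h

theorem mem_splits {S : Finset (Fin n)} : S ∈ splits k b c d m I ↔ S ⊆ I ∧ S.card = b ∧
    Disjoint (compA n k b) S ∧ Disjoint (compB n k c d) (I \ S) ∧
      ((I \ S).filter fun i => i.val < c).card = m := by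
  rw [splits, Finset.mem_filter, Finset.mem_powerset]

/-- What compatibility says about an element of `I`. -/
theorem compat_of_mem {S : Finset (Fin n)} (hS : S ∈ splits k b c d m I)
    (hc : τ.Compat (compA n k b ∪ S) (compB n k c d ∪ (I \ S))) {x : Fin n} (hx : x ∈ S) :
    x ∉ compA n k b ∧ x ∈ I ∧ (τ.m x = x → x ∈ compB n k c d) ∧
      (τ.m x ≠ x → x ∉ compB n k c d ∧ τ.m x ∉ S ∧ τ.m x ∉ compA n k b ∧
        (τ.m x ∈ compB n k c d ∨ τ.m x ∈ I)) := by
  obtain ⟨h1, h2, h3, h4, h5⟩ := mem_splits.1 hS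
  have hxA : x ∉ compA n k b := fun h => Finset.disjoint_left.1 h3 h hx
  have hx1 := hc x
  have hx2 := hc (τ.m x)
  rw [τ.invol] at hx2
  simp only [Finset.mem_union, Finset.mem_sdiff] at hx1 hx2
  refine ⟨hxA, h1 hx, fun h => ?_, fun h => ?_⟩
  · have h6 := hx1.1 h
    simp only [hx, or_true, not_true, and_false, or_false, true_iff] at h6
    exact h6.2.2 h6.1
  · have h6 := hx1.2 h
    simp only [hx, or_true, not_true, and_false, or_false, true_iff] at h6
    have h7 := (hx2.2 h.symm).1
    rw [iff_not_comm] at h7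
    have h8 := not_or.1 (h7.1 h6.2)
    exact ⟨h6.1, h8.2, h8.1, h6.2.imp_right And.left⟩

theorem compat_of_mem' {S : Finset (Fin n)} (hS : S ∈ splits k b c d m I)
    (hc : τ.Compat (compA n k b ∪ S) (compB n k c d ∪ (I \ S))) {x : Fin n} (hx : x ∈ I)
    (hx' : x ∉ S) :
    x ∉ compB n k c d ∧ (τ.m x = x → x ∈ compA n k b) ∧
      (τ.m x ≠ x → x ∉ compA n k b ∧ τ.m x ∉ compB n k c d ∧
        (τ.m x ∈ compA n k b ∨ τ.m x ∈ S)) := by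
  obtain ⟨h1, h2, h3, h4, h5⟩ := mem_splits.1 hS
  have hxB : x ∉ compB n k c d := fun h =>
    Finset.disjoint_left.1 h4 h (Finset.mem_sdiff.2 ⟨hx, hx'⟩)
  have hx1 := hc x
  have hx2 := hc (τ.m x)
  rw [τ.invol] at hx2
  simp only [Finset.mem_union, Finset.mem_sdiff] at hx1 hx2
  refine ⟨hxB, fun h => ?_, fun h => ?_⟩
  · have h6 := hx1.1 h
    simp only [hx, hx', not_false_iff, and_true, or_true, or_false, true_iff] at h6
    exact h6.1.2 h6.2
  · have h6 := hx1.2 h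
    have h7 := hx2.2 h.symm
    simp only [hx, hx', not_false_iff, and_true, or_true, or_false, not_true, iff_false,
      iff_true] at h6 h7
    have h9 := not_or.1 (h7.1.1 h7.2)
    exact ⟨h6.1, h9.1, h7.2⟩

/-- An arc of `τ` with both ends in `I`, on the same side of `c`, gives a sign-reversing
involution. -/
theorem sum_sign_eq_zero {x y : Fin n} (hxy : τ.m x = y) (hlt : x < y) (hx : x ∈ I) (hy : y ∈ I)
    (hc : x.val < c ↔ y.val < c) [DecidablePred fun S : Finset (Fin n) =>
      τ.Compat (compA n k b ∪ S) (compB n k c d ∪ (I \ S))] :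
    ∑ S ∈ (splits k b c d m I).filter fun S =>
      τ.Compat (compA n k b ∪ S) (compB n k c d ∪ (I \ S)),
        (-1 : K) ^ crossings S (I \ S) = 0 := by
  have hyx : τ.m y = x := by rw [← hxy, τ.invol]
  -- exactly one end of the arc is in `S`
  have key : ∀ S ∈ splits k b c d m I, τ.Compat (compA n k b ∪ S) (compB n k c d ∪ (I \ S)) →
      (x ∈ S ↔ y ∉ S) ∧ x ∉ compA n k b ∧ x ∉ compB n k c d ∧ y ∉ compA n k b ∧
        y ∉ compB n k c d := by
    intro S hS hC
    by_cases hxS : x ∈ S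
    · have h := compat_of_mem hS hC hxS
      rw [hxy] at h
      have h2 := h.2.2.2 hlt.ne'
      have h3 := compat_of_mem' hS hC hy h2.2.1
      exact ⟨iff_of_true hxS h2.2.1, h.1, h2.1, h2.2.2.1, h3.1⟩
    · have h := compat_of_mem' hS hC hx hxS
      rw [hxy] at h
      have h2 := h.2.2 hlt.ne'
      by_cases hyS : y ∈ S
      · have h3 := compat_of_mem hS hC hyS
        exact ⟨iff_of_false hxS (not_not.2 hyS), h2.1, h.1, h3.1, h2.2.1⟩
      · have h3 := (compat_of_mem' hS hC hy hyS).2.2 (by rw [hyx]; exact hlt.ne)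
        exact absurd (h2.2.2.resolve_right hyS) h3.1
  have hI : ∀ z, Equiv.swap x y z ∈ I ↔ z ∈ I := by
    intro z
    rw [Equiv.swap_apply_def]
    split_ifs with h1 h2
    · rw [h1]; exact iff_of_true hy hx
    · rw [h2]; exact iff_of_true hx hy
    · rfl
  have hmem : ∀ (S : Finset (Fin n)) z, z ∈ S.map (Equiv.swap x y).toEmbedding ↔
      Equiv.swap x y z ∈ S := by
    intro S z
    rw [Finset.mem_map_equiv, Equiv.symm_swap]
  have hsd : ∀ S : Finset (Fin n), I \ S.map (Equiv.swap x y).toEmbedding =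
      (I \ S).map (Equiv.swap x y).toEmbedding := by
    intro S
    ext z
    rw [hmem, Finset.mem_sdiff, Finset.mem_sdiff, hmem, hI]
  refine Finset.sum_involution (fun S _ => S.map (Equiv.swap x y).toEmbedding) ?_ ?_ ?_ ?_
  · intro S hS
    obtain ⟨hS, hC⟩ := Finset.mem_filter.1 hS
    obtain ⟨h1, h2, h3, h4, h5⟩ := mem_splits.1 hS
    obtain ⟨k1, k2, k3, k4, k5⟩ := key S hS hC
    -- Because `x` and `y` lie on the same side of `c`, the points between them avoid `compA` and
    -- `compB`. By compatibility such a point belongs to `I` exactly when it is matched. There are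
    -- evenly many, so exchanging `x` and `y` reverses the sign.
    have hev : Even (I.filter fun z => x < z ∧ z < y).card := by
      convert even_card_between τ hxy using 2
      ext z
      simp only [Finset.mem_filter, Finset.mem_univ, true_and]
      constructor
      · rintro ⟨hz, hz1, hz2⟩
        refine ⟨hz1, hz2, fun hz3 => ?_⟩
        by_cases hzS : z ∈ S
        · have := (compat_of_mem hS hC hzS).2.2.1 hz3
          rw [mem_compB] at this k5
          rw [Fin.lt_def] at hz1 hz2
          omega
        · have := (compat_of_mem' hS hC hz hzS).2.1 hz3
          rw [mem_compA] at this k4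
          rw [Fin.lt_def] at hz1 hz2
          omega
      · rintro ⟨hz1, hz2, hz3⟩
        refine ⟨?_, hz1, hz2⟩
        have h6 := (hC z).2 hz3
        rw [mem_compA] at k4
        rw [mem_compB] at k5
        rw [Fin.lt_def] at hz1 hz2
        have hzA : z ∉ compA n k b := by
          rw [mem_compA]
          omega
        have hzB : z ∉ compB n k c d := by
          rw [mem_compB]
          omega
        simp only [Finset.mem_union, Finset.mem_sdiff, hzA, hzB, false_or] at h6
        by_contra hzI
        exact hzI (h1 (h6.1.2 fun h => hzI h.1))
    have hcard : (I.filter (· < y)).card =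
        (I.filter (· < x)).card + 1 + (I.filter fun z => x < z ∧ z < y).card := by
      have e : I.filter (· < y) =
          (insert x (I.filter (· < x))) ∪ I.filter fun z => x < z ∧ z < y := by
        ext z
        simp only [Finset.mem_filter, Finset.mem_union, Finset.mem_insert]
        constructor
        · rintro ⟨hz, hzy⟩
          rcases lt_trichotomy z x with h | h | h
          · exact Or.inl (Or.inr ⟨hz, h⟩)
          · exact Or.inl (Or.inl h)
          · exact Or.inr ⟨hz, h, hzy⟩
        · rintro ((rfl | h) | h)
          · exact ⟨hx, hlt⟩
          · exact ⟨h.1, h.2.trans hlt⟩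
          · exact ⟨h.1, h.2.2⟩
      rw [e, Finset.card_union_of_disjoint, Finset.card_insert_of_notMem]
      · simp
      · rw [Finset.disjoint_left]
        intro z hz hz'
        simp only [Finset.mem_insert, Finset.mem_filter] at hz hz'
        rcases hz with rfl | h
        · exact lt_irrefl _ hz'.2.1
        · exact lt_asymm h.2 hz'.2.1
    have hsign : (-1 : K) ^ (I.filter (· < y)).card = -(-1) ^ (I.filter (· < x)).card := by
      rw [hcard, pow_add, pow_succ, hev.neg_one_pow]
      ring
    have hS' : S.map (Equiv.swap x y).toEmbedding ⊆ I := fun z hz =>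
      (hI z).1 (h1 ((hmem S z).1 hz))
    rw [crossings_sdiff h1, crossings_sdiff hS', Finset.card_map, Finset.prod_map, ← mul_add]
    simp only [Equiv.coe_toEmbedding]
    refine mul_eq_zero_of_right _ ?_
    by_cases hxS : x ∈ S
    · have e : ∀ z ∈ S.erase x, (-1 : K) ^ (I.filter (· < Equiv.swap x y z)).card =
          (-1) ^ (I.filter (· < z)).card := fun z hz => by
        have hz' : z ≠ x ∧ z ≠ y := ⟨Finset.ne_of_mem_erase hz, fun h => k1.1 hxS (h ▸ Finset.mem_of_mem_erase hz)⟩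
        rw [Equiv.swap_apply_of_ne_of_ne hz'.1 hz'.2]
      rw [← Finset.mul_prod_erase S _ hxS, ← Finset.mul_prod_erase S _ hxS,
        Finset.prod_congr rfl e, Equiv.swap_apply_left, hsign]
      ring
    · have hyS : y ∈ S := by
        by_contra hyS
        exact hxS (k1.2 hyS)
      have e : ∀ z ∈ S.erase y, (-1 : K) ^ (I.filter (· < Equiv.swap x y z)).card =
          (-1) ^ (I.filter (· < z)).card := fun z hz => by
        have hz' : z ≠ x ∧ z ≠ y := ⟨fun h => hxS (h ▸ Finset.mem_of_mem_erase hz), Finset.ne_of_mem_erase hz⟩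
        rw [Equiv.swap_apply_of_ne_of_ne hz'.1 hz'.2]
      rw [← Finset.mul_prod_erase S _ hyS, ← Finset.mul_prod_erase S _ hyS,
        Finset.prod_congr rfl e, Equiv.swap_apply_right, hsign]
      ring
  · intro S hS _ heq
    obtain ⟨hS, hC⟩ := Finset.mem_filter.1 hS
    have k1 := (key S hS hC).1
    have h1 := hmem S x
    rw [heq, Equiv.swap_apply_left, k1] at h1
    exact (iff_not_self h1.symm).elim
  · intro S hS
    obtain ⟨hS, hC⟩ := Finset.mem_filter.1 hS
    obtain ⟨h1, h2, h3, h4, h5⟩ := mem_splits.1 hS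
    obtain ⟨k1, k2, k3, k4, k5⟩ := key S hS hC
    have hA : ∀ z, Equiv.swap x y z ∈ compA n k b ↔ z ∈ compA n k b := by
      intro z
      rw [Equiv.swap_apply_def]
      split_ifs with h1 h2
      · rw [h1]; exact iff_of_false k4 k2
      · rw [h2]; exact iff_of_false k2 k4
      · rfl
    have hB : ∀ z, Equiv.swap x y z ∈ compB n k c d ↔ z ∈ compB n k c d := by
      intro z
      rw [Equiv.swap_apply_def]
      split_ifs with h1 h2
      · rw [h1]; exact iff_of_false k5 k3
      · rw [h2]; exact iff_of_false k3 k5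
      · rfl
    have hU : ∀ z, (Equiv.swap x y z).val < c ↔ z.val < c := by
      intro z
      rw [Equiv.swap_apply_def]
      split_ifs with h1 h2
      · subst h1; exact hc.symm
      · subst h2; exact hc
      · rfl
    refine Finset.mem_filter.2 ⟨mem_splits.2 ⟨?_, ?_, ?_, ?_, ?_⟩, ?_⟩
    · exact fun z hz => (hI z).1 (h1 ((hmem S z).1 hz))
    · rw [Finset.card_map, h2]
    · rw [Finset.disjoint_left]
      intro z hz hz'
      exact Finset.disjoint_left.1 h3 ((hA z).2 hz) ((hmem S z).1 hz')
    · rw [Finset.disjoint_left, hsd]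
      intro z hz hz'
      exact Finset.disjoint_left.1 h4 ((hB z).2 hz) ((hmem _ z).1 hz')
    · rw [hsd, Finset.filter_map, Finset.card_map, ← h5]
      congr 1
      refine Finset.filter_congr fun z _ => ?_
      exact hU z
    · rw [hsd]
      intro z
      have hz := hC z
      simp only [Finset.mem_union, hmem, Finset.mem_sdiff, hI] at hz ⊢
      by_cases hzx : z = x
      · subst hzx
        rw [hxy, Equiv.swap_apply_left, Equiv.swap_apply_right]
        simp only [hx, hy, k2, k3, k5, true_and, false_or, k1, not_not, hlt.ne', false_imp_iff,
          ne_eq, not_false_iff, true_imp_iff, iff_self, and_self]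
      · by_cases hzy : z = y
        · subst hzy
          rw [hyx, Equiv.swap_apply_left, Equiv.swap_apply_right]
          simp only [hx, hy, k3, k4, k5, true_and, false_or, k1, not_not, hlt.ne,
            false_imp_iff, ne_eq, not_false_iff, true_imp_iff, iff_self, and_self]
        · have h6 : τ.m z ≠ x := fun h => hzy (by rw [← hxy, ← h, τ.invol])
          have h7 : τ.m z ≠ y := fun h => hzx (by rw [← hyx, ← h, τ.invol])
          rw [Equiv.swap_apply_of_ne_of_ne hzx hzy, Equiv.swap_apply_of_ne_of_ne h6 h7]
          exact hz
  · intro S hS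
    ext z
    rw [hmem, hmem, Equiv.swap_apply_self]

/-- There is no arc of `τ` with ends in `I` on different sides of `c`. -/
theorem no_straddling_arc {S : Finset (Fin n)} (hS : S ∈ splits k b c d m I)
    (hC : τ.Compat (compA n k b ∪ S) (compB n k c d ∪ (I \ S))) (hbc : b ≤ c) (hcd : c ≤ d)
    (hk : b + (d - c) ≤ k) (hkn : k ≤ n) (hI : I.card = b + (d - c)) {x y : Fin n}
    (hxy : τ.m x = y) (hx : x ∈ I) (hy : y ∈ I) (hxc : x.val < c) (hyc : c ≤ y.val) : False := by
  obtain ⟨h1, h2, h3, h4, h5⟩ := mem_splits.1 hS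
  have hyx : τ.m y = x := by rw [← hxy, τ.invol]
  have hlt : x < y := by rw [Fin.lt_def]; omega
  have hz : ∃ z, (z = x ∨ z = y) ∧ z ∈ I \ S := by
    by_cases hxS : x ∈ S
    · refine ⟨y, Or.inr rfl, Finset.mem_sdiff.2 ⟨hy, ?_⟩⟩
      have h := compat_of_mem hS hC hxS
      rw [hxy] at h
      exact (h.2.2.2 hlt.ne').2.1
    · exact ⟨x, Or.inl rfl, Finset.mem_sdiff.2 ⟨hx, hxS⟩⟩
  have hout : x ∉ compB n k c d ∧ y ∉ compA n k b := by
    by_cases hxS : x ∈ S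
    · have h := (compat_of_mem hS hC hxS).2.2.2 (by rw [hxy]; exact hlt.ne')
      rw [hxy] at h
      exact ⟨h.1, h.2.2.1⟩
    · refine ⟨(compat_of_mem' hS hC hx hxS).1, ?_⟩
      by_cases hyS : y ∈ S
      · exact (compat_of_mem hS hC hyS).1
      · exact ((compat_of_mem' hS hC hy hyS).2.2 (by rw [hyx]; exact hlt.ne)).1
  obtain ⟨hxB, hyA⟩ := hout
  rw [mem_compB] at hxB
  rw [mem_compA] at hyA
  -- Every `a` in `compA` lies to the right of `y`, and its partner (or `a` itself) cannot lie in
  -- `compB` without crossing the arc from `x` to `y`. Thus `τ.m` injects the `k - b` points of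
  -- `compA` into `I \ S` minus one end of the arc, a set of fewer than `d - c ≤ k - b` points.
  have hinj : ∀ a ∈ compA n k b, τ.m a ∈ I \ S ∧ τ.m a ≠ x ∧ τ.m a ≠ y := by
    intro a ha
    have ha' := mem_compA.1 ha
    have hay : y < a := by rw [Fin.lt_def]; omega
    refine ⟨?_, ?_, ?_⟩
    · have hT : τ.m a ∈ compB n k c d ∪ (I \ S) := by
        have haS : a ∈ compA n k b ∪ S := Finset.mem_union_left _ ha
        by_cases hfix : τ.m a = a
        · rw [hfix]
          have h6 := (hC a).1 hfix
          exact h6.2.2 (h6.1.1 haS)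
        · exact ((hC a).2 hfix).2.1 haS
      refine (Finset.mem_union.1 hT).resolve_left fun hB => ?_
      rw [mem_compB] at hB
      have h6 := a.2
      have h8 : (τ.m a).val < c := by
        have := (τ.m a).2
        omega
      have h9 : x.val < (τ.m a).val := by omega
      have := τ.noncrossing x (τ.m a) h9 (by rw [hxy, Fin.lt_def]; omega)
      rw [hxy, τ.invol] at this
      exact this hay
    · intro h
      have : τ.m (τ.m a) = y := by rw [h, hxy]
      rw [τ.invol] at this
      exact hay.ne this.symm
    · intro h
      have : τ.m (τ.m a) = x := by rw [h, hyx]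
      rw [τ.invol] at this
      exact (hlt.trans hay).ne this.symm
  obtain ⟨z, hz, hzI⟩ := hz
  have hcard : ((compA n k b).image τ.m).card ≤ ((I \ S).erase z).card := by
    refine Finset.card_le_card fun w hw => ?_
    obtain ⟨a, ha, rfl⟩ := Finset.mem_image.1 hw
    have := hinj a ha
    refine Finset.mem_erase.2 ⟨?_, this.1⟩
    rcases hz with rfl | rfl
    · exact this.2.1
    · exact this.2.2
  rw [Finset.card_image_of_injective _ (fun u v h => by
      rw [← τ.invol u, h, τ.invol]), card_compA (by omega) hkn, Finset.card_erase_of_mem hzI,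
    Finset.card_sdiff_of_subset h1, hI, h2] at hcard
  have : 0 < (I \ S).card := Finset.card_pos.2 ⟨z, hzI⟩
  rw [Finset.card_sdiff_of_subset h1, hI, h2] at this
  omega

/-- If `τ` has no arcs with both ends in `I`, all the signs are the same. -/
theorem crossings_of_no_arc {S : Finset (Fin n)} (hS : S ∈ splits k b c d m I)
    (hC : τ.Compat (compA n k b ∪ S) (compB n k c d ∪ (I \ S))) (hbc : b ≤ c) (hcd : c ≤ d)
    (hdn : d ≤ n) (hno : ∀ x ∈ I, τ.m x ≠ x → τ.m x ∉ I) : crossings S (I \ S) = m * b := by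
  obtain ⟨h1, h2, h3, h4, h5⟩ := mem_splits.1 hS
  have inj : ∀ u v, τ.m u = τ.m v → u = v := fun u v h => by rw [← τ.invol u, h, τ.invol]
  have f1 : ∀ x ∈ S, x ∉ compA n k b ∧ (τ.m x = x → x ∈ compB n k c d) ∧
      (τ.m x ≠ x → τ.m x ∈ compB n k c d ∧ τ.m x ∉ compA n k b) := by
    intro x hx
    have h := compat_of_mem hS hC hx
    refine ⟨h.1, h.2.2.1, fun hne => ?_⟩
    have h6 := h.2.2.2 hne
    exact ⟨h6.2.2.2.resolve_right (hno x h.2.1 hne), h6.2.2.1⟩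
  have f2 : ∀ x ∈ I \ S, x ∉ compB n k c d ∧ (τ.m x = x → x ∈ compA n k b) ∧
      (τ.m x ≠ x → τ.m x ∈ compA n k b ∧ τ.m x ∉ compB n k c d) := by
    intro x hx
    rw [Finset.mem_sdiff] at hx
    have h := compat_of_mem' hS hC hx.1 hx.2
    refine ⟨h.1, h.2.1, fun hne => ?_⟩
    have h6 := h.2.2 hne
    exact ⟨h6.2.2.resolve_right fun h => hno x hx.1 hne (h1 h), h6.2.1⟩
  -- Below `c` the points of `I \ S` precede those of `S`, and from `c` on the order is reversed,
  -- since otherwise two arcs would cross. Hence each of the `b` points of `S` has before it exactly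
  -- the `m` points of `I \ S` below `c`.
  have hU : ∀ x ∈ S, ∀ y ∈ I \ S, x.val < c → y.val < c → y < x := by
    intro x hx y hy hxc hyc
    by_contra hlt
    have hne : x ≠ y := fun h => (Finset.mem_sdiff.1 hy).2 (h ▸ hx)
    have hlt : x < y := lt_of_le_of_ne (not_lt.1 hlt) hne
    obtain ⟨a1, a2, a3⟩ := f1 x hx
    obtain ⟨b1, b2, b3⟩ := f2 y hy
    rw [mem_compA] at a1 b2
    rw [mem_compB] at a2 b1
    rw [mem_compA, mem_compB] at a3 b3
    rw [Fin.lt_def] at hlt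
    by_cases hyf : τ.m y = y
    · have := b2 hyf
      omega
    · have b3 := b3 hyf
      by_cases hxf : τ.m x = x
      · have := a2 hxf
        omega
      · have a3 := a3 hxf
        have := (τ.m x).2
        have h6 := τ.noncrossing x y hlt
        simp only [Fin.lt_def] at h6
        have h7 : (τ.m x).val ≠ (τ.m y).val := fun h => hne (inj _ _ (Fin.ext h))
        by_cases h8 : (τ.m x).val < (τ.m y).val
        · exact h6 (by omega) h8
        · omega
  have hW : ∀ x ∈ S, ∀ y ∈ I \ S, c ≤ x.val → c ≤ y.val → x < y := by
    intro x hx y hy hxc hyc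
    by_contra hlt
    have hne : x ≠ y := fun h => (Finset.mem_sdiff.1 hy).2 (h ▸ hx)
    have hlt : y < x := lt_of_le_of_ne (not_lt.1 hlt) hne.symm
    obtain ⟨a1, a2, a3⟩ := f1 x hx
    obtain ⟨b1, b2, b3⟩ := f2 y hy
    rw [mem_compA] at a1 b2
    rw [mem_compB] at a2 b1
    rw [mem_compA, mem_compB] at a3 b3
    rw [Fin.lt_def] at hlt
    by_cases hyf : τ.m y = y
    · have := b2 hyf
      omega
    · have b3 := b3 hyf
      by_cases hxf : τ.m x = x
      · have := a2 hxf
        omega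
      · have a3 := a3 hxf
        have h7 : (τ.m x).val ≠ (τ.m y).val := fun h => hne (inj _ _ (Fin.ext h))
        have h9 : (τ.m x).val ≠ y.val := fun h => by
          have := (τ.invol x)
          rw [Fin.ext h] at this
          rw [this] at b3
          omega
        have h6 := τ.noncrossing y x hlt
        have h8 := τ.noncrossing (τ.m x) y
        rw [τ.invol] at h8
        simp only [Fin.lt_def] at h6 h8
        by_cases h10 : (τ.m x).val < y.val
        · exact h8 h10 hlt (by omega)
        · by_cases h11 : (τ.m y).val < (τ.m x).val
          · exact h6 (by omega) h11
          · omega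
  rw [crossings, Finset.sum_congr rfl (g := fun _ => m), Finset.sum_const, h2, smul_eq_mul,
    mul_comm]
  intro y hy
  rw [← h5]
  congr 1
  refine Finset.filter_congr fun x hx => ?_
  by_cases hyc : y.val < c
  · constructor
    · intro h
      rw [Fin.lt_def] at h
      omega
    · exact fun h => hU y hy x hx hyc h
  · constructor
    · intro h
      by_contra h'
      exact lt_asymm h (hW y hy x hx (by omega) (by omega))
    · intro h
      rw [Fin.lt_def]
      omega

/-- On a single matching, an arc with both ends in `I` makes the sum zero: by the sign-reversing
swap if the ends are on the same side of `c`, and because no splitting is compatible otherwise.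
Without such an arc every sign is `(-1)^(m b)`, and the normalised sum is a cardinality. -/
theorem twoArc_sum_mem {Q : Subsemiring K} {φ : Finset (Fin n) → Finset (Fin n) → K}
    (hφ : φ ∈ tlCone n Q) (hbc : b ≤ c) (hcd : c ≤ d) (hdn : d ≤ n) (hk : b + (d - c) ≤ k)
    (hkn : k ≤ n) (hI : I.card = b + (d - c)) (m : ℕ) :
    ∑ S ∈ splits k b c d m I, (-1) ^ (crossings S (I \ S) + m * b) *
      φ (compA n k b ∪ S) (compB n k c d ∪ (I \ S)) ∈ Q := by
  classical
  let E : (Finset (Fin n) → Finset (Fin n) → K) →+ K :=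
    { toFun := fun φ => ∑ S ∈ splits k b c d m I, (-1) ^ (crossings S (I \ S) + m * b) *
        φ (compA n k b ∪ S) (compB n k c d ∪ (I \ S))
      map_zero' := by simp
      map_add' := fun φ ψ => by simp [mul_add, Finset.sum_add_distrib] }
  change E φ ∈ Q.toAddSubmonoid
  refine tlCone_induction E _ (fun a ha τ => ?_) hφ
  have e : E (fun S T => a * τ.ind K S T) = a * ((-1) ^ (m * b) *
      ∑ S ∈ (splits k b c d m I).filter fun S =>
        τ.Compat (compA n k b ∪ S) (compB n k c d ∪ (I \ S)),
          (-1 : K) ^ crossings S (I \ S)) := by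
    simp only [E, AddMonoidHom.coe_mk, ZeroHom.coe_mk]
    rw [Finset.sum_filter, Finset.mul_sum, Finset.mul_sum]
    refine Finset.sum_congr rfl fun S _ => ?_
    rw [Matching.ind]
    split_ifs
    · rw [pow_add]
      ring
    · ring
  rw [e]
  refine Q.mul_mem ha ?_
  by_cases hno : ∀ x ∈ I, τ.m x ≠ x → τ.m x ∉ I
  · rw [Finset.sum_congr rfl (g := fun _ => (-1 : K) ^ (m * b)) fun S hS => ?_, Finset.sum_const,
      nsmul_eq_mul, mul_left_comm, ← mul_pow, neg_one_mul, neg_neg, one_pow, mul_one]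
    · exact natCast_mem Q _
    · rw [Finset.mem_filter] at hS
      rw [crossings_of_no_arc hS.1 hS.2 hbc hcd hdn hno]
  · push Not at hno
    obtain ⟨x, hx, hne, hy⟩ := hno
    convert Q.zero_mem
    refine mul_eq_zero_of_right _ ?_
    obtain ⟨u, v, huv, hlt, hu, hv⟩ : ∃ u v, τ.m u = v ∧ u < v ∧ u ∈ I ∧ v ∈ I := by
      rcases lt_or_gt_of_ne hne with h | h
      · exact ⟨τ.m x, x, τ.invol x, h, hy, hx⟩
      · exact ⟨x, τ.m x, rfl, h, hx, hy⟩
    by_cases hc : u.val < c ↔ v.val < c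
    · exact sum_sign_eq_zero huv hlt hu hv hc
    · refine Finset.sum_eq_zero fun S hS => ?_
      rw [Finset.mem_filter] at hS
      rw [Fin.lt_def] at hlt
      exact (no_straddling_arc hS.1 hS.2 hbc hcd hk hkn hI huv hu hv (by omega) (by omega)).elim

end TwoArcSum

/-! ### Minors with columns in one interval as single Plücker coordinates. -/

section IntervalMinors

theorem rowDet_congr {α K : Type*} [LinearOrder α] [CommRing K] {r : ℕ} {c c' : Fin r → α → K}
    {I : Finset α} (h : ∀ u, ∀ i ∈ I, c u i = c' u i) :
    rowDet (List.ofFn c) I = rowDet (List.ofFn c') I := by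
  by_cases hI : I.card = r
  · rw [rowDet_ofFn_orderEmb hI, rowDet_ofFn_orderEmb hI]
    congr 1
    ext s u
    exact h u _ (Finset.orderEmbOfFin_mem _ _ _)
  · rw [rowDet_eq_zero_of_card (by simpa using hI), rowDet_eq_zero_of_card (by simpa using hI)]

variable {n k b c d m : ℕ}

theorem compA_eq_compB (hb : b ≤ k) : compA n k b = compB n k 0 b := by
  ext i
  rw [mem_compA, mem_compB]
  omega

theorem insert_compB (hk : 1 ≤ k) (hkn : k ≤ n) (j : Fin n) :
    insert j (compB n (k - 1) j j) = compB n k (j + 1) (j + 1) := by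
  ext i
  rw [Finset.mem_insert, mem_compB, mem_compB, Fin.ext_iff]
  omega

theorem arc_eq_compB {m : ℕ} (hm : m ≤ n) (j : Fin n) : arc j m = compB n m j j := by
  ext i
  rw [mem_compB]
  simp only [arc, Finset.mem_filter, Finset.mem_univ, true_and, Finset.mem_range]
  have hi := i.2
  have hj := j.2
  constructor
  · rintro ⟨a, ha, h⟩
    rw [Nat.ModEq, Nat.mod_eq_of_lt hj] at h
    by_cases h' : i.val + a + 1 < n
    · rw [Nat.mod_eq_of_lt h'] at h
      omega
    · rw [Nat.mod_eq_sub_mod (by omega), Nat.mod_eq_of_lt (by omega)] at h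
      omega
  · rintro (h | h)
    · exact ⟨j - i - 1, by omega, by rw [show i.val + (j - i - 1) + 1 = j by omega]⟩
    · refine ⟨n + j - i - 1, by omega, ?_⟩
      rw [show i.val + (n + j - i - 1) + 1 = n + j by omega, Nat.ModEq, Nat.add_mod_left]

theorem card_compB_self (hk : k ≤ n) (hd : d ≤ n) : (compB n k d d).card = k := by
  have h1 := card_filter_val_lt (n := n) hd
  have h2 := card_filter_val_lt (n := n) (k := d - k) (by omega)
  have h3 := card_filter_val_lt (n := n) (k := min n (n + d - k)) (by omega)
  have e1 := Finset.card_sdiff_add_card_inter (Finset.univ.filter fun i : Fin n => i.val < d)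
    (Finset.univ.filter fun i : Fin n => i.val < d - k)
  have e2 := Finset.card_compl (Finset.univ.filter fun i : Fin n => i.val < min n (n + d - k))
  have e3 : (Finset.univ.filter fun i : Fin n => i.val < d) ∩
      (Finset.univ.filter fun i : Fin n => i.val < d - k) =
        Finset.univ.filter fun i : Fin n => i.val < d - k := by
    ext i
    simp only [Finset.mem_inter, Finset.mem_filter, Finset.mem_univ, true_and]
    omega
  have e4 : compB n k d d = ((Finset.univ.filter fun i : Fin n => i.val < d) \
      (Finset.univ.filter fun i : Fin n => i.val < d - k)) ∪
        (Finset.univ.filter fun i : Fin n => i.val < min n (n + d - k))ᶜ := by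
    ext i
    simp only [Finset.mem_union, Finset.mem_sdiff, Finset.mem_compl, Finset.mem_filter,
      Finset.mem_univ, true_and, mem_compB]
    omega
  rw [e4, Finset.card_union_of_disjoint]
  · rw [e3] at e1
    rw [Fintype.card_fin] at e2
    omega
  · rw [Finset.disjoint_left]
    intro i
    simp only [Finset.mem_sdiff, Finset.mem_compl, Finset.mem_filter,
      Finset.mem_univ, true_and]
    omega

/-- The interval `[c, d)`. -/
def ico (n c d : ℕ) : Finset (Fin n) := Finset.univ.filter fun i => c ≤ i.val ∧ i.val < d

theorem mem_ico {i : Fin n} : i ∈ ico n c d ↔ c ≤ i.val ∧ i.val < d := by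
  simp [ico]

theorem ico_eq_image (hd : d ≤ n) (hcd : c ≤ d) : ico n c d =
    Finset.univ.image fun u : Fin (d - c) => (⟨c + u, by omega⟩ : Fin n) := by
  ext i
  simp only [mem_ico, Finset.mem_image, Finset.mem_univ, true_and]
  constructor
  · intro h
    exact ⟨⟨i - c, by omega⟩, Fin.ext (by simp only; omega)⟩
  · rintro ⟨u, rfl⟩
    have := u.2
    simp only
    omega

theorem strictMono_ico (hd : d ≤ n) (hcd : c ≤ d) :
    StrictMono fun u : Fin (d - c) => (⟨c + u, by omega⟩ : Fin n) := fun u v h => by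
  rw [Fin.lt_def] at h ⊢
  simp only
  omega

theorem card_ico (hd : d ≤ n) (hcd : c ≤ d) : (ico n c d).card = d - c := by
  rw [ico_eq_image hd hcd, card_image_strictMono (strictMono_ico hd hcd)]

theorem compB_union_ico (hk : d - c ≤ k) (hcd : c ≤ d) :
    compB n k d d = compB n k c d ∪ ico n c d := by
  ext i
  rw [Finset.mem_union, mem_compB, mem_compB, mem_ico]
  omega

theorem disjoint_compB_ico (hkn : k ≤ n) : Disjoint (compB n k c d) (ico n c d) := by
  rw [Finset.disjoint_left]
  intro i
  rw [mem_compB, mem_ico]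
  omega

theorem card_compB (hk : d - c ≤ k) (hcd : c ≤ d) (hd : d ≤ n) (hkn : k ≤ n) :
    (compB n k c d).card = k - (d - c) := by
  have h := card_compB_self hkn hd
  rw [compB_union_ico hk hcd, Finset.card_union_of_disjoint (disjoint_compB_ico hkn),
    card_ico hd hcd] at h
  omega

section

variable {K : Type*} [CommRing K]

/-- The Plücker coordinate of the rows `i` and the `k - 1` rows cyclically preceding `j`, with the
sign which makes it a linear function of the row `i`. -/
def om (V : Matrix (Fin n) (Fin k) K) (j i : Fin n) : K :=
  (-1) ^ (if i < j then k + 1 else 0) * pl V (insert i (compB n (k - 1) j j))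

theorem om_eq_zero (V : Matrix (Fin n) (Fin k) K) (hk : 1 ≤ k) (hkn : k ≤ n) {j i : Fin n}
    (h : i ∈ compB n (k - 1) j j) : om V j i = 0 := by
  rw [om, Finset.insert_eq_of_mem h, pl_of_card_ne, mul_zero]
  rw [card_compB_self (by omega) (by omega)]
  omega

theorem om_self (V : Matrix (Fin n) (Fin k) K) (hk : 1 ≤ k) (hkn : k ≤ n) (j : Fin n) :
    om V j j = pl V (compB n k (j + 1) (j + 1)) := by
  rw [om, if_neg (lt_irrefl _), pow_zero, one_mul, insert_compB hk hkn]

theorem orderEmb_insert_succAbove {m : ℕ} {S : Finset (Fin n)} {i : Fin n} (hi : i ∉ S)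
    (hS : S.card = m) (hS' : (insert i S).card = m + 1) :
    ∃ p : Fin (m + 1), p.val = (S.filter (· < i)).card ∧ (insert i S).orderEmbOfFin hS' p = i ∧
      ∀ s, (insert i S).orderEmbOfFin hS' (p.succAbove s) = S.orderEmbOfFin hS s := by
  obtain ⟨p, hp⟩ : ∃ p, (insert i S).orderEmbOfFin hS' p = i := by
    have : i ∈ Set.range ((insert i S).orderEmbOfFin hS') := by simp
    exact this
  have hmono := ((insert i S).orderEmbOfFin hS').strictMono
  refine ⟨p, ?_, hp, fun s => ?_⟩
  · have h := card_filter_lt_image hmono p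
    rw [image_orderEmbOfFin, hp, Finset.filter_insert, if_neg (lt_irrefl _)] at h
    exact h.symm
  · have h : ⇑(S.orderEmbOfFin hS) = (insert i S).orderEmbOfFin hS' ∘ p.succAbove := by
      refine orderEmbOfFin_image (hmono.comp (Fin.strictMono_succAbove p)) ?_ hS
      ext x
      simp only [Finset.mem_image, Finset.mem_univ, true_and, Function.comp_apply]
      constructor
      · intro hx
        obtain ⟨q, hq⟩ : ∃ q, (insert i S).orderEmbOfFin hS' q = x := by
          have : x ∈ Set.range ((insert i S).orderEmbOfFin hS') := by simp [hx]
          exact this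
        obtain ⟨t, ht⟩ := Fin.exists_succAbove_eq (x := q) (y := p) (fun h => hi (by
          rw [← hp, ← h, hq]; exact hx))
        exact ⟨t, by rw [ht, hq]⟩
      · rintro ⟨t, rfl⟩
        have := Finset.orderEmbOfFin_mem (insert i S) hS' (p.succAbove t)
        refine (Finset.mem_insert.1 this).resolve_left fun h => ?_
        exact Fin.succAbove_ne p t (hmono.injective (h.trans hp.symm))
    rw [h]
    rfl

/-- For `i ≥ j` the row `i` is inserted in position `min j (k - 1)`; for `i < j` outside the cyclic
interval it comes first, and then `j ≥ k`. The sign in `om` makes up for the difference `k - 1`, so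
the cofactors of the row `i` do not depend on `i`. For `i` in the interval both sides vanish, by a
repeated row. -/
theorem exists_om (V : Matrix (Fin n) (Fin k) K) (hk : 1 ≤ k) (hkn : k ≤ n) (j : Fin n) :
    ∃ w, om V j = V.mulVec w := by
  obtain ⟨k, rfl⟩ : ∃ k', k = k' + 1 := ⟨k - 1, by omega⟩
  set A := compB n (k + 1 - 1) j j with hA
  have hAc : A.card = k := card_compB_self (by omega) (by omega)
  refine ⟨fun l => (-1) ^ (min j.val k) * ((-1) ^ l.val *
    (V.submatrix (A.orderEmbOfFin hAc) l.succAbove).det), funext fun i => ?_⟩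
  have hsum : V.mulVec (fun l => (-1) ^ (min j.val k) * ((-1) ^ l.val *
      (V.submatrix (A.orderEmbOfFin hAc) l.succAbove).det)) i =
      (-1) ^ (min j.val k) * ∑ l : Fin (k + 1), (-1) ^ l.val * V i l *
        (V.submatrix (A.orderEmbOfFin hAc) l.succAbove).det := by
    rw [Matrix.mulVec, dotProduct, Finset.mul_sum]
    refine Finset.sum_congr rfl fun l _ => ?_
    ring
  rw [hsum]
  by_cases hi : i ∈ A
  · rw [om_eq_zero V hk hkn hi]
    obtain ⟨s, hs⟩ : ∃ s, A.orderEmbOfFin hAc s = i := by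
      have : i ∈ Set.range (A.orderEmbOfFin hAc) := by simpa using hi
      exact this
    have := Matrix.det_succ_row_zero (V.submatrix (Fin.cons i (A.orderEmbOfFin hAc)) id)
    rw [Matrix.det_zero_of_row_eq (i := 0) (j := s.succ) (Fin.succ_ne_zero s).symm] at this
    · refine (mul_eq_zero_of_right _ ?_).symm
      rw [this]
      rfl
    · funext t
      simp [hs]
  · have hc : (insert i A).card = k + 1 := by rw [Finset.card_insert_of_notMem hi, hAc]
    obtain ⟨p, hp, hpi, hps⟩ := orderEmb_insert_succAbove hi hAc hc
    have hsign : (-1 : K) ^ (if i < j then k + 1 + 1 else 0) * (-1) ^ p.val =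
        (-1) ^ (min j.val k) := by
      rw [hp]
      rw [mem_compB] at hi
      split_ifs with hij
      · rw [Fin.lt_def] at hij
        have : A.filter (· < i) = ∅ := by
          rw [Finset.filter_eq_empty_iff]
          intro x hx
          rw [mem_compB] at hx
          rw [Fin.lt_def]
          omega
        rw [this, Finset.card_empty, pow_zero, mul_one, min_eq_right (by omega), pow_add, pow_add]
        ring
      · rw [Fin.lt_def] at hij
        have h1 : A.filter (· < i) = ico n (j - k) j := by
          ext x
          rw [Finset.mem_filter, mem_compB, mem_ico, Fin.lt_def]
          omega
        rw [h1, card_ico (by omega) (by omega), pow_zero, one_mul]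
        congr 1
        omega
    rw [om, ← hsign, mul_assoc]
    refine congrArg _ ?_
    rw [pl_of_card hc, Matrix.det_succ_row _ p, Finset.mul_sum]
    refine Finset.sum_congr rfl fun l _ => ?_
    rw [pow_add, Matrix.submatrix_apply, hpi, Matrix.submatrix_submatrix]
    have : ⇑((insert i A).orderEmbOfFin hc) ∘ p.succAbove = A.orderEmbOfFin hAc :=
      funext fun s => hps s
    rw [this, Function.id_comp]
    simp only [id, mul_assoc]

end

variable {K : Type*} [Field K]

/-- Vectors in the column space of `V` that look like unit vectors on the rows `A`, the columns of
the inverse of that block. They serve to complete a short list of columns to `k` columns. -/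
theorem exists_dual {V : Matrix (Fin n) (Fin k) K} {A : Finset (Fin n)} (hV : pl V A ≠ 0) :
    ∃ e : Fin n → Fin k → K, ∀ a ∈ A, ∀ a' ∈ A,
      V.mulVec (e a) a' = (Pi.single a 1 : Fin n → K) a' := by
  have hA : A.card = k := by
    by_contra h
    exact hV (pl_of_card_ne h)
  rw [pl_of_card hA] at hV
  set E := V.submatrix (A.orderEmbOfFin hA) id with hE
  have hinv : E * E⁻¹ = 1 := Matrix.mul_nonsing_inv _ (isUnit_iff_ne_zero.2 hV)
  classical
  have hs : ∀ a ∈ A, ∃ s, A.orderEmbOfFin hA s = a := fun a ha => by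
    have : a ∈ Set.range (A.orderEmbOfFin hA) := by simpa using ha
    exact this
  refine ⟨fun a => if h : a ∈ A then E⁻¹.col (hs a h).choose else 0, fun a ha a' ha' => ?_⟩
  simp only [dif_pos ha]
  obtain ⟨s', rfl⟩ := hs a' ha'
  have h1 := (hs a ha).choose_spec
  set s := (hs a ha).choose with hsdef
  rw [← h1]
  have h2 := congrFun (congrFun hinv s') s
  rw [Matrix.one_apply] at h2
  simp only [Pi.single_apply, (A.orderEmbOfFin hA).injective.eq_iff]
  exact h2

/-- A point outside `compB` and at or above `c` exceeds exactly the part of `compB` below `c`. A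
point outside `compB` and below `c` precedes all of `compB`, and can exist only if `compB` lies
entirely below `c`. The signs for `T` and for `[c, d)` thus differ by the points of `T` below `c`.
-/
theorem crossings_compB {T : Finset (Fin n)} (hk : d - c ≤ k) (hcd : c ≤ d) (hd : d ≤ n)
    (hkn : k ≤ n) (hT : Disjoint (compB n k c d) T) (hTc : T.card = d - c) :
    (-1 : K) ^ crossings T (compB n k c d) = (-1) ^ crossings (ico n c d) (compB n k c d) *
      (-1) ^ ((T.filter fun i => i.val < c).card * (k - (d - c))) := by
  set β := ((compB n k c d).filter fun i => i.val < c).card with hβ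
  have hT' : ∀ y ∈ T, y ∉ compB n k c d := fun y hy h => Finset.disjoint_left.1 hT h hy
  have h1 : ∀ S : Finset (Fin n), (∀ y ∈ S, y ∉ compB n k c d) →
      (∀ y ∈ S, c ≤ y.val) → crossings S (compB n k c d) = S.card * β := by
    intro S hS hSc
    rw [crossings, Finset.sum_congr rfl (g := fun _ => β), Finset.sum_const, smul_eq_mul]
    intro y hy
    rw [hβ]
    congr 1
    refine Finset.filter_congr fun x hx => ?_
    have h2 := hS y hy
    have h3 := hSc y hy
    rw [mem_compB] at hx h2
    rw [Fin.lt_def]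
    omega
  have h2 : crossings T (compB n k c d) = (T.filter fun i => c ≤ i.val).card * β := by
    rw [← h1 _ (fun y hy => hT' y (Finset.mem_filter.1 hy).1) fun y hy =>
      (Finset.mem_filter.1 hy).2, crossings, crossings]
    refine (Finset.sum_filter_of_ne fun y hy hne => ?_).symm
    by_contra hlt
    refine hne ?_
    rw [Finset.card_eq_zero, Finset.filter_eq_empty_iff]
    intro x hx
    have h3 := hT' y hy
    rw [mem_compB] at hx h3
    rw [Fin.lt_def]
    omega
  have h3 : (T.filter fun i => i.val < c).card * β =
      (T.filter fun i => i.val < c).card * (k - (d - c)) := by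
    by_cases h : (T.filter fun i => i.val < c).card = 0
    · rw [h, zero_mul, zero_mul]
    · obtain ⟨y, hy⟩ := Finset.card_pos.1 (Nat.pos_of_ne_zero h)
      rw [Finset.mem_filter] at hy
      have h4 := hT' y hy.1
      rw [mem_compB] at h4
      rw [hβ, ← card_compB hk hcd hd hkn]
      congr 2
      rw [Finset.filter_eq_self]
      intro x hx
      rw [mem_compB] at hx
      omega
  have h4 := Finset.card_filter_add_card_filter_not (s := T) (fun i : Fin n => i.val < c)
  simp only [not_lt] at h4
  rw [h2, h1 _ (fun y hy h => Finset.disjoint_left.1 (disjoint_compB_ico hkn) h hy)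
    (fun y hy => (mem_ico.1 hy).1), card_ico hd hcd, ← h3, ← hTc, ← h4, ← pow_add, ← add_mul]
  rw [add_right_comm, add_mul, pow_add _ (_ * β), ← two_mul, mul_assoc, pow_mul]
  simp

open Classical in
/-- The minors of the matrix `om` with columns in an interval. -/
theorem rowDet_om (V : Matrix (Fin n) (Fin k) K) (hk : 1 ≤ k) (hkn : k ≤ n) (hcd : c ≤ d)
    (hd : d ≤ n) (hdk : d - c ≤ k) (hV : pl V (compB n k d d) ≠ 0) {T : Finset (Fin n)}
    (hT : T.card = d - c) :
    rowDet (List.ofFn fun u : Fin (d - c) => om V ⟨c + u, by omega⟩) T * pl V (compB n k d d) =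
      (∏ j ∈ ico n c d, pl V (compB n k (j + 1) (j + 1))) *
        ((-1) ^ ((T.filter fun i => i.val < c).card * (k - (d - c))) *
          if Disjoint (compB n k c d) T then pl V (compB n k c d ∪ T) else 0) := by
  set B := compB n k c d with hB
  have hBc : B.card = k - (d - c) := card_compB hdk hcd hd hkn
  set cs : List (Fin n → K) := List.ofFn fun u : Fin (d - c) => om V ⟨c + u, by omega⟩ with hcs
  have hom : ∀ u : Fin (d - c), ∀ i ∈ B, om V ⟨c + u, by omega⟩ i = 0 := by
    intro u i hi
    refine om_eq_zero V hk hkn ?_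
    rw [mem_compB] at hi ⊢
    simp only
    omega
  by_cases hdisj : Disjoint B T
  swap
  · rw [if_neg hdisj, mul_zero, mul_zero]
    obtain ⟨i, hiB, hiT⟩ := Finset.not_disjoint_iff.1 hdisj
    rw [rowDet_eq_zero_of_row hiT, zero_mul]
    intro f hf
    obtain ⟨u, rfl⟩ := List.mem_ofFn.1 hf
    exact hom u i hiB
  rw [if_pos hdisj]
  obtain ⟨e, he⟩ := exists_dual hV
  have hBA : B ⊆ compB n k d d := by
    rw [compB_union_ico hdk hcd]
    exact Finset.subset_union_left
  -- Completing the columns `om` by vectors dual to `B` gives `k` vectors in the column space of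
  -- `V`, with minors `κ` times Plücker coordinates. The columns `om` vanish on the rows `B` and the
  -- new ones vanish on `[c, d)`, so Laplace expansion has one term on the rows `B ∪ [c, d)`, where
  -- the block is triangular and fixes `κ`, and one term on the rows `B ∪ T`, which gives the minor
  -- sought.
  set ds : List (Fin n → K) := List.ofFn fun u : Fin (k - (d - c)) =>
    V.mulVec (e (B.orderEmbOfFin hBc u)) with hds
  have hdsB : rowDet ds B = 1 := by
    rw [← rowDet_pi_single (K := K) hBc]
    refine rowDet_congr fun u i hi => he _ (hBA (Finset.orderEmbOfFin_mem _ _ _)) _ (hBA hi)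
  obtain ⟨κ, hκ⟩ : ∃ κ, ∀ S, rowDet (cs ++ ds) S = pl V S * κ := by
    choose w hw using fun j => exists_om V hk hkn j
    refine ⟨rowDet ((List.ofFn fun u : Fin (d - c) => w ⟨c + u, by omega⟩) ++
      List.ofFn fun u => e (B.orderEmbOfFin hBc u)) Finset.univ, fun S => ?_⟩
    rw [← rowDet_mulVec _ _ (by simp; omega), List.map_append, List.map_ofFn, List.map_ofFn,
      hcs, hds]
    congr 3
    funext u
    exact hw _
  have h1 : rowDet (cs ++ ds) (compB n k d d) =
      (-1) ^ crossings (ico n c d) B * rowDet cs (ico n c d) := by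
    have e0 : compB n k d d \ ico n c d = B := by
      rw [compB_union_ico hdk hcd, Finset.union_sdiff_right,
        Finset.sdiff_eq_self_of_disjoint (disjoint_compB_ico hkn)]
    rw [rowDet_append, Finset.sum_eq_single (ico n c d)]
    · rw [e0, hdsB, mul_one]
    · intro S hS hne
      refine mul_eq_zero_of_right _ ?_
      rw [Finset.mem_powerset] at hS
      by_cases hSc : S.card = d - c
      · obtain ⟨i, hi, hi'⟩ : ∃ i ∈ ico n c d, i ∉ S := by
          by_contra! hsub
          refine hne (Finset.eq_of_subset_of_card_le hsub ?_).symm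
          rw [hSc, card_ico hd hcd]
        have hiA : i ∈ compB n k d d := by
          rw [compB_union_ico hdk hcd]
          exact Finset.mem_union_right _ hi
        refine rowDet_eq_zero_of_row (Finset.mem_sdiff.2 ⟨hiA, hi'⟩) fun f hf => ?_
        obtain ⟨u, rfl⟩ := List.mem_ofFn.1 hf
        have hmem := Finset.orderEmbOfFin_mem B hBc u
        rw [he _ (hBA hmem) _ hiA]
        refine Pi.single_eq_of_ne ?_ _
        rintro rfl
        exact Finset.disjoint_left.1 (disjoint_compB_ico hkn) hmem hi
      · refine rowDet_eq_zero_of_card ?_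
        rw [Finset.card_sdiff_of_subset hS, card_compB_self hkn hd, hds, List.length_ofFn]
        have := Finset.card_le_card hS
        rw [card_compB_self hkn hd] at this
        omega
    · intro h
      refine absurd (Finset.mem_powerset.2 ?_) h
      rw [compB_union_ico hdk hcd]
      exact Finset.subset_union_right
  have h2 : rowDet cs (ico n c d) = ∏ j ∈ ico n c d, pl V (compB n k (j + 1) (j + 1)) := by
    rw [hcs, ico_eq_image hd hcd, rowDet_ofFn (strictMono_ico hd hcd),
      Finset.prod_image fun _ _ _ _ h => (strictMono_ico hd hcd).injective h,
      Matrix.det_of_isLowerTriangular]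
    · refine Finset.prod_congr rfl fun u _ => ?_
      rw [Matrix.of_apply, om_self V hk hkn]
    · intro u v huv
      rw [OrderDual.toDual_lt_toDual] at huv
      rw [Matrix.of_apply]
      refine om_eq_zero V hk hkn ?_
      rw [mem_compB]
      rw [Fin.lt_def] at huv
      simp only
      omega
  have h3 : rowDet (cs ++ ds) (B ∪ T) = (-1) ^ crossings T B * rowDet cs T := by
    have e0 : (B ∪ T) \ T = B := by
      rw [Finset.union_sdiff_right, Finset.sdiff_eq_self_of_disjoint hdisj]
    rw [rowDet_append, Finset.sum_eq_single T]
    · rw [e0, hdsB, mul_one]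
    · intro S hS hne
      rw [Finset.mem_powerset] at hS
      refine mul_eq_zero_of_left (mul_eq_zero_of_right _ ?_) _
      by_cases hSc : S.card = d - c
      · obtain ⟨i, hi, hi'⟩ : ∃ i ∈ S, i ∉ T := by
          by_contra! hsub
          exact hne (Finset.eq_of_subset_of_card_le hsub (by omega))
        refine rowDet_eq_zero_of_row hi fun f hf => ?_
        obtain ⟨u, rfl⟩ := List.mem_ofFn.1 hf
        exact hom u i ((Finset.mem_union.1 (hS hi)).resolve_right hi')
      · exact rowDet_eq_zero_of_card (by simpa [hcs] using hSc)
    · intro h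
      exact absurd (Finset.mem_powerset.2 Finset.subset_union_right) h
  rw [hκ, h2] at h1
  rw [hκ, crossings_compB hdk hcd hd hkn hdisj hT] at h3
  have hs : (-1 : K) ^ crossings (ico n c d) B * (-1) ^ crossings (ico n c d) B = 1 := by
    rw [← mul_pow]; simp
  set ε := (-1 : K) ^ crossings (ico n c d) B
  have hs' : (-1 : K) ^ ((T.filter fun i => i.val < c).card * (k - (d - c))) *
      (-1) ^ ((T.filter fun i => i.val < c).card * (k - (d - c))) = 1 := by
    rw [← mul_pow]; simp
  set η := (-1 : K) ^ ((T.filter fun i => i.val < c).card * (k - (d - c)))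
  linear_combination (-ε * η * pl V (compB n k d d)) * h3 + (ε * η * pl V (B ∪ T)) * h1 -
    (rowDet cs T * pl V (compB n k d d)) * (hs * η * η + hs') +
    (η * pl V (B ∪ T) * ∏ j ∈ ico n c d, pl V (compB n k (j + 1) (j + 1))) * hs

end IntervalMinors

/-! ### Minors with columns in two intervals -/

section Minors

variable {n k b c d : ℕ}

/-- The minor of `A` with rows `I` and columns `J`, zero if these sets have different sizes. -/
def minor {K : Type*} [CommRing K] (A : Matrix (Fin n) (Fin n) K) (I J : Finset (Fin n)) : K :=
  if h : J.card = I.card then (A.submatrix (I.orderEmbOfFin rfl) (J.orderEmbOfFin h)).det else 0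

theorem minor_of_card {K : Type*} [CommRing K] (A : Matrix (Fin n) (Fin n) K)
    {I J : Finset (Fin n)} {r : ℕ} (hI : I.card = r) (hJ : J.card = r) :
    minor A I J = (A.submatrix (I.orderEmbOfFin hI) (J.orderEmbOfFin hJ)).det := by
  subst hI
  rw [minor, dif_pos hJ]

theorem rowDet_ofFn_col {K : Type*} [CommRing K] (A : Matrix (Fin n) (Fin n) K)
    {I J : Finset (Fin n)} (h : I.card = J.card) {r : ℕ} {f : Fin r → Fin n} (hf : StrictMono f)
    (hJ : J = Finset.univ.image f) :
    minor A I J = rowDet (List.ofFn fun u => A.col (f u)) I := by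
  have hr : J.card = r := by rw [hJ, card_image_strictMono hf]
  rw [minor_of_card A (h.trans hr) hr, rowDet_ofFn_orderEmb (h.trans hr),
    orderEmbOfFin_image hf hJ hr]
  rfl

theorem prod_orderEmbOfFin {K : Type*} [CommMonoid K] {I : Finset (Fin n)} {r : ℕ}
    (hI : I.card = r) (f : Fin n → K) : ∏ s, f (I.orderEmbOfFin hI s) = ∏ i ∈ I, f i := by
  conv_rhs => rw [← image_orderEmbOfFin hI]
  rw [Finset.prod_image fun _ _ _ _ h => (I.orderEmbOfFin hI).injective h]

theorem minor_scale {K : Type*} [CommRing K] (A : Matrix (Fin n) (Fin n) K) (u v : Fin n → K)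
    (I J : Finset (Fin n)) :
    minor (Matrix.of fun i j => u i * v j * A i j) I J =
      (∏ i ∈ I, u i) * (∏ j ∈ J, v j) * minor A I J := by
  by_cases h : J.card = I.card
  · rw [minor_of_card _ rfl h, minor_of_card _ rfl h, ← prod_orderEmbOfFin rfl u,
      ← prod_orderEmbOfFin h v, mul_assoc, ← Matrix.det_mul_row, ← Matrix.det_mul_column]
    congr 1
    ext s t
    simp only [Matrix.of_apply, Matrix.submatrix_apply]
    ring
  · rw [minor, minor, dif_neg h, dif_neg h, mul_zero]

theorem minor_map {K L : Type*} [CommRing K] [CommRing L] (φ : K →+* L)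
    (A : Matrix (Fin n) (Fin n) K) (I J : Finset (Fin n)) :
    minor (A.map φ) I J = φ (minor A I J) := by
  by_cases h : J.card = I.card
  · rw [minor_of_card _ rfl h, minor_of_card _ rfl h, RingHom.map_det]
    rfl
  · rw [minor, minor, dif_neg h, dif_neg h, map_zero]

variable {K : Type*} [CommRing K]

/-- The matrix whose columns are, up to rescaling, those of `g`. -/
noncomputable def hMat (k : ℕ) (P : Finset (Fin n) → K) : Matrix (Fin n) (Fin n) K[X] :=
  Matrix.of fun i j => (if i < j then X else 1) * C (P (insert i (compB n (k - 1) j j)))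

theorem hMat_pl (V : Matrix (Fin n) (Fin k) K) (i j : Fin n) :
    hMat k (pl V) i j = (if i < j then (-1) ^ (k + 1) * X else 1) * C (om V j i) := by
  rw [hMat, Matrix.of_apply, om, C_mul, C_pow, C_neg, C_1]
  split_ifs with h
  · have e : (-1 : K[X]) ^ (k + 1) * (-1) ^ (k + 1) = 1 := by
      rw [← mul_pow]
      simp
    linear_combination (-X * C (pl V (insert i (compB n (k - 1) j j)))) * e
  · simp

/-- Within an interval of at most `k` columns the entries between the row `c` and the diagonal
vanish. The variable therefore sits on the same rows, those below `c`, in all these columns, and can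
be pulled out of the determinant row by row. -/
theorem hMat_pl_col (V : Matrix (Fin n) (Fin k) K) (hk : 1 ≤ k) (hkn : k ≤ n) (hcd : c ≤ d)
    (hd : d ≤ n) (hdk : d - c ≤ k) (u : Fin (d - c)) :
    (hMat k (pl V)).col ⟨c + u, by omega⟩ = fun i : Fin n =>
      (if i.val < c then (-1) ^ (k + 1) * X else 1) * C (om V ⟨c + u, by omega⟩ i) := by
  funext i
  rw [Matrix.col_apply, hMat_pl]
  by_cases hi : i.val < c
  · rw [if_pos hi, if_pos (by rw [Fin.lt_def]; simp only; omega)]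
  · rw [if_neg hi]
    split_ifs with h
    · rw [Fin.lt_def] at h
      rw [om_eq_zero V hk hkn, C_0, mul_zero, mul_zero]
      rw [mem_compB]
      simp only at h ⊢
      have := u.2
      omega
    · rfl

theorem rowDet_map {α L : Type*} [LinearOrder α] [CommRing L] (φ : K →+* L) (cs : List (α → K))
    (I : Finset α) : rowDet (cs.map fun f i => φ (f i)) I = φ (rowDet cs I) := by
  induction cs generalizing I with
  | nil =>
    by_cases h : I = ∅ <;> simp [rowDet, h]
  | cons f cs ih =>
    simp only [List.map_cons, rowDet, ih, map_sum, map_mul, map_pow, map_neg, map_one]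

/-- The columns `[0, b)` and `[c, d)`. -/
def twoIco (n b c d : ℕ) : Finset (Fin n) := ico n 0 b ∪ ico n c d

theorem mem_twoIco {i : Fin n} : i ∈ twoIco n b c d ↔ i.val < b ∨ c ≤ i.val ∧ i.val < d := by
  rw [twoIco, Finset.mem_union, mem_ico, mem_ico]
  simp

theorem card_twoIco (hbc : b ≤ c) (hcd : c ≤ d) (hd : d ≤ n) :
    (twoIco n b c d).card = b + (d - c) := by
  rw [twoIco, Finset.card_union_of_disjoint, card_ico (by omega) (by omega), card_ico hd hcd,
    Nat.sub_zero]
  rw [Finset.disjoint_left]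
  intro i
  rw [mem_ico, mem_ico]
  omega

/-- The Laplace expansion of a minor along its two intervals of columns. -/
theorem minor_twoIco (A : Matrix (Fin n) (Fin n) K) (hbc : b ≤ c) (hcd : c ≤ d) (hd : d ≤ n)
    {I : Finset (Fin n)} (hI : I.card = b + (d - c)) :
    minor A I (twoIco n b c d) = ∑ S ∈ I.powerset, (-1) ^ crossings S (I \ S) *
      rowDet (List.ofFn fun u : Fin (b - 0) => A.col ⟨0 + u, by omega⟩) S *
        rowDet (List.ofFn fun u : Fin (d - c) => A.col ⟨c + u, by omega⟩) (I \ S) := by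
  rw [← rowDet_append, ← List.ofFn_fin_append]
  have hf : StrictMono (Fin.append (fun u : Fin (b - 0) => (⟨0 + u, by omega⟩ : Fin n))
      fun u : Fin (d - c) => (⟨c + u, by omega⟩ : Fin n)) := by
    intro u v huv
    induction u using Fin.addCases <;> induction v using Fin.addCases <;>
      simp only [Fin.append_left, Fin.append_right, Fin.lt_def, Fin.val_castAdd,
        Fin.val_natAdd] at huv ⊢ <;> omega
  rw [rowDet_ofFn_col A (by rw [hI, card_twoIco hbc hcd hd]) hf]
  · congr 2
    funext u
    induction u using Fin.addCases <;> simp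
  · rw [twoIco, ico_eq_image hd hcd, ico_eq_image (c := 0) (by omega) (by omega)]
    ext i
    simp only [Finset.mem_union, Finset.mem_image, Finset.mem_univ, true_and]
    constructor
    · rintro (⟨u, rfl⟩ | ⟨u, rfl⟩)
      · exact ⟨Fin.castAdd _ u, by simp⟩
      · exact ⟨Fin.natAdd _ u, by simp⟩
    · rintro ⟨u, rfl⟩
      induction u using Fin.addCases with
      | left u => exact Or.inl ⟨u, by simp⟩
      | right u => exact Or.inr ⟨u, by simp⟩

/-- A Laplace expansion for the coefficients of the minors with columns in two intervals. -/
theorem coeff_minor_hMat {K : Type*} [Field K] (V : Matrix (Fin n) (Fin k) K) (hk : 1 ≤ k)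
    (hkn : k ≤ n) (hbc : b ≤ c) (hcd : c ≤ d) (hd : d ≤ n) (hbdk : b + (d - c) ≤ k)
    (hb0 : pl V (compB n k b b) ≠ 0) (hd0 : pl V (compB n k d d) ≠ 0)
    {I : Finset (Fin n)} (hI : I.card = b + (d - c)) (m : ℕ) :
    (-1) ^ ((b + (d - c) + 1) * m) * (minor (hMat k (pl V)) I (twoIco n b c d)).coeff m *
        (pl V (compB n k b b) * pl V (compB n k d d)) =
      (∏ j ∈ twoIco n b c d, pl V (compB n k (j + 1) (j + 1))) *
        ∑ S ∈ splits k b c d m I, (-1) ^ (crossings S (I \ S) + m * b) *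
          (pl V (compA n k b ∪ S) * pl V (compB n k c d ∪ (I \ S))) := by
  classical
  have hJ : ∏ j ∈ twoIco n b c d, pl V (compB n k (j + 1) (j + 1)) =
      (∏ j ∈ ico n 0 b, pl V (compB n k (j + 1) (j + 1))) *
        ∏ j ∈ ico n c d, pl V (compB n k (j + 1) (j + 1)) := by
    rw [twoIco, Finset.prod_union]
    rw [Finset.disjoint_left]
    intro i
    rw [mem_ico, mem_ico]
    omega
  have hcol : ∀ {c' d' : ℕ} (hcd : c' ≤ d') (hd : d' ≤ n) (hdk : d' - c' ≤ k) (T : Finset (Fin n)),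
      rowDet (List.ofFn fun u : Fin (d' - c') => (hMat k (pl V)).col ⟨c' + u, by omega⟩) T =
        ((-1) ^ (k + 1) * X) ^ (T.filter fun i => i.val < c').card *
          C (rowDet (List.ofFn fun u : Fin (d' - c') => om V ⟨c' + u, by omega⟩) T) := by
    intro c' d' hcd hd hdk T
    have e : (List.ofFn fun u : Fin (d' - c') => (hMat k (pl V)).col ⟨c' + u, by omega⟩) =
        ((List.ofFn fun u : Fin (d' - c') => om V ⟨c' + u, by omega⟩).map
          fun f i => C (f i)).map fun f (i : Fin n) =>
            (if i.val < c' then (-1) ^ (k + 1) * X else 1) * f i := by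
      rw [List.map_ofFn, List.map_ofFn]
      congr 1
      funext u
      exact hMat_pl_col V hk hkn hcd hd hdk u
    rw [e, rowDet_scale_rows, rowDet_map]
    congr 1
    rw [Finset.prod_ite, Finset.prod_const, Finset.prod_const_one, mul_one]
  rw [minor_twoIco _ hbc hcd hd hI, finsetSum_coeff, Finset.mul_sum, Finset.sum_mul, hJ,
    Finset.mul_sum, splits, Finset.sum_filter]
  refine Finset.sum_congr rfl fun S hS => ?_
  rw [Finset.mem_powerset] at hS
  rw [hcol (c' := 0) (d' := b) (by omega) (by omega) (by omega), hcol hcd hd (by omega)]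
  by_cases hSb : S.card = b
  swap
  · rw [if_neg (fun h => hSb h.1), rowDet_eq_zero_of_card (by simpa using hSb)]
    simp
  have hSc : (I \ S).card = d - c := by
    rw [Finset.card_sdiff_of_subset hS, hI, hSb]
    omega
  have h1 := rowDet_om V hk hkn (Nat.zero_le b) (by omega) (by omega) hb0
    (T := S) (by omega)
  have h2 := rowDet_om V hk hkn hcd hd (by omega) hd0 hSc
  rw [← compA_eq_compB (by omega)] at h1
  set D1 := rowDet (List.ofFn fun u : Fin (b - 0) => om V ⟨0 + u, by omega⟩) S
  set D2 := rowDet (List.ofFn fun u : Fin (d - c) => om V ⟨c + u, by omega⟩) (I \ S)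
  set μ := ((I \ S).filter fun i => i.val < c).card with hμ
  have e0 : (S.filter fun i : Fin n => i.val < 0) = ∅ := by simp
  rw [e0, Finset.card_empty, zero_mul, pow_zero, one_mul] at h1
  -- Each Laplace term is a monomial: the block starting at column `0` carries no variable and the
  -- other one carries `X` once for each row of `I \ S` below `c`. The coefficient index thus
  -- becomes the cardinality condition in `splits`.
  have e1 : ((-1) ^ crossings S (I \ S) *
      (((-1 : K[X]) ^ (k + 1) * X) ^ (S.filter fun i : Fin n => i.val < 0).card * C D1) *
      (((-1) ^ (k + 1) * X) ^ μ * C D2)).coeff m =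
      if m = μ then (-1) ^ crossings S (I \ S) * (-1) ^ ((k + 1) * μ) * (D1 * D2) else 0 := by
    rw [e0, Finset.card_empty, pow_zero, one_mul, mul_pow, ← pow_mul]
    have : (-1 : K[X]) ^ crossings S (I \ S) * C D1 * ((-1) ^ ((k + 1) * μ) * X ^ μ * C D2) =
        C ((-1) ^ crossings S (I \ S) * (-1) ^ ((k + 1) * μ) * (D1 * D2)) * X ^ μ := by
      simp only [C_mul, C_pow, C_neg, C_1]
      ring
    rw [this, coeff_C_mul_X_pow]
  rw [e1]
  by_cases hm : m = μ
  swap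
  · rw [if_neg hm, if_neg (fun h => hm h.2.2.2.symm)]
    simp
  rw [if_pos hm]
  have e2 : (-1 : K) ^ ((b + (d - c) + 1) * m) * ((-1) ^ crossings S (I \ S) *
      (-1) ^ ((k + 1) * μ) * (D1 * D2)) * (pl V (compB n k b b) * pl V (compB n k d d)) =
      (-1 : K) ^ ((b + (d - c) + 1) * m) * ((-1) ^ crossings S (I \ S) *
      (-1) ^ ((k + 1) * μ)) * ((D1 * pl V (compB n k b b)) * (D2 * pl V (compB n k d d))) := by
    ring
  rw [e2, h1, h2]
  by_cases hA : Disjoint (compA n k b) S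
  swap
  · simp only [hA, if_false, false_and, and_false, mul_zero, zero_mul]
  by_cases hB : Disjoint (compB n k c d) (I \ S)
  swap
  · simp only [hB, if_false, false_and, and_false, mul_zero]
  rw [if_pos hA, if_pos hB, if_pos ⟨hSb, hA, hB, hm.symm⟩, ← hm]
  have e3 : (-1 : K) ^ ((b + (d - c) + 1) * m) * (-1) ^ ((k + 1) * m) *
      (-1) ^ (m * (k - (d - c))) = (-1) ^ (m * b) := by
    rw [← pow_add, ← pow_add, ← add_mul, mul_comm m, ← add_mul]
    have : b + (d - c) + 1 + (k + 1) + (k - (d - c)) = b + 2 * (k + 1) := by omega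
    rw [this, add_mul, mul_assoc, pow_add, pow_mul _ 2, neg_one_sq, one_pow, mul_one, mul_comm b]
  rw [pow_add, ← e3]
  ring

end Minors

/-! ### Families of Plücker vectors and of polynomials with signed coefficients. -/

section Families

variable {σ : Type} {n k b c d r : ℕ}

/-- A family of points of the Grassmannian, given by its Plücker coordinates, for which products
of pairs of Plücker coordinates lie in the non-negative cone, and the Plücker coordinates of cyclic
intervals are positive. -/
structure PlFam (k : ℕ) (P : (σ → ℂˣ) → Finset (Fin n) → ℂ) : Prop where
  tl : IsTL k (nonnegFamilies σ) fun S z => P z S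
  pos : ∀ d ≤ n, PosFam fun z => P z (compB n k d d)
  eq_pl : ∀ᶠ z in generic σ, ∃ V : Matrix (Fin n) (Fin k) ℂ, P z = pl V

/-- A family of polynomials `f` such that `f (-X) ^ (r - 1)` has non-negative coefficients. -/
def PolyNonneg (r : ℕ) (F : (σ → ℂˣ) → ℂ[X]) : Prop :=
  ∀ m, NonnegFam fun z => (-1) ^ ((r + 1) * m) * (F z).coeff m

theorem polyNonneg_minor_twoIco {P : (σ → ℂˣ) → Finset (Fin n) → ℂ} (h : PlFam k P) (hk : 1 ≤ k)
    (hkn : k ≤ n) (hbc : b ≤ c) (hcd : c ≤ d) (hd : d ≤ n) (hbdk : b + (d - c) ≤ k)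
    {I : Finset (Fin n)} (hI : I.card = b + (d - c)) :
    PolyNonneg (b + (d - c)) fun z => minor (hMat k (P z)) I (twoIco n b c d) := by
  intro m
  obtain ⟨φ, hφ, hP⟩ := h.tl
  have h1 := twoArc_sum_mem hφ hbc hcd hd hbdk hkn hI m
  have hb0 := h.pos b (by omega)
  have hd0 := h.pos d hd
  have h2 : PosFam fun z => (∏ j ∈ twoIco n b c d, P z (compB n k (j + 1) (j + 1))) /
      (P z (compB n k b b) * P z (compB n k d d)) :=
    (PosFam.prod fun j _ => h.pos _ (by omega)).div (hb0.mul hd0)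
  refine (h2.nonneg.mul h1).congr ?_
  filter_upwards [hb0.ne_zero, hd0.ne_zero, h.eq_pl] with z hbz hdz ⟨V, hV⟩
  rw [hV] at hbz hdz
  rw [Pi.mul_apply, Finset.sum_apply, hV, div_mul_eq_mul_div, eq_div_iff (mul_ne_zero hbz hdz),
    coeff_minor_hMat V hk hkn hbc hcd hd hbdk hbz hdz hI]
  congr 1
  refine Finset.sum_congr rfl fun S hS => ?_
  obtain ⟨s1, s2, s3, s4, s5⟩ := mem_splits.1 hS
  rw [← hP, Pi.mul_apply, Pi.pow_apply, Pi.mul_apply]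
  · simp only [hV]
    rfl
  · rw [Finset.card_union_of_disjoint s3, card_compA (by omega) hkn, s2]
    omega
  · rw [Finset.card_union_of_disjoint s4, card_compB (by omega) hcd hd hkn,
      Finset.card_sdiff_of_subset s1, hI, s2]
    omega

end Families

/-! ### Rotation -/

section Rotation

variable {n k r : ℕ}

/-- The number of times the last element of `Fin n` occurs in `S` (zero or one). -/
def lastCount (S : Finset (Fin n)) : ℕ := (S.filter fun i => i.val + 1 = n).card

/-- Rotation keeps the order of the elements unless `S` contains the last one, which then becomes
the first. In that case the reordering is an `r`-cycle, of sign `(-1)^(r-1)`. -/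
theorem exists_perm_rotate {S : Finset (Fin n)} (hS : S.card = r)
    (hS' : (S.map (finRotate n).toEmbedding).card = r) :
    ∃ π : Equiv.Perm (Fin r), (Equiv.Perm.sign π : ℤ) = (-1) ^ ((r + 1) * lastCount S) ∧
      ∀ s, (S.map (finRotate n).toEmbedding).orderEmbOfFin hS' (π s) =
        finRotate n (S.orderEmbOfFin hS s) := by
  have hmono := (S.orderEmbOfFin hS).strictMono
  have himg : ∀ e : Equiv.Perm (Fin r), S.map (finRotate n).toEmbedding =
      Finset.univ.image fun s => finRotate n (S.orderEmbOfFin hS (e s)) := by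
    intro e
    conv_lhs => rw [← image_orderEmbOfFin hS]
    ext x
    simp only [Finset.mem_map, Finset.mem_image, Finset.mem_univ, true_and, Equiv.coe_toEmbedding]
    constructor
    · rintro ⟨_, ⟨s, rfl⟩, rfl⟩
      exact ⟨e.symm s, by simp⟩
    · rintro ⟨s, rfl⟩
      exact ⟨_, ⟨e s, rfl⟩, rfl⟩
  by_cases h : ∃ i ∈ S, i.val + 1 = n
  · obtain ⟨i, hi, hin⟩ := h
    have hc : lastCount S = 1 := by
      rw [lastCount, Finset.card_eq_one]
      refine ⟨i, ?_⟩
      ext x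
      simp only [Finset.mem_filter, Finset.mem_singleton, Fin.ext_iff]
      constructor
      · rintro ⟨-, h⟩
        omega
      · intro h
        exact ⟨(Fin.ext h : x = i) ▸ hi, by omega⟩
    have hval : ∀ a : Fin r, (S.orderEmbOfFin hS a).val + 1 = n → a.val + 1 = r := by
      intro a ha
      by_contra har
      have h1 := hmono (show a < ⟨a + 1, by omega⟩ by rw [Fin.lt_def]; simp)
      rw [Fin.lt_def] at h1
      omega
    have hval' : ∀ a : Fin r, a.val + 1 = r → (S.orderEmbOfFin hS a).val + 1 = n := by
      intro a ha
      obtain ⟨t, ht⟩ : ∃ t, S.orderEmbOfFin hS t = i := by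
        have : i ∈ Set.range (S.orderEmbOfFin hS) := by simpa using hi
        exact this
      have h1 := hval t (by rw [ht, hin])
      rw [show a = t from Fin.ext (by omega), ht, hin]
    obtain ⟨r, rfl⟩ : ∃ r', r = r' + 1 := ⟨r - 1, by
      have := Finset.card_pos.2 ⟨i, hi⟩
      omega⟩
    refine ⟨finRotate (r + 1), ?_, fun s => ?_⟩
    · rw [sign_finRotate, hc]
      push_cast
      rw [mul_one, pow_add, pow_add]
      norm_num
    · have h1 : StrictMono fun s =>
          finRotate n (S.orderEmbOfFin hS ((finRotate (r + 1)).symm s)) := by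
        intro u v huv
        obtain ⟨a, rfl⟩ : ∃ a, finRotate (r + 1) a = u := ⟨_, Equiv.apply_symm_apply _ _⟩
        obtain ⟨b, rfl⟩ : ∃ a, finRotate (r + 1) a = v := ⟨_, Equiv.apply_symm_apply _ _⟩
        simp only [Equiv.symm_apply_apply]
        rw [Fin.lt_def, finRotate_val, finRotate_val] at huv ⊢
        have ha := hval a
        have ha' := hval' a
        have hb := hval b
        have hb' := hval' b
        by_cases h1 : a.val + 1 = r + 1 <;> by_cases h2 : b.val + 1 = r + 1
        · rw [if_pos h1, if_pos h2] at huv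
          omega
        · rw [if_pos (ha' h1), if_neg (fun h => h2 (hb h))]
          omega
        · rw [if_neg h1, if_pos h2] at huv
          omega
        · rw [if_neg h1, if_neg h2] at huv
          have h3 := hmono (show a < b by rw [Fin.lt_def]; omega)
          rw [Fin.lt_def] at h3
          rw [if_neg (fun h => h1 (ha h)), if_neg (fun h => h2 (hb h))]
          omega
      rw [orderEmbOfFin_image h1 (himg _) hS']
      simp
  · push Not at h
    have hc : lastCount S = 0 := by
      rw [lastCount, Finset.card_eq_zero, Finset.filter_eq_empty_iff]
      exact h
    refine ⟨1, by simp [hc], fun s => ?_⟩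
    have h1 : StrictMono fun s => finRotate n (S.orderEmbOfFin hS s) := by
      intro u v huv
      have h2 := hmono huv
      have h3 := h _ (Finset.orderEmbOfFin_mem S hS u)
      have h4 := h _ (Finset.orderEmbOfFin_mem S hS v)
      rw [Fin.lt_def] at h2 ⊢
      rw [finRotate_val, finRotate_val, if_neg h3, if_neg h4]
      omega
    rw [orderEmbOfFin_image h1 (himg 1) hS']
    simp

theorem minor_rotate {K : Type*} [CommRing K] (A : Matrix (Fin n) (Fin n) K)
    {I J : Finset (Fin n)} (hI : I.card = r) (hJ : J.card = r) :
    minor (A.submatrix (finRotate n) (finRotate n)) I J =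
      (-1) ^ ((r + 1) * lastCount I) * (-1) ^ ((r + 1) * lastCount J) *
        minor A (I.map (finRotate n).toEmbedding) (J.map (finRotate n).toEmbedding) := by
  have hI' : (I.map (finRotate n).toEmbedding).card = r := by rw [Finset.card_map, hI]
  have hJ' : (J.map (finRotate n).toEmbedding).card = r := by rw [Finset.card_map, hJ]
  obtain ⟨π, hπ, hπ'⟩ := exists_perm_rotate hI hI'
  obtain ⟨ρ, hρ, hρ'⟩ := exists_perm_rotate hJ hJ'
  rw [minor_of_card _ hI hJ, minor_of_card _ hI' hJ']
  have e : (A.submatrix (finRotate n) (finRotate n)).submatrix (I.orderEmbOfFin hI)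
      (J.orderEmbOfFin hJ) = ((A.submatrix ((I.map (finRotate n).toEmbedding).orderEmbOfFin hI')
        ((J.map (finRotate n).toEmbedding).orderEmbOfFin hJ')).submatrix π id).submatrix id ρ := by
    ext s t
    simp only [Matrix.submatrix_apply, id, hπ', hρ']
  rw [e, Matrix.det_permute', Matrix.det_permute, hπ, hρ]
  push_cast
  ring

/-- Multiplying the row that wraps around by `(-1)^(k+1)` cancels the sign of the cycle, so a
rotated Plücker vector is again a Plücker vector, without signs. -/
theorem pl_rotate {K : Type*} [CommRing K] (V : Matrix (Fin n) (Fin k) K) (S : Finset (Fin n)) :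
    pl (Matrix.of fun i s => (if i.val + 1 = n then (-1) ^ (k + 1) else 1) * V (finRotate n i) s) S =
      pl V (S.map (finRotate n).toEmbedding) := by
  by_cases hS : S.card = k
  · have hS' : (S.map (finRotate n).toEmbedding).card = k := by rw [Finset.card_map, hS]
    obtain ⟨π, hπ, hπ'⟩ := exists_perm_rotate hS hS'
    rw [pl_of_card hS, pl_of_card hS']
    have e : (Matrix.of fun (i : Fin n) s => (if i.val + 1 = n then (-1) ^ (k + 1) else 1) *
        V (finRotate n i) s).submatrix (S.orderEmbOfFin hS) id = Matrix.of fun s t =>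
          (if (S.orderEmbOfFin hS s).val + 1 = n then (-1) ^ (k + 1) else 1) *
            ((V.submatrix ((S.map (finRotate n).toEmbedding).orderEmbOfFin hS') id).submatrix π id)
              s t := by
      ext s t
      simp only [Matrix.submatrix_apply, id, hπ', Matrix.of_apply]
    rw [e, Matrix.det_mul_column, Matrix.det_permute, hπ,
      prod_orderEmbOfFin hS fun i => if i.val + 1 = n then (-1 : K) ^ (k + 1) else 1,
      Finset.prod_ite, Finset.prod_const_one, Finset.prod_const, mul_one, ← mul_assoc]
    rw [← lastCount]
    push_cast
    rw [← pow_mul, ← mul_pow]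
    simp
  · rw [pl_of_card_ne hS, pl_of_card_ne (by rwa [Finset.card_map])]

theorem map_rotate_compB {d : ℕ} (hkn : k ≤ n) (hd : d ≤ n) :
    (compB n k d d).map (finRotate n).toEmbedding =
      compB n k (if d = n then 1 else d + 1) (if d = n then 1 else d + 1) := by
  ext i
  obtain ⟨a, rfl⟩ : ∃ a, finRotate n a = i := ⟨_, Equiv.apply_symm_apply _ _⟩
  rw [Finset.mem_map_equiv, Equiv.symm_apply_apply, mem_compB, mem_compB, finRotate_val]
  have := a.2
  split_ifs <;> omega

/-- Rotation changes the truth of `i < j` only if exactly one of the two indices wraps from last to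
first; the factor `X` attached to a wrapping row or column compensates for this. -/
theorem hMat_rotate {K : Type*} [CommRing K] (hk : 1 ≤ k) (hkn : k ≤ n) (P : Finset (Fin n) → K)
    (i j : Fin n) :
    (if j.val + 1 = n then X else 1) * hMat k P (finRotate n i) (finRotate n j) =
      (if i.val + 1 = n then X else 1) *
        hMat k (fun S => P (S.map (finRotate n).toEmbedding)) i j := by
  have e : (insert i (compB n (k - 1) j j)).map (finRotate n).toEmbedding =
      insert (finRotate n i) (compB n (k - 1) (finRotate n j).val (finRotate n j).val) := by
    rw [Finset.map_insert, map_rotate_compB (by omega) (by omega), finRotate_val]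
    congr 1
    ext x
    rw [mem_compB, mem_compB]
    split_ifs <;> omega
  rw [hMat, hMat, Matrix.of_apply, Matrix.of_apply, e]
  simp only [Fin.lt_def, finRotate_val]
  have := i.2
  have := j.2
  by_cases h1 : i.val + 1 = n <;> by_cases h2 : j.val + 1 = n <;>
    simp only [h1, h2, if_true, if_false]
  · rw [if_neg (by omega), if_neg (by omega)]
  · rw [if_pos (by omega), if_neg (by omega)]
    ring
  · rw [if_neg (by omega), if_pos (by omega)]
    ring
  · by_cases h3 : i.val < j.val
    · rw [if_pos (by omega), if_pos h3]
    · rw [if_neg (by omega), if_neg h3]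

theorem minor_hMat_rotate {K : Type*} [CommRing K] (hk : 1 ≤ k) (hkn : k ≤ n)
    (P : Finset (Fin n) → K) {I J : Finset (Fin n)} (hI : I.card = r) (hJ : J.card = r) :
    ((-1) ^ (r + 1) * X) ^ lastCount J *
        minor (hMat k P) (I.map (finRotate n).toEmbedding) (J.map (finRotate n).toEmbedding) =
      ((-1) ^ (r + 1) * X) ^ lastCount I *
        minor (hMat k (fun S => P (S.map (finRotate n).toEmbedding))) I J := by
  have hprod : ∀ S : Finset (Fin n), (∏ i ∈ S, if i.val + 1 = n then (X : K[X]) else 1) =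
      X ^ lastCount S := by
    intro S
    rw [Finset.prod_ite, Finset.prod_const_one, Finset.prod_const, mul_one]
    rfl
  have h1 := minor_scale ((hMat k P).submatrix (finRotate n) (finRotate n)) (fun _ => 1)
    (fun j => if j.val + 1 = n then (X : K[X]) else 1) I J
  have h2 := minor_scale (hMat k (fun S => P (S.map (finRotate n).toEmbedding)))
    (fun i => if i.val + 1 = n then (X : K[X]) else 1) (fun _ => 1) I J
  have e : (Matrix.of fun i j => 1 * (if j.val + 1 = n then (X : K[X]) else 1) *
      ((hMat k P).submatrix (finRotate n) (finRotate n)) i j) =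
      Matrix.of fun i j => (if i.val + 1 = n then (X : K[X]) else 1) * 1 *
        (hMat k (fun S => P (S.map (finRotate n).toEmbedding))) i j := by
    ext1 i j
    simp only [Matrix.of_apply, one_mul, mul_one, Matrix.submatrix_apply]
    exact hMat_rotate hk hkn P i j
  rw [e, h2, hprod, hprod, minor_rotate _ hI hJ, Finset.prod_const_one, Finset.prod_const_one,
    one_mul, mul_one] at h1
  rw [mul_pow, mul_pow, ← pow_mul, ← pow_mul, mul_assoc ((-1) ^ ((r + 1) * lastCount I)), h1]
  have hs : (-1 : K[X]) ^ ((r + 1) * lastCount I) * (-1) ^ ((r + 1) * lastCount I) = 1 := by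
    rw [← mul_pow]
    simp
  linear_combination (-(-1 : K[X]) ^ ((r + 1) * lastCount J) * X ^ lastCount J *
    minor (hMat k P) (I.map (finRotate n).toEmbedding) (J.map (finRotate n).toEmbedding)) * hs

end Rotation

section Families

variable {σ : Type} {n k r : ℕ}

theorem PlFam.rotate {P : (σ → ℂˣ) → Finset (Fin n) → ℂ} (h : PlFam k P) (hkn : k < n) :
    PlFam k fun z S => P z (S.map (finRotate n).toEmbedding) where
  tl := h.tl.rotate
  pos d hd := by
    simp only [map_rotate_compB hkn.le hd]
    exact h.pos _ (by split_ifs <;> omega)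
  eq_pl := by
    filter_upwards [h.eq_pl] with z ⟨V, hV⟩
    exact ⟨_, funext fun S => by rw [hV, pl_rotate V S]⟩

/-- Multiplication by a power of `(-1)^(r+1) X` merely shifts the coefficients together with their
prescribed signs. -/
theorem PolyNonneg.of_mul_eq {F G : (σ → ℂˣ) → ℂ[X]} (hG : PolyNonneg r G) {a b : ℕ}
    (h : ∀ z, ((-1) ^ (r + 1) * X) ^ a * F z = ((-1) ^ (r + 1) * X) ^ b * G z) :
    PolyNonneg r F := by
  have hs : ∀ q : ℕ, ((-1 : ℂ) ^ (r + 1)) ^ q * ((-1) ^ (r + 1)) ^ q = 1 := by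
    intro q
    rw [← mul_pow, ← mul_pow]
    simp
  have hc : ∀ (q : ℕ) (f : ℂ[X]), ((-1) ^ (r + 1) * X) ^ q * f =
      C (((-1) ^ (r + 1)) ^ q) * (f * X ^ q) := by
    intro q f
    simp only [C_pow, C_neg, C_1]
    ring
  intro m
  by_cases hb : b ≤ m + a
  · refine (hG (m + a - b)).congr (.of_forall fun z => ?_)
    have h1 := congrArg (fun p => p.coeff (m + a)) (h z)
    simp only [hc, coeff_C_mul, coeff_mul_X_pow] at h1
    rw [coeff_mul_X_pow', if_pos hb] at h1
    have h2 : (-1 : ℂ) ^ ((r + 1) * m) =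
        ((-1) ^ (r + 1)) ^ a * (((-1) ^ (r + 1)) ^ b * (-1) ^ ((r + 1) * (m + a - b))) := by
      rw [pow_mul, pow_mul, ← pow_add, show b + (m + a - b) = m + a by omega,
        pow_add _ m a, mul_left_comm, hs, mul_one]
    rw [h2]
    linear_combination (((-1 : ℂ) ^ (r + 1)) ^ b * (-1) ^ ((r + 1) * (m + a - b))) * h1 +
      ((-1 : ℂ) ^ ((r + 1) * (m + a - b)) * (G z).coeff (m + a - b)) * hs b
  · refine nonnegFam_zero.congr (.of_forall fun z => ?_)
    have h1 := congrArg (fun p => p.coeff (m + a)) (h z)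
    simp only [hc, coeff_C_mul, coeff_mul_X_pow] at h1
    rw [coeff_mul_X_pow', if_neg hb, mul_zero] at h1
    rw [(mul_eq_zero.1 h1).resolve_left, mul_zero]
    exact pow_ne_zero _ (pow_ne_zero _ (by norm_num))

/-- The rotations of the sets `[0, b) ∪ [c, d)`. -/
def TwoArc (J : Finset (Fin n)) : Prop :=
  ∃ q b c d : ℕ, b ≤ c ∧ c ≤ d ∧ d ≤ n ∧
    J = (twoIco n b c d).map ((finRotate n) ^ q : Equiv.Perm (Fin n)).toEmbedding

/-- The two intervals are rotated back to `[0, b)` and `[c, d)` one step at a time. Each step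
replaces the family by its rotation and multiplies the minor by signed powers of the variable. -/
theorem polyNonneg_minor_of_le {P : (σ → ℂˣ) → Finset (Fin n) → ℂ} (h : PlFam k P) (hk : 1 ≤ k)
    (hkn : k < n) (hr : r ≤ k) {I J : Finset (Fin n)} (hI : I.card = r) (hJ : J.card = r)
    (hJ2 : TwoArc J) : PolyNonneg r fun z => minor (hMat k (P z)) I J := by
  obtain ⟨q, b, c, d, hbc, hcd, hd, rfl⟩ := hJ2
  rw [Finset.card_map] at hJ
  induction q generalizing P I with
  | zero =>
    have hJ' := card_twoIco hbc hcd hd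
    have := polyNonneg_minor_twoIco h hk hkn.le hbc hcd hd (by omega) (I := I) (by omega)
    rw [← hJ', hJ] at this
    rw [pow_zero, Equiv.Perm.one_def]
    simpa using this
  | succ q ih =>
    have h1 := ih (h.rotate hkn) (I := I.map (finRotate n).symm.toEmbedding)
      (by rw [Finset.card_map, hI])
    have hI' : (I.map (finRotate n).symm.toEmbedding).map (finRotate n).toEmbedding = I := by
      ext x
      rw [Finset.mem_map_equiv, Finset.mem_map_equiv, Equiv.symm_symm, Equiv.apply_symm_apply]
    have hJ' : (twoIco n b c d).map ((finRotate n) ^ (q + 1) : Equiv.Perm (Fin n)).toEmbedding =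
        ((twoIco n b c d).map ((finRotate n) ^ q : Equiv.Perm (Fin n)).toEmbedding).map
          (finRotate n).toEmbedding := by
      rw [Finset.map_map, pow_succ']
      rfl
    refine h1.of_mul_eq (a := lastCount ((twoIco n b c d).map
      ((finRotate n) ^ q : Equiv.Perm (Fin n)).toEmbedding))
      (b := lastCount (I.map (finRotate n).symm.toEmbedding)) fun z => ?_
    have h2 := minor_hMat_rotate hk hkn.le (P z)
        (I := I.map (finRotate n).symm.toEmbedding)
        (J := (twoIco n b c d).map ((finRotate n) ^ q : Equiv.Perm (Fin n)).toEmbedding)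
        (by rw [Finset.card_map, hI]) (by rw [Finset.card_map, hJ])
    rw [hI', ← hJ'] at h2
    exact h2

end Families

/-! ### Duality -/

section Duality

variable {n k r : ℕ}

theorem orderEmbOfFin_map_rev {S : Finset (Fin n)} (hS : S.card = r)
    (hS' : (S.map Fin.revPerm.toEmbedding).card = r) (s : Fin r) :
    (S.map Fin.revPerm.toEmbedding).orderEmbOfFin hS' s = (S.orderEmbOfFin hS s.rev).rev := by
  have h : StrictMono fun s : Fin r => (S.orderEmbOfFin hS s.rev).rev := fun u v huv => by
    simpa using huv
  rw [orderEmbOfFin_image h _ hS']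
  conv_lhs => rw [← image_orderEmbOfFin hS]
  ext x
  simp only [Finset.mem_map, Finset.mem_image, Finset.mem_univ, true_and, Equiv.coe_toEmbedding,
    Fin.revPerm_apply]
  constructor
  · rintro ⟨_, ⟨s, rfl⟩, rfl⟩
    exact ⟨s.rev, by simp⟩
  · rintro ⟨s, rfl⟩
    exact ⟨_, ⟨s.rev, rfl⟩, rfl⟩

/-- The image of a set under the reversal of `Fin n`. -/
abbrev revSet (S : Finset (Fin n)) : Finset (Fin n) := S.map Fin.revPerm.toEmbedding

theorem mem_revSet {S : Finset (Fin n)} {i : Fin n} : i ∈ revSet S ↔ i.rev ∈ S := by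
  rw [revSet, Finset.mem_map_equiv, Fin.revPerm_symm, Fin.revPerm_apply]

theorem revSet_revSet (S : Finset (Fin n)) : revSet (revSet S) = S := by
  ext i
  rw [mem_revSet, mem_revSet, Fin.rev_rev]

theorem minor_flip {K : Type*} [CommRing K] (A : Matrix (Fin n) (Fin n) K)
    (I J : Finset (Fin n)) :
    minor (Matrix.of fun i j => A j.rev i.rev) I J = minor A (revSet J) (revSet I) := by
  by_cases h : J.card = I.card
  · rw [minor_of_card _ rfl h, minor_of_card A (r := I.card) (by rw [Finset.card_map, h])
      (by rw [Finset.card_map]), ← Matrix.det_transpose, ← Matrix.det_submatrix_equiv_self Fin.revPerm]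
    congr 1
    ext s t
    simp only [Matrix.submatrix_apply, Matrix.transpose_apply, Matrix.of_apply, Fin.revPerm_apply]
    rw [orderEmbOfFin_map_rev h, orderEmbOfFin_map_rev rfl]
  · rw [minor, minor, dif_neg h, dif_neg]
    rw [Finset.card_map, Finset.card_map]
    exact Ne.symm h

theorem minor_jacobi {K : Type*} [CommRing K] {A B : Matrix (Fin n) (Fin n) K} {c : K}
    (hAB : A * B = c • 1) {I J : Finset (Fin n)} (h : I.card = J.card) :
    A.det * ((∏ j ∈ J, (-1) ^ (j : ℕ)) * minor B Jᶜ Iᶜ) =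
      (∏ i ∈ I, (-1) ^ (i : ℕ)) * (c ^ Iᶜ.card * minor A I J) := by
  have h1 : Jᶜ.card = Iᶜ.card := by rw [Finset.card_compl, Finset.card_compl, h]
  rw [minor_of_card B h1 rfl, minor_of_card A rfl h.symm]
  exact jacobi_minor hAB rfl h.symm rfl h1

theorem pl_eq_minor {K : Type*} [CommRing K] (A : Matrix (Fin n) (Fin n) K) (hk : k ≤ n)
    (S : Finset (Fin n)) :
    pl (Matrix.of fun i (u : Fin k) => A i ⟨u, by omega⟩) S = minor A S (ico n 0 k) := by
  have h0 : (ico n 0 k).card = k := by rw [card_ico hk (Nat.zero_le _), Nat.sub_zero]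
  by_cases hS : S.card = k
  · have hu : ico n 0 k = Finset.univ.image fun u : Fin k => (⟨u, by omega⟩ : Fin n) := by
      ext i
      simp only [mem_ico, Finset.mem_image, Finset.mem_univ, true_and, zero_le]
      constructor
      · intro h
        exact ⟨⟨i, h⟩, rfl⟩
      · rintro ⟨u, rfl⟩
        exact u.2
    have hm : StrictMono fun u : Fin k => (⟨u, by omega⟩ : Fin n) := fun u v h => h
    rw [pl_of_card hS, minor_of_card A hS h0, orderEmbOfFin_image hm hu h0]
    rfl
  · rw [pl_of_card_ne hS, minor, dif_neg]
    rw [h0]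
    exact Ne.symm hS

theorem rowDet_col_eq_pl {K : Type*} [CommRing K] (V : Matrix (Fin n) (Fin k) K)
    (S : Finset (Fin n)) : rowDet (List.ofFn V.col) S = pl V S := by
  by_cases hS : S.card = k
  · rw [rowDet_ofFn_orderEmb hS, pl_of_card hS]
    rfl
  · rw [rowDet_eq_zero_of_card (by simpa using hS), pl_of_card_ne hS]

variable {K : Type*} [Field K]

/-- The unit vectors outside `A₀` complete the columns of `V` to an invertible matrix, whose
determinant is `pl V A₀` up to sign. -/
theorem exists_extension {V : Matrix (Fin n) (Fin k) K} (hk : k ≤ n) {A₀ : Finset (Fin n)}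
    (hV : pl V A₀ ≠ 0) : ∃ A : Matrix (Fin n) (Fin n) K, A.det ≠ 0 ∧
      ∀ i (u : Fin k), A i ⟨u, by omega⟩ = V i u := by
  have hA₀ : A₀.card = k := by
    by_contra h
    exact hV (pl_of_card_ne h)
  have hA₀' : A₀ᶜ.card = n - k := by rw [Finset.card_compl, hA₀, Fintype.card_fin]
  set e : Fin n → Fin (k + (n - k)) := Fin.cast (by omega) with he
  set f : Fin (k + (n - k)) → Fin n → K := Fin.append V.col fun u =>
    (Pi.single (A₀ᶜ.orderEmbOfFin hA₀' u) 1 : Fin n → K) with hf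
  refine ⟨Matrix.of fun i j => f (e j) i, ?_, fun i u => ?_⟩
  · have h1 : rowDet (List.ofFn fun j => f (e j)) Finset.univ =
        (Matrix.of fun i j => f (e j) i).det := by
      have := rowDet_ofFn (strictMono_id (α := Fin n)) fun j => f (e j)
      rwa [Finset.image_id] at this
    have h2 : (List.ofFn fun j => f (e j)) = List.ofFn f := by
      refine List.ext_getElem (by simp; omega) fun i _ _ => ?_
      simp [he]
    rw [← h1, h2, hf, List.ofFn_fin_append, rowDet_append, Finset.sum_eq_single A₀]
    · rw [← Finset.compl_eq_univ_sdiff, rowDet_pi_single, rowDet_col_eq_pl, mul_one]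
      exact mul_ne_zero (pow_ne_zero _ (by norm_num)) hV
    · intro S _ hS
      by_cases hc : S.card = k
      · obtain ⟨i, hi, hi'⟩ : ∃ i ∈ A₀, i ∉ S := by
          by_contra! hsub
          exact hS (Finset.eq_of_subset_of_card_le hsub (by omega)).symm
        refine mul_eq_zero_of_right _ (rowDet_eq_zero_of_row (i := i) (by simp [hi']) ?_)
        intro d hd
        obtain ⟨u, rfl⟩ := List.mem_ofFn.1 hd
        refine Pi.single_eq_of_ne ?_ _
        rintro rfl
        exact Finset.mem_compl.1 (Finset.orderEmbOfFin_mem _ _ _) hi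
      · rw [rowDet_eq_zero_of_card (cs := List.ofFn V.col) (by simpa using hc), mul_zero, zero_mul]
    · simp
  · have : e ⟨u, by omega⟩ = Fin.castAdd (n - k) u := rfl
    rw [Matrix.of_apply, this, hf, Fin.append_left]
    rfl

theorem revSet_ico (hk : k ≤ n) : revSet (ico n 0 (n - k)) = (ico n 0 k)ᶜ := by
  ext i
  rw [mem_revSet, mem_ico, Finset.mem_compl, mem_ico, Fin.val_rev]
  have := i.2
  omega

/-- The orthogonal complement, with coordinates reversed and up to signs. -/
theorem exists_dual_pl {V : Matrix (Fin n) (Fin k) K} (hk : k < n) {A₀ : Finset (Fin n)}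
    (hV : pl V A₀ ≠ 0) : ∃ V' : Matrix (Fin n) (Fin (n - k)) K,
      ∀ S, pl V' S = pl V (revSet S)ᶜ := by
  obtain ⟨A, hA, hAV⟩ := exists_extension hk.le hV
  have hV' : V = Matrix.of fun i (u : Fin k) => A i ⟨u, by omega⟩ := by
    ext i u
    rw [Matrix.of_apply, hAV]
  have hinv : A * A⁻¹ = (1 : K) • 1 := by
    rw [one_smul, Matrix.mul_nonsing_inv _ (isUnit_iff_ne_zero.2 hA)]
  -- The first `n - k` columns of this matrix are, up to reversal and signs, the last `n - k` rows
  -- of `A⁻¹`, which annihilate the columns of `V`. Jacobi's identity turns their minors into the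
  -- complementary maximal minors of `V`.
  set A' : Matrix (Fin n) (Fin n) K := Matrix.of fun i j =>
    (-1) ^ (i.rev : ℕ) * 1 * (Matrix.of fun i j : Fin n => A⁻¹ j.rev i.rev) i j with hA'
  set W : Matrix (Fin n) (Fin (n - k)) K := Matrix.of fun i u => A' i ⟨u, by omega⟩ with hW
  obtain ⟨κ, hκ⟩ : ∃ κ : K, ∀ S, pl W S * κ = pl V (revSet S)ᶜ := by
    refine ⟨A.det * (∏ j ∈ ico n 0 k, (-1) ^ (j : ℕ)) * ∏ j : Fin n, (-1) ^ (j : ℕ), fun S => ?_⟩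
    by_cases hS : S.card = n - k
    · have hc : (revSet S)ᶜ.card = (ico n 0 k).card := by
        rw [Finset.card_compl, Finset.card_map, Fintype.card_fin, hS, card_ico hk.le (Nat.zero_le _)]
        omega
      have h1 := minor_jacobi hinv hc
      rw [one_pow, one_mul] at h1
      rw [hW, pl_eq_minor A' (by omega), hA', minor_scale, minor_flip, revSet_ico hk.le,
        Finset.prod_const_one, mul_one]
      rw [compl_compl] at h1
      have h2 : ∏ i ∈ S, (-1 : K) ^ (i.rev : ℕ) = ∏ i ∈ revSet S, (-1 : K) ^ (i : ℕ) := by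
        rw [Finset.prod_map]
        rfl
      have h3 : (∏ i ∈ revSet S, (-1 : K) ^ (i : ℕ)) * ∏ i ∈ (revSet S)ᶜ, (-1 : K) ^ (i : ℕ) =
          ∏ j : Fin n, (-1) ^ (j : ℕ) := Finset.prod_mul_prod_compl _ _
      have hs : ∀ T : Finset (Fin n), (∏ i ∈ T, (-1 : K) ^ (i : ℕ)) *
          ∏ i ∈ T, (-1 : K) ^ (i : ℕ) = 1 := fun T => by
        rw [← Finset.prod_mul_distrib]
        refine Finset.prod_eq_one fun i _ => ?_
        rw [← mul_pow]
        simp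
      have h4 := hs (revSet S)
      have h5 := hs (revSet S)ᶜ
      rw [h2, ← h3, hV', pl_eq_minor A hk.le]
      set p := ∏ i ∈ revSet S, (-1 : K) ^ (i : ℕ)
      set q := ∏ i ∈ (revSet S)ᶜ, (-1 : K) ^ (i : ℕ)
      linear_combination (p * p * q) * h1 + minor A (revSet S)ᶜ (ico n 0 k) * (q * q * h4 + h5)
    · rw [pl_of_card_ne hS, zero_mul, pl_of_card_ne]
      rw [Finset.card_compl, Finset.card_map, Fintype.card_fin]
      have := Finset.card_le_univ S
      rw [Fintype.card_fin] at this
      omega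
  -- Scaling a single column absorbs the common factor `κ`; there is a column to scale because `k <
  -- n`.
  refine ⟨W * (Matrix.diagonal (Function.update 1 ⟨0, by omega⟩ κ) :
    Matrix (Fin (n - k)) (Fin (n - k)) K), fun S => ?_⟩
  rw [pl_mul, Matrix.det_diagonal, Finset.prod_update_of_mem (Finset.mem_univ _)]
  simp [hκ]

variable {V : Matrix (Fin n) (Fin k) K} {V' : Matrix (Fin n) (Fin (n - k)) K}

/-- The vector `V w` depends linearly on the `k` columns of `V`, so the determinant of these `k + 1`
columns vanishes; expand it along `V w`. -/
theorem sum_pl_erase_eq_zero (V : Matrix (Fin n) (Fin k) K) (w : Fin k → K)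
    {W : Finset (Fin n)} (hW : W.card = k + 1) :
    ∑ l ∈ W, (-1) ^ (W.filter (· < l)).card * V.mulVec w l * pl V (W.erase l) = 0 := by
  have h : rowDet (V.mulVec w :: List.ofFn V.col) W = 0 := by
    have e : V.mulVec w :: List.ofFn V.col = List.ofFn (Fin.cons (V.mulVec w) V.col) := by
      rw [List.ofFn_cons]
    rw [e, rowDet_ofFn_orderEmb hW]
    refine Matrix.exists_mulVec_eq_zero_iff.1 ⟨Fin.cons (-1) w, fun h => ?_, ?_⟩
    · have := congrFun h 0
      simp at this
    · funext s
      rw [Matrix.mulVec, dotProduct, Fin.sum_univ_succ]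
      change V.mulVec w (W.orderEmbOfFin hW s) * (-1) +
        ∑ u : Fin k, V (W.orderEmbOfFin hW s) u * w u = 0
      rw [mul_neg_one, neg_add_eq_zero]
      rfl
  rw [rowDet] at h
  simpa only [rowDet_col_eq_pl] using h

/-- Orthogonality of `V` and its dual. As a function of `l`, the dual `om` is up to sign the Plücker
coordinate of `V` on `W \ {l}`, for the cyclic interval `W` of length `k + 1` ending at `i`, while
`om V j` lies in the column space of `V`. What remains is to match the signs on `W`. -/
theorem sum_om_dual (hV : ∀ S, pl V' S = pl V (revSet S)ᶜ) (hk : 1 ≤ k) (hkn : k < n)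
    (i j : Fin n) :
    ∑ l : Fin n, (-1) ^ (i.val + l.val) * (om V' i.rev l.rev * om V j l) = 0 := by
  obtain ⟨w, hw⟩ := exists_om V hk hkn.le j
  set A := compB n (n - k - 1) i.rev i.rev with hA
  set W := (revSet A)ᶜ with hW
  have hmemW : ∀ l, l ∈ W ↔ l.rev ∉ A := fun l => by rw [hW, Finset.mem_compl, mem_revSet]
  have hWc : W.card = k + 1 := by
    rw [hW, Finset.card_compl, Finset.card_map, card_compB_self (by omega) (by omega),
      Fintype.card_fin]
    omega
  have h0 := sum_pl_erase_eq_zero V w hWc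
  rw [← hw] at h0
  have hmemW' : ∀ l, l ∈ W ↔ (i.val ≤ l.val + k ∧ l ≤ i) ∨ n + i.val ≤ l.val + k := by
    intro l
    rw [hmemW, hA, mem_compB, Fin.le_def, Fin.val_rev, Fin.val_rev]
    have := l.2
    have := i.2
    omega
  have hom : ∀ l, om V' i.rev l.rev = if l ∈ W then
      (-1) ^ (if i < l then n - k + 1 else 0) * pl V (W.erase l) else 0 := by
    intro l
    by_cases hl : l ∈ W
    · rw [if_pos hl, om, hV]
      simp only [Fin.rev_lt_rev]
      congr 2
      ext x
      rw [Finset.mem_compl, mem_revSet, Finset.mem_insert, Finset.mem_erase, hmemW, Fin.rev_inj]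
      tauto
    · rw [if_neg hl]
      rw [hmemW, not_not] at hl
      exact om_eq_zero V' (by omega) (by omega) hl
  rw [← Finset.sum_subset (Finset.subset_univ W)]
  · have hsign : ∃ ε : K, ∀ l ∈ W, (-1 : K) ^ (i.val + l.val) *
        (-1) ^ (if i < l then n - k + 1 else 0) = ε * (-1) ^ (W.filter (· < l)).card := by
      by_cases hik : k ≤ i.val
      · refine ⟨(-1) ^ k, fun l hl => ?_⟩
        rw [hmemW', Fin.le_def] at hl
        have := l.2
        have : W.filter (· < l) = ico n (i - k) l := by
          ext x
          rw [Finset.mem_filter, hmemW', mem_ico, Fin.le_def, Fin.lt_def]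
          have := x.2
          omega
        rw [this, card_ico (by omega) (by omega), if_neg (by rw [Fin.lt_def]; omega), pow_zero,
          mul_one, ← pow_add, show i.val + l.val = k + (l - (i - k)) + 2 * (i - k) by omega,
          pow_add, pow_mul]
        simp
      · refine ⟨(-1) ^ i.val, fun l hl => ?_⟩
        rw [hmemW', Fin.le_def] at hl
        have := l.2
        by_cases hli : l.val ≤ i.val
        · have : W.filter (· < l) = ico n 0 l := by
            ext x
            rw [Finset.mem_filter, hmemW', mem_ico, Fin.le_def, Fin.lt_def]
            have := x.2
            omega
          rw [this, card_ico (by omega) (by omega), if_neg (by rw [Fin.lt_def]; omega), pow_zero,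
            mul_one, pow_add]
          rfl
        · have : W.filter (· < l) = ico n 0 (i + 1) ∪ ico n (n + i - k) l := by
            ext x
            rw [Finset.mem_filter, hmemW', Finset.mem_union, mem_ico, mem_ico, Fin.le_def,
              Fin.lt_def]
            have := x.2
            omega
          rw [this, Finset.card_union_of_disjoint, card_ico (by omega) (by omega),
            card_ico (by omega) (by omega), if_pos (by rw [Fin.lt_def]; omega), ← pow_add,
            ← pow_add, show i.val + l.val + (n - k + 1) =
              i.val + (i.val + 1 - 0 + (l.val - (n + i.val - k))) + 2 * (n - k) by omega,
            pow_add _ _ (2 * _), pow_mul]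
          · simp
          · rw [Finset.disjoint_left]
            intro x
            rw [mem_ico, mem_ico]
            omega
    obtain ⟨ε, hε⟩ := hsign
    rw [← mul_zero ε, ← h0, Finset.mul_sum]
    refine Finset.sum_congr rfl fun l hl => ?_
    rw [hom, if_pos hl]
    linear_combination (pl V (W.erase l) * om V j l) * hε l hl
  · intro l _ hl
    rw [hom, if_neg hl, zero_mul, mul_zero]

/-- The matrix `hMat` of the dual, with the variable changed so as to correspond to that of
`hMat`. -/
noncomputable def dualMat (V' : Matrix (Fin n) (Fin (n - k)) K) : Matrix (Fin n) (Fin n) K[X] :=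
  (hMat (n - k) (pl V')).map (compRingHom ((-1) ^ n * X))

theorem dualMat_apply (hkn : k < n) (i j : Fin n) :
    dualMat V' i j = (if i < j then (-1) ^ (k + 1) * X else 1) * C (om V' j i) := by
  rw [dualMat, Matrix.map_apply, hMat_pl]
  split_ifs with h
  · rw [coe_compRingHom_apply, mul_comp, mul_comp, pow_comp, neg_comp, one_comp, X_comp, C_comp,
      ← mul_assoc _ _ X, ← pow_add, show n - k + 1 + n = k + 1 + 2 * (n - k) by omega,
      pow_add, pow_mul]
    simp
  · simp

/-- For `i ≠ j` the weights in the variable are constant on the common support of the two factors,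
so orthogonality makes the sum zero. For `i = j` the weight is `N` at every `l ≠ i` and `1` at `l =
i`, so orthogonality leaves `1 - N` times the term `l = i`. -/
theorem dual_mul_hMat (hV : ∀ S, pl V' S = pl V (revSet S)ᶜ) (hk : 1 ≤ k) (hkn : k < n)
    (i j : Fin n) :
    ∑ l : Fin n, (-1) ^ (i.val + l.val) * (dualMat V' l.rev i.rev * hMat k (pl V) l j) =
      if i = j then (1 - (-1) ^ (k + 1) * X) * C (om V' i.rev i.rev * om V i i) else 0 := by
  have h0 := sum_om_dual hV hk hkn i j
  set N : K[X] := (-1) ^ (k + 1) * X with hN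
  have ht : ∀ l : Fin n, (-1) ^ (i.val + l.val) * (dualMat V' l.rev i.rev * hMat k (pl V) l j) =
      ((if i < l then N else 1) * (if l < j then N else 1)) *
        C ((-1) ^ (i.val + l.val) * (om V' i.rev l.rev * om V j l)) := by
    intro l
    rw [dualMat_apply hkn, hMat_pl, ← hN]
    by_cases h1 : i < l <;> by_cases h2 : l < j <;>
      simp only [Fin.rev_lt_rev, h1, h2, if_true, if_false, C_mul, C_pow, C_neg, C_1] <;> ring
  simp only [ht]
  have h0' : ∑ l : Fin n, C ((-1) ^ (i.val + l.val) * (om V' i.rev l.rev * om V j l)) =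
      (0 : K[X]) := by
    rw [← map_sum, h0, C_0]
  by_cases hij : i = j
  · subst hij
    rw [if_pos rfl]
    have e : ∀ l : Fin n, ((if i < l then N else 1) * (if l < i then N else 1)) *
        C ((-1) ^ (i.val + l.val) * (om V' i.rev l.rev * om V i l)) =
        N * C ((-1) ^ (i.val + l.val) * (om V' i.rev l.rev * om V i l)) +
          if i = l then (1 - N) * C (om V' i.rev l.rev * om V i l) else 0 := by
      intro l
      rcases lt_trichotomy i l with h | rfl | h
      · rw [if_pos h, if_neg h.asymm, if_neg h.ne]
        ring
      · rw [if_neg (lt_irrefl _), if_pos rfl, Even.neg_one_pow ⟨_, rfl⟩,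
          one_mul (om _ _ _ * _)]
        ring
      · rw [if_neg h.asymm, if_pos h, if_neg h.ne']
        ring
    simp only [e]
    rw [Finset.sum_add_distrib, ← Finset.mul_sum, h0', mul_zero, zero_add, Finset.sum_ite_eq,
      if_pos (Finset.mem_univ _)]
  · rw [if_neg hij, ← mul_zero (if i < j then N else 1), ← h0', Finset.mul_sum]
    refine Finset.sum_congr rfl fun l _ => ?_
    by_cases hl1 : l.rev ∈ compB n (n - k - 1) i.rev i.rev
    · rw [om_eq_zero V' (by omega) (by omega) hl1]
      simp
    by_cases hl2 : l ∈ compB n (k - 1) j j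
    · rw [om_eq_zero V hk hkn.le hl2]
      simp
    congr 1
    rw [mem_compB, Fin.val_rev, Fin.val_rev] at hl1
    rw [mem_compB] at hl2
    simp only [Fin.lt_def]
    rw [Fin.ext_iff] at hij
    have := l.2
    have := i.2
    have := j.2
    by_cases h1 : i.val < j.val
    · rw [if_pos h1]
      by_cases h2 : i.val < l.val
      · rw [if_pos h2, if_neg (by omega), mul_one]
      · rw [if_neg h2, if_pos (by omega), one_mul]
    · rw [if_neg h1, if_neg (by omega), if_neg (by omega), one_mul]

end Duality

/-! ### Large minors by complementation, and the scalar factor. -/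

section DualMinors

variable {n k r : ℕ} {K : Type*} [Field K] {V : Matrix (Fin n) (Fin k) K}
  {V' : Matrix (Fin n) (Fin (n - k)) K}

theorem minor_hMat_top (V : Matrix (Fin n) (Fin k) K) (hk : 1 ≤ k) (hkn : k ≤ n) :
    minor (hMat k (pl V)) (ico n 0 k) (ico n 0 k) = ∏ i ∈ ico n 0 k, C (om V i i) := by
  have hc : (ico n 0 k).card = k := by rw [card_ico hkn (Nat.zero_le _), Nat.sub_zero]
  have hm : StrictMono fun u : Fin (k - 0) => (⟨0 + u, by omega⟩ : Fin n) :=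
    strictMono_ico hkn (Nat.zero_le k)
  have hi := ico_eq_image hkn (Nat.zero_le k)
  rw [minor_of_card _ (r := k - 0) hc hc, orderEmbOfFin_image hm hi,
    Matrix.det_of_isLowerTriangular, hi, Finset.prod_image fun _ _ _ _ h => hm.injective h]
  · refine Finset.prod_congr rfl fun u _ => ?_
    rw [Matrix.submatrix_apply, hMat_pl, if_neg (lt_irrefl _), one_mul]
  · intro u v huv
    rw [OrderDual.toDual_lt_toDual] at huv
    rw [Matrix.submatrix_apply, hMat_pl, om_eq_zero V hk hkn, C_0, mul_zero]
    rw [mem_compB]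
    rw [Fin.lt_def] at huv
    simp only
    omega

/-- After rescaling, the reversed dual matrix `A` satisfies `A H = 1 - N` with `N = (-1)^(k+1) X`.
Jacobi's identity gives `det A` times a minor of `H` as `(1 - N)^r` times a complementary minor of
`A`, up to sign; as `det A` is a constant times `(1 - N)^k`, exactly `r - k` factors survive. -/
theorem minor_hMat_dual (hV : ∀ S, pl V' S = pl V (revSet S)ᶜ) (hk : 1 ≤ k) (hkn : k < n)
    (h0 : ∀ i, om V i i ≠ 0) (h0' : ∀ i, om V' i i ≠ 0) {I J : Finset (Fin n)}
    (hI : I.card = r) (hJ : J.card = r) (hr : k ≤ r) :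
    minor (hMat k (pl V)) I J = (1 + (-1) ^ k * X) ^ (r - k) *
      (C ((∏ i, om V i i) * ∏ i ∈ Jᶜ, (om V' i.rev i.rev * om V i i)⁻¹) *
        minor (dualMat V') (revSet Iᶜ) (revSet Jᶜ)) := by
  have hs : ∀ T : Finset (Fin n), (∏ i ∈ T, (-1 : K[X]) ^ (i : ℕ)) *
      ∏ i ∈ T, (-1 : K[X]) ^ (i : ℕ) = 1 := fun T => by
    rw [← Finset.prod_mul_distrib]
    refine Finset.prod_eq_one fun i _ => ?_
    rw [← mul_pow]
    simp
  set N : K[X] := (-1) ^ (k + 1) * X with hN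
  have hN' : 1 + (-1) ^ k * X = 1 - N := by
    rw [hN]
    ring
  set H := hMat k (pl V) with hH
  set D : Matrix (Fin n) (Fin n) K[X] := Matrix.of fun i j => dualMat V' j.rev i.rev with hD
  set c : Fin n → K := fun i => (om V' i.rev i.rev * om V i i)⁻¹ with hc
  set A : Matrix (Fin n) (Fin n) K[X] :=
    Matrix.of fun i j => (C (c i) * (-1) ^ (i : ℕ)) * (-1) ^ (j : ℕ) * D i j with hA
  have hAH : A * H = (1 - N) • 1 := by
    ext1 i j
    have h1 := dual_mul_hMat hV hk hkn i j
    rw [Matrix.mul_apply, Matrix.smul_apply, Matrix.one_apply, smul_eq_mul]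
    have e : ∀ l, A i l * H l j = C (c i) * ((-1) ^ (i.val + l.val) *
        (dualMat V' l.rev i.rev * H l j)) := by
      intro l
      rw [hA, hD, Matrix.of_apply, Matrix.of_apply, pow_add]
      ring
    simp only [e]
    rw [← Finset.mul_sum, h1]
    split_ifs with hij
    · subst hij
      rw [mul_left_comm, ← C_mul, hc, inv_mul_cancel₀ (mul_ne_zero (h0' _) (h0 _)), C_1]
    · rw [mul_zero, mul_zero]
  have hmA : ∀ S T, minor A S T = (∏ i ∈ S, C (c i)) * (∏ i ∈ S, (-1 : K[X]) ^ (i : ℕ)) *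
      (∏ i ∈ T, (-1 : K[X]) ^ (i : ℕ)) * minor (dualMat V') (revSet T) (revSet S) := by
    intro S T
    rw [hA, minor_scale, hD, minor_flip, Finset.prod_mul_distrib]
  have hdet : A.det * C (∏ i, om V i i) = (1 - N) ^ k := by
    have hkc : (ico n 0 k)ᶜᶜ.card = k := by
      rw [compl_compl, card_ico hkn.le (Nat.zero_le _), Nat.sub_zero]
    -- The determinant of `A` is read off from one instance of Jacobi's identity in which both
    -- minors are triangular.
    have h1 := minor_jacobi hAH (I := (ico n 0 k)ᶜ) (J := (ico n 0 k)ᶜ) rfl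
    have hrev : revSet (ico n 0 k)ᶜ = ico n 0 (n - k) := by
      rw [← revSet_ico hkn.le, revSet_revSet]
    have htop : minor (dualMat V') (ico n 0 (n - k)) (ico n 0 (n - k)) =
        ∏ i ∈ (ico n 0 k)ᶜ, C (om V' i.rev i.rev) := by
      rw [dualMat, minor_map, minor_hMat_top V' (by omega) (by omega), map_prod, ← hrev,
        Finset.prod_map]
      refine Finset.prod_congr rfl fun i _ => ?_
      simp
    rw [hkc, hmA, hrev, htop, compl_compl, hH, minor_hMat_top V hk hkn.le] at h1
    have h2 : (∏ i ∈ (ico n 0 k)ᶜ, C (c i)) * (∏ i ∈ (ico n 0 k)ᶜ, C (om V' i.rev i.rev)) *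
        ∏ i ∈ (ico n 0 k)ᶜ, C (om V i i) = 1 := by
      rw [← Finset.prod_mul_distrib, ← Finset.prod_mul_distrib]
      refine Finset.prod_eq_one fun i _ => ?_
      rw [← C_mul, ← C_mul, hc, mul_assoc, inv_mul_cancel₀ (mul_ne_zero (h0' _) (h0 _)), C_1]
    have h3 : C (∏ i, om V i i) = (∏ i ∈ ico n 0 k, C (om V i i)) *
        ∏ i ∈ (ico n 0 k)ᶜ, C (om V i i) := by
      rw [map_prod, Finset.prod_mul_prod_compl]
    rw [h3]
    have h4 := hs (ico n 0 k)ᶜ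
    set p := ∏ i ∈ (ico n 0 k)ᶜ, (-1 : K[X]) ^ (i : ℕ)
    set a := ∏ i ∈ (ico n 0 k)ᶜ, C (c i)
    set b := ∏ i ∈ (ico n 0 k)ᶜ, C (om V' i.rev i.rev)
    set d := ∏ i ∈ (ico n 0 k)ᶜ, C (om V i i)
    set e := ∏ i ∈ ico n 0 k, C (om V i i)
    linear_combination (p * d) * h1 + (-A.det * e * d + (1 - N) ^ k * (p * p + 1) * a * b * d) * h4 +
      (1 - N) ^ k * h2
  have hne : (1 - N) ^ k ≠ 0 := by
    refine pow_ne_zero _ fun h => ?_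
    have := congrArg (eval 0) h
    simp [hN] at this
  have h1 := minor_jacobi hAH (I := Jᶜ) (J := Iᶜ) (by
    rw [Finset.card_compl, Finset.card_compl, hI, hJ])
  rw [compl_compl, compl_compl, hJ, hmA] at h1
  refine mul_left_cancel₀ hne ?_
  rw [hN', ← mul_assoc, ← pow_add, show k + (r - k) = r by omega, ← hdet, C_mul, map_prod C _ Jᶜ]
  have h4 := hs Iᶜ
  have h5 := hs Jᶜ
  set p := ∏ i ∈ Iᶜ, (-1 : K[X]) ^ (i : ℕ)
  set q := ∏ i ∈ Jᶜ, (-1 : K[X]) ^ (i : ℕ)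
  set a := ∏ i ∈ Jᶜ, C (c i)
  set m := minor (dualMat V') (revSet Iᶜ) (revSet Jᶜ)
  set o := C (∏ i, om V i i)
  linear_combination (p * o) * h1 - (A.det * o * minor H I J) * h4 +
    ((1 - N) ^ r * o * a * m) * (q * q * h4 + h5)

end DualMinors

/-! ### Pairs of cyclic intervals under rotation, complement and reversal. -/

section TwoArc

variable {n : ℕ}

theorem finRotate_pow_val (q : ℕ) (i : Fin n) :
    (((finRotate n) ^ q : Equiv.Perm (Fin n)) i).val = (i.val + q) % n := by
  induction q with
  | zero => simp [Nat.mod_eq_of_lt i.2]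
  | succ q ih =>
    rw [pow_succ', Equiv.Perm.mul_apply, finRotate_val, ih]
    have h := Nat.mod_lt (i.val + q) i.pos
    have e : (i.val + (q + 1)) % n = ((i.val + q) % n + 1) % n := by
      rw [Nat.mod_add_mod, add_assoc]
    rw [e]
    split_ifs with h1
    · rw [h1, Nat.mod_self]
    · exact (Nat.mod_eq_of_lt (by omega)).symm

theorem finRotate_pow_self : ((finRotate n) ^ n : Equiv.Perm (Fin n)) = 1 := by
  ext i
  rw [finRotate_pow_val, Nat.add_mod_right, Nat.mod_eq_of_lt i.2]
  rfl

theorem TwoArc.rotate {J : Finset (Fin n)} (h : TwoArc J) (q : ℕ) :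
    TwoArc (J.map ((finRotate n) ^ q : Equiv.Perm (Fin n)).toEmbedding) := by
  obtain ⟨q', b, c, d, h1, h2, h3, rfl⟩ := h
  refine ⟨q + q', b, c, d, h1, h2, h3, ?_⟩
  rw [Finset.map_map, pow_add]
  rfl

theorem TwoArc.of_rotate {J : Finset (Fin n)}
    (h : TwoArc (J.map (finRotate n).toEmbedding)) : TwoArc J := by
  have h1 := h.rotate (n - 1)
  rw [Finset.map_map] at h1
  rcases Nat.eq_zero_or_pos n with hn | hn
  · subst hn
    exact ⟨0, 0, 0, 0, le_rfl, le_rfl, le_rfl, by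
      ext i
      exact i.elim0⟩
  · convert h1 using 1
    have hp : ((finRotate n) ^ n : Equiv.Perm (Fin n)) = (finRotate n) ^ (n - 1) * finRotate n := by
      rw [← pow_succ, Nat.sub_add_cancel hn]
    have : ((finRotate n).toEmbedding.trans
        ((finRotate n) ^ (n - 1) : Equiv.Perm (Fin n)).toEmbedding) =
        ((finRotate n) ^ n : Equiv.Perm (Fin n)).toEmbedding := by
      rw [hp]
      rfl
    rw [this, finRotate_pow_self]
    exact (Finset.map_refl).symm

theorem map_finRotate_twoIco {q b c d : ℕ} (hbc : b ≤ c) (hcd : c ≤ d) (hd : d + q ≤ n) (x : Fin n) :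
    x ∈ (twoIco n b c d).map ((finRotate n) ^ q : Equiv.Perm (Fin n)).toEmbedding ↔
      (q ≤ x.val ∧ x.val < b + q) ∨ (c + q ≤ x.val ∧ x.val < d + q) := by
  rw [Finset.mem_map]
  constructor
  · rintro ⟨y, hy, rfl⟩
    rw [mem_twoIco] at hy
    rw [Equiv.coe_toEmbedding, finRotate_pow_val, Nat.mod_eq_of_lt (by omega)]
    omega
  · intro h
    refine ⟨⟨x - q, by omega⟩, ?_, ?_⟩
    · rw [mem_twoIco]
      simp only
      omega
    · ext
      rw [Equiv.coe_toEmbedding, finRotate_pow_val]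
      simp only
      rw [Nat.sub_add_cancel (by omega), Nat.mod_eq_of_lt x.2]

theorem TwoArc.compl {J : Finset (Fin n)} (h : TwoArc J) : TwoArc Jᶜ := by
  obtain ⟨q, b, c, d, h1, h2, h3, rfl⟩ := h
  have : TwoArc (twoIco n b c d)ᶜ := by
    -- The complement is `[b, c) ∪ [d, n)`, shifted by `b` so as to start at zero.
    refine ⟨b, c - b, d - b, n - b, by omega, by omega, by omega, ?_⟩
    ext x
    rw [map_finRotate_twoIco (by omega) (by omega) (by omega), Finset.mem_compl, mem_twoIco]
    have := x.2
    omega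
  convert this.rotate q using 1
  ext x
  simp only [Finset.mem_compl, Finset.mem_map_equiv]

theorem TwoArc.rev {J : Finset (Fin n)} (h : TwoArc J) : TwoArc (revSet J) := by
  obtain ⟨q, b, c, d, h1, h2, h3, rfl⟩ := h
  induction q with
  | zero =>
    refine ⟨n - d, d - c, d - b, d, by omega, by omega, by omega, ?_⟩
    ext x
    rw [map_finRotate_twoIco (by omega) (by omega) (by omega), pow_zero, Equiv.Perm.one_def,
      Equiv.refl_toEmbedding, Finset.map_refl, mem_revSet, mem_twoIco, Fin.val_rev]
    have := x.2
    omega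
  | succ q ih =>
    refine TwoArc.of_rotate ?_
    convert ih using 1
    ext x
    obtain ⟨y, rfl⟩ : ∃ y, finRotate n y = x := ⟨_, Equiv.apply_symm_apply _ _⟩
    rw [Finset.mem_map_equiv, Equiv.symm_apply_apply, mem_revSet, mem_revSet, pow_succ']
    have : y.rev = finRotate n (finRotate n y).rev := by
      ext
      rw [finRotate_val, Fin.val_rev, Fin.val_rev, finRotate_val]
      have := y.2
      split_ifs <;> omega
    have h' : ∀ w, (finRotate n * (finRotate n) ^ q : Equiv.Perm (Fin n)).symm (finRotate n w) =
        ((finRotate n) ^ q : Equiv.Perm (Fin n)).symm w := fun w => by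
      rw [Equiv.symm_apply_eq, Equiv.Perm.mul_apply, Equiv.apply_symm_apply]
    rw [this, Finset.mem_map_equiv, Finset.mem_map_equiv, h']

end TwoArc

section Families

variable {σ : Type} {n k r : ℕ}

theorem revSet_compB_compl {d : ℕ} (hkn : k ≤ n) (hd : d ≤ n) :
    (revSet (compB n (n - k) d d))ᶜ = compB n k (n - d) (n - d) := by
  ext i
  rw [Finset.mem_compl, mem_revSet, mem_compB, mem_compB, Fin.val_rev]
  have := i.2
  omega

theorem PlFam.dual {P : (σ → ℂˣ) → Finset (Fin n) → ℂ} (h : PlFam k P) (hkn : k < n) :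
    PlFam (n - k) fun z S => P z (revSet S)ᶜ where
  tl := (h.tl.compl hkn.le).rev
  pos d hd := by
    simp only [revSet_compB_compl hkn.le hd]
    exact h.pos _ (by omega)
  eq_pl := by
    filter_upwards [h.eq_pl, (h.pos 0 (Nat.zero_le _)).ne_zero] with z ⟨V, hV⟩ h0
    rw [hV] at h0
    obtain ⟨V', hV'⟩ := exists_dual_pl hkn h0
    exact ⟨V', funext fun S => by rw [hV, hV']⟩

theorem PolyNonneg.congr {F G : (σ → ℂˣ) → ℂ[X]} (h : PolyNonneg r F)
    (hFG : ∀ᶠ z in generic σ, G z = F z) : PolyNonneg r G := fun m =>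
  (h m).congr (by
    filter_upwards [hFG] with z hz
    rw [hz])

theorem PolyNonneg.C_mul {F : (σ → ℂˣ) → ℂ[X]} (h : PolyNonneg r F) {c : (σ → ℂˣ) → ℂ}
    (hc : NonnegFam c) : PolyNonneg r fun z => C (c z) * F z := fun m =>
  (hc.mul (h m)).congr (.of_forall fun z => by
    rw [coeff_C_mul, Pi.mul_apply]
    ring)

/-- The complementary minor has size `n - r ≤ n - k` and belongs to the dual family, where the small
case applies. The substitution of `(-1)^n X` for the variable turns the sign pattern for `n - r`
into the one for `r`. -/
theorem polyNonneg_minor_of_ge {P : (σ → ℂˣ) → Finset (Fin n) → ℂ} (h : PlFam k P) (hk : 1 ≤ k)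
    (hkn : k < n) (hr : k ≤ r) {I J : Finset (Fin n)} (hI : I.card = r) (hJ : J.card = r)
    (hJ2 : TwoArc J) : ∃ F : (σ → ℂˣ) → ℂ[X], PolyNonneg r F ∧
      ∀ᶠ z in generic σ, minor (hMat k (P z)) I J = (1 + (-1) ^ k * X) ^ (r - k) * F z := by
  have hrn : r ≤ n := by
    rw [← hI]
    exact (Finset.card_le_univ I).trans_eq (Fintype.card_fin n)
  have hd := h.dual hkn
  have hpos : ∀ i : Fin n, PosFam fun z => P z (compB n k (i + 1) (i + 1)) := fun i =>
    h.pos _ (by omega)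
  have hpos' : ∀ i : Fin n, PosFam fun z => P z (revSet (compB n (n - k) (i + 1) (i + 1)))ᶜ :=
    fun i => hd.pos _ (by omega)
  have hdual := polyNonneg_minor_of_le (r := n - r) hd (by omega) (by omega) (by omega)
    (I := revSet Iᶜ) (J := revSet Jᶜ)
    (by rw [Finset.card_map, Finset.card_compl, hI, Fintype.card_fin])
    (by rw [Finset.card_map, Finset.card_compl, hJ, Fintype.card_fin]) hJ2.compl.rev
  refine ⟨fun z => C ((∏ i : Fin n, P z (compB n k (i + 1) (i + 1))) * ∏ i ∈ Jᶜ,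
    (P z (revSet (compB n (n - k) (i.rev + 1) (i.rev + 1)))ᶜ *
      P z (compB n k (i + 1) (i + 1)))⁻¹) *
    (minor (hMat (n - k) fun S => P z (revSet S)ᶜ) (revSet Iᶜ) (revSet Jᶜ)).comp ((-1) ^ n * X),
    PolyNonneg.C_mul (fun m => ?_) ?_, ?_⟩
  · refine (hdual m).congr (.of_forall fun z => ?_)
    have : ((-1) ^ n * X : ℂ[X]) = C ((-1) ^ n) * X := by simp
    rw [this, comp_C_mul_X_coeff, ← pow_mul, mul_comm (coeff _ _), ← mul_assoc, ← pow_add]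
    congr 1
    rw [← add_mul, show r + 1 + n = n - r + 1 + 2 * r by omega, add_mul, pow_add, mul_assoc,
      pow_mul _ 2]
    simp
  · exact ((PosFam.prod fun i _ => hpos i).mul
      (PosFam.prod fun i _ => ((hpos' _).mul (hpos i)).inv)).nonneg
  · have h1 : ∀ᶠ z in generic σ, ∀ i : Fin n, P z (compB n k (i + 1) (i + 1)) ≠ 0 :=
      Filter.eventually_all.2 fun i => (hpos i).ne_zero
    have h2 : ∀ᶠ z in generic σ, ∀ i : Fin n,
        P z (revSet (compB n (n - k) (i + 1) (i + 1)))ᶜ ≠ 0 :=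
      Filter.eventually_all.2 fun i => (hpos' i).ne_zero
    filter_upwards [h.eq_pl, h1, h2] with z ⟨V, hV⟩ h1 h2
    obtain ⟨V', hV'⟩ := exists_dual_pl hkn (V := V) (A₀ := compB n k ((⟨0, by omega⟩ : Fin n) + 1)
      ((⟨0, by omega⟩ : Fin n) + 1)) (by rw [← hV]; exact h1 ⟨0, by omega⟩)
    have e : (fun S => P z (revSet S)ᶜ) = pl V' := funext fun S => by rw [hV, hV']
    have e' : ∀ S, P z (revSet S)ᶜ = pl V' S := fun S => by rw [hV, hV']
    rw [e]
    simp only [e'] at h2 ⊢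
    rw [hV] at h1 ⊢
    rw [minor_hMat_dual hV' hk hkn (fun i => by rw [om_self V hk hkn.le]; exact h1 i)
      (fun i => by rw [om_self V' (by omega) (by omega)]; exact h2 i) hI hJ hr]
    simp only [om_self V hk hkn.le, om_self V' (show 1 ≤ n - k by omega) (Nat.sub_le n k)]
    rw [dualMat, minor_map]
    rfl

end Families

/-! ### The Gelfand–Tsetlin parametrization -/

section BasicMinors

variable {n k : ℕ} {K : Type*}

/-- The `n × k` matrices built by successive multiplication with bidiagonal matrices. -/
def gtMat [CommRing K] (k : ℕ) (x : ℕ → Fin n → K) : ℕ → Matrix (Fin n) (Fin k) K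
  | 0 => topIdentity n k K
  | a + 1 => bidiagMul (x a) (fun p => a < p ∧ p ≤ a + k) (gtMat k x a)

theorem gtMat_map [CommRing K] {L : Type*} [CommRing L] (φ : K →+* L) (x : ℕ → Fin n → K)
    (a : ℕ) : (gtMat k x a).map φ = gtMat k (fun a p => φ (x a p)) a := by
  induction a with
  | zero =>
    ext i j
    simp [gtMat, topIdentity, apply_ite φ]
  | succ a ih =>
    ext i j
    have h : ∀ i j, φ (gtMat k x a i j) = gtMat k (fun a p => φ (x a p)) a i j := fun i j => by
      rw [← ih]
      rfl
    simp only [gtMat, bidiagMul, Matrix.map_apply, Matrix.of_apply, map_add, map_mul, h,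
      apply_ite φ, map_zero]

theorem isTL_gtMat [CommRing K] {Q : Subsemiring K} (hk : k ≤ n) {x : ℕ → Fin n → K}
    (hx : ∀ a p, x a p ∈ Q) (a : ℕ) : IsTL k Q (pl (gtMat k x a)) := by
  induction a with
  | zero => exact isTL_topIdentity hk
  | succ a ih => exact ih.bidiagMul (hx a) _

theorem gtMat_apply_eq_zero [CommRing K] (x : ℕ → Fin n → K) (a : ℕ) (p : Fin n)
    (hp : a + k ≤ p.val) (s : Fin k) : gtMat k x a p s = 0 := by
  induction a generalizing p with
  | zero =>
    have := s.2
    rw [gtMat, topIdentity, Matrix.of_apply, if_neg (by omega)]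
  | succ a ih =>
    rw [gtMat, bidiagMul, Matrix.of_apply, ih p (by omega), mul_zero, zero_add]
    split_ifs with h
    · exact ih _ (by simp only; omega)
    · rfl

/-- The set `[i, i + m) ∪ [s + m, s + k)`. -/
def basicSet (n k s i m : ℕ) : Finset (Fin n) :=
  Finset.univ.filter fun p => (i ≤ p.val ∧ p.val < i + m) ∨ (s + m ≤ p.val ∧ p.val < s + k)

theorem mem_basicSet {s i m : ℕ} {p : Fin n} : p ∈ basicSet n k s i m ↔
    (i ≤ p.val ∧ p.val < i + m) ∨ (s + m ≤ p.val ∧ p.val < s + k) := by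
  simp [basicSet]

theorem exists_strictMono_basicSet {s i m : ℕ} (hs : s + k ≤ n) (hi : i ≤ s) (hm : m ≤ k) :
    ∃ f : Fin k → Fin n, StrictMono f ∧ basicSet n k s i m = Finset.univ.image f ∧
      ∀ u, (f u).val = if u.val < m then i + u else s + u := by
  have hlt : ∀ u : Fin k, (if u.val < m then i + u.val else s + u.val) < n := fun u => by
    have := u.2
    split_ifs <;> omega
  refine ⟨fun u => ⟨_, hlt u⟩, ?_, ?_, fun u => rfl⟩
  · intro u v huv
    rw [Fin.lt_def] at huv ⊢
    simp only
    split_ifs <;> omega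
  · ext p
    simp only [mem_basicSet, Finset.mem_image, Finset.mem_univ, true_and, Fin.ext_iff]
    constructor
    · rintro (h | h)
      · exact ⟨⟨p - i, by omega⟩, by simp only; rw [if_pos (by omega)]; omega⟩
      · exact ⟨⟨p - s, by omega⟩, by simp only; rw [if_neg (by omega)]; omega⟩
    · rintro ⟨u, hu⟩
      have := u.2
      rw [← hu]
      split_ifs <;> omega

theorem det_lowerBidiag [CommRing K] (R : Matrix (Fin k) (Fin k) K) (d e : Fin k → K) :
    (Matrix.of fun u v => d u * R u v +
      if h : 0 < u.val then e u * R ⟨u - 1, by omega⟩ v else 0).det = (∏ u, d u) * R.det := by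
  set L : Matrix (Fin k) (Fin k) K := Matrix.of fun u v =>
    (if u = v then d u else 0) + if v.val + 1 = u.val then e u else 0 with hL
  have h : (Matrix.of fun u v => d u * R u v +
      if h : 0 < u.val then e u * R ⟨u - 1, by omega⟩ v else 0) = L * R := by
    ext u v
    rw [Matrix.mul_apply]
    simp only [hL, Matrix.of_apply, add_mul, Finset.sum_add_distrib, ite_mul, zero_mul,
      Finset.sum_ite_eq, Finset.mem_univ, if_true]
    congr 1
    split_ifs with hu
    · rw [Finset.sum_eq_single ⟨u.val - 1, by omega⟩]
      · rw [if_pos (by simp only; omega)]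
      · intro w _ hw
        rw [if_neg]
        exact fun h => hw (Fin.ext (by simp only; omega))
      · simp
    · refine (Finset.sum_eq_zero fun w _ => ?_).symm
      rw [if_neg (by omega)]
  rw [h, Matrix.det_mul, Matrix.det_of_isLowerTriangular]
  · congr 1
    refine Finset.prod_congr rfl fun u _ => ?_
    simp [hL]
  · intro u v huv
    rw [OrderDual.toDual_lt_toDual, Fin.lt_def] at huv
    rw [hL, Matrix.of_apply, if_neg (fun h => by rw [h] at huv; omega), if_neg (by omega), add_zero]

theorem det_upperBidiag [CommRing K] (R : Matrix (Fin k) (Fin k) K) (e : Fin k → K) :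
    (Matrix.of fun u v => R u v +
      if h : u.val + 1 < k then e u * R ⟨u + 1, h⟩ v else 0).det = R.det := by
  have h1 := det_lowerBidiag (R.submatrix Fin.rev id) 1 fun u => e u.rev
  have h2 := congrArg (fun x => ((Equiv.Perm.sign (Fin.revPerm (n := k)) : ℤ) : K) * x) h1
  simp only [Pi.one_apply, Finset.prod_const_one, one_mul] at h2
  rw [← Matrix.det_permute Fin.revPerm, ← Matrix.det_permute Fin.revPerm] at h2
  convert h2 using 2
  · ext u v
    simp only [Matrix.of_apply, Matrix.submatrix_apply, Fin.revPerm_apply, Fin.rev_rev, id,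
      Fin.val_rev]
    congr 1
    by_cases h : u.val + 1 < k
    · rw [dif_pos h, dif_pos (by omega)]
      congr 2
      ext
      simp only [Fin.val_rev]
      omega
    · rw [dif_neg h, dif_neg (by omega)]
  · ext u v
    simp

/-- The rows of the upper block stay in place, are scaled by `x`, and beyond `s` receive their
predecessor, which is in the block. Each row of the lower block moves down by one, and the new row
is the old one plus a multiple of the next old one. Both changes are bidiagonal, and the determinant
gains only the factors `x p` of the upper block with `p ≥ s`. -/
theorem pl_bidiagMul_basicSet [CommRing K] {s i m : ℕ} (hs : s + k < n) (hi : i ≤ s) (hm : m ≤ k)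
    {V : Matrix (Fin n) (Fin k) K} (hV : ∀ p : Fin n, s + k ≤ p.val → ∀ u, V p u = 0)
    {x : Fin n → K} (hx : ∀ p : Fin n, p.val < s → x p = 1) :
    pl (bidiagMul x (fun p => s < p ∧ p ≤ s + k) V) (basicSet n k (s + 1) i m) =
      (∏ p ∈ ico n s (i + m), x p) * pl V (basicSet n k s i m) := by
  obtain ⟨f, hf, hfi, hfv⟩ := exists_strictMono_basicSet (n := n) (k := k) (s := s) (by omega) hi hm
  obtain ⟨f', hf', hfi', hfv'⟩ :=
    exists_strictMono_basicSet (n := n) (k := k) (s := s + 1) (by omega) (by omega : i ≤ s + 1) hm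
  rw [hfi, hfi', pl_image _ hf, pl_image _ hf']
  set R := V.submatrix f id with hR
  set R' : Matrix (Fin k) (Fin k) K := Matrix.of fun u v => R u v +
      if h : u.val + 1 < k then (if u.val < m then 0 else x (f' u)) * R ⟨u + 1, h⟩ v else 0 with hR'
  have h2 : R'.det = R.det := det_upperBidiag R _
  have h1 : (bidiagMul x (fun p => s < p ∧ p ≤ s + k) V).submatrix f' id =
      Matrix.of fun u v => (if u.val < m then x (f' u) else 1) * R' u v +
        if h : 0 < u.val then (if u.val < m ∧ s < i + u then 1 else 0) *
          R' ⟨u - 1, by omega⟩ v else 0 := by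
    ext u v
    have hu := hfv u
    have hu' := hfv' u
    have hk := u.2
    rw [Matrix.submatrix_apply, bidiagMul, Matrix.of_apply, Matrix.of_apply]
    by_cases hum : u.val < m
    · rw [if_pos hum] at hu hu' ⊢
      have hff : f' u = f u := Fin.ext (by omega)
      have e1 : R' u v = R u v := by
        rw [hR', Matrix.of_apply, if_pos hum]
        simp
      rw [e1, hff]
      congr 1
      by_cases hsu : s < i + u
      · have h0 : 0 < u.val := by omega
        have e2 : R' ⟨u - 1, by omega⟩ v = R ⟨u - 1, by omega⟩ v := by
          rw [hR', Matrix.of_apply, if_pos (by simp only; omega)]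
          simp
        rw [dif_pos h0, if_pos (by omega : (s < (f u).val ∧ (f u).val ≤ s + k) ∧ 0 < (f u).val),
          if_pos (⟨hum, hsu⟩ : u.val < m ∧ s < i + u.val), one_mul, e2, hR,
          Matrix.submatrix_apply]
        congr 1
        have e7 := hfv ⟨u.val - 1, by omega⟩
        rw [if_pos (by simp only; omega)] at e7
        refine Fin.ext ?_
        simp only at e7 ⊢
        omega
      · rw [if_neg (by omega)]
        split_ifs with h0 h3
        · exact absurd h3.2 hsu
        · rw [zero_mul]
        · rfl
    · rw [if_neg hum] at hu hu'
      have e1 : R' u v = V (f u) v + x (f' u) * V (f' u) v := by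
        rw [hR', Matrix.of_apply, if_neg hum]
        congr 1
        split_ifs with h
        · rw [hR, Matrix.submatrix_apply, id]
          congr 2
          refine Fin.ext ?_
          rw [hfv]
          simp only
          rw [if_neg (by omega)]
          omega
        · rw [hV _ (by omega), mul_zero]
      have e3 : (⟨(f' u).val - 1, by omega⟩ : Fin n) = f u := Fin.ext (by simp only; omega)
      rw [e1, if_neg hum, one_mul, if_pos (by omega), e3, id]
      have e4 : (if h : 0 < u.val then (if u.val < m ∧ s < i + u then 1 else 0) *
          R' ⟨u - 1, by omega⟩ v else 0) = 0 := by
        split_ifs with h0 h3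
        · exact absurd h3.1 hum
        · rw [zero_mul]
        · rfl
      rw [e4]
      ring
  rw [h1, det_lowerBidiag, h2]
  congr 1
  have e5 : (∏ u : Fin k, if u.val < m then x (f' u) else 1) =
      ∏ u ∈ Finset.univ.filter (fun u : Fin k => u.val < m ∧ s ≤ i + u), x (f' u) := by
    rw [Finset.prod_filter]
    refine Finset.prod_congr rfl fun u _ => ?_
    have hu' := hfv' u
    by_cases hum : u.val < m
    · rw [if_pos hum] at hu' ⊢
      split_ifs with h
      · rfl
      · exact hx _ (by omega)
    · rw [if_neg hum, if_neg (fun h => hum h.1)]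
  have e6 : ico n s (i + m) =
      (Finset.univ.filter (fun u : Fin k => u.val < m ∧ s ≤ i + u)).image f' := by
    ext p
    simp only [mem_ico, Finset.mem_image, Finset.mem_filter, Finset.mem_univ, true_and]
    constructor
    · intro h
      refine ⟨⟨p - i, by omega⟩, ⟨by simp only; omega, by simp only; omega⟩, Fin.ext ?_⟩
      rw [hfv']
      simp only
      rw [if_pos (by omega)]
      omega
    · rintro ⟨u, hu, rfl⟩
      rw [hfv', if_pos hu.1]
      omega
  rw [e5, e6, Finset.prod_image fun _ _ _ _ h => hf'.injective h]

end BasicMinors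

/-! ### Basic Plücker coordinates as monomials. -/

section TelescopedMinors

variable {n k : ℕ} {K : Type*} [Field K]

/-- The diagonal entries of the bidiagonal matrices attached to the numbers `X a b`. -/
def ratioDiag (k : ℕ) (X : ℕ → ℕ → K) (a : ℕ) (p : Fin n) : K :=
  if a ≤ p.val ∧ p.val ≤ a + k then X a (p - a + 1) / X a (p - a) else 1

theorem prod_ratioDiag {X : ℕ → ℕ → K} (h0 : ∀ a, X a 0 = 1) (hX : ∀ a b, X a b ≠ 0) {s e : ℕ}
    (he : e ≤ s + k) (hen : e ≤ n) :
    ∏ p ∈ ico n s e, ratioDiag k X s p = X s (e - s) := by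
  rcases Nat.lt_or_ge e s with h | h
  · rw [Nat.sub_eq_zero_of_le h.le, h0, Finset.prod_eq_one]
    intro p hp
    rw [mem_ico] at hp
    omega
  rw [ico_eq_image hen h, Finset.prod_image fun _ _ _ _ h' => (strictMono_ico hen h).injective h']
  have h1 : ∀ u : Fin (e - s), ratioDiag k X s (⟨s + u, by omega⟩ : Fin n) =
      (fun u : ℕ => X s (u + 1) / X s u) u := fun u => by
    have := u.2
    rw [ratioDiag, if_pos (by simp only; omega)]
    simp
  rw [Finset.prod_congr rfl fun u _ => h1 u,
    Fin.prod_univ_eq_prod_range (fun u => X s (u + 1) / X s u) (e - s)]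
  clear h1
  induction e - s with
  | zero => simp [h0]
  | succ m ih => rw [Finset.prod_range_succ, ih, mul_div_cancel₀ _ (hX s m)]

theorem basicSet_zero (s i : ℕ) : basicSet n k s i 0 = ico n s (s + k) := by
  ext p
  simp only [mem_basicSet, mem_ico]
  omega

theorem basicSet_self {s m : ℕ} (hm : m ≤ k) : basicSet n k s s m = ico n s (s + k) := by
  ext p
  simp only [mem_basicSet, mem_ico]
  omega

/-- Multiplication by the bidiagonal matrix of index `s` contributes a product of ratios `X s (b +
1) / X s b`, which telescopes to a single variable. -/
theorem pl_gtMat_basicSet {X : ℕ → ℕ → K} (h0 : ∀ a, X a 0 = 1) (hX : ∀ a b, X a b ≠ 0)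
    {s i m : ℕ} (hs : s + k ≤ n) (hi : i ≤ s) (hm : m ≤ k) :
    pl (gtMat k (ratioDiag k X) s) (basicSet n k s i m) =
      ∏ a ∈ Finset.Ico i (min (i + m) s), X a (i + m - a) := by
  induction s generalizing i m with
  | zero =>
    obtain rfl : i = 0 := by omega
    rw [Nat.min_zero, Finset.Ico_self, Finset.prod_empty, basicSet_self hm, gtMat,
      pl_topIdentity (by omega) _ (by rw [card_ico (by omega) (by omega)]; omega), if_pos]
    ext p
    simp [mem_ico]
  | succ s ih =>
    have key : ∀ i m, i ≤ s → m ≤ k →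
        pl (gtMat k (ratioDiag k X) (s + 1)) (basicSet n k (s + 1) i m) =
          ∏ a ∈ Finset.Ico i (min (i + m) (s + 1)), X a (i + m - a) := fun i m hi hm => by
      rw [gtMat, pl_bidiagMul_basicSet (by omega) hi hm
        (fun p hp u => gtMat_apply_eq_zero _ _ _ hp _)
        (fun p hp => by rw [ratioDiag, if_neg (by omega)]), ih (by omega) hi hm,
        prod_ratioDiag h0 hX (by omega) (by omega)]
      rcases Nat.lt_or_ge s (i + m) with h | h
      · rw [min_eq_right (by omega), min_eq_right h, Finset.prod_Ico_succ_top hi, mul_comm]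
      · rw [min_eq_left h, min_eq_left (by omega), Nat.sub_eq_zero_of_le h, h0, one_mul]
    -- For `i = s + 1` the basic set is the bottom interval whatever `m` is, and it also arises from
    -- `i = s` and `m = 0`.
    rcases Nat.lt_or_ge s i with h | h
    · obtain rfl : i = s + 1 := by omega
      rw [basicSet_self hm, ← basicSet_zero (s + 1) s, key s 0 le_rfl (by omega),
        min_eq_left (by omega : s + 0 ≤ s + 1), min_eq_right (by omega : s + 1 ≤ s + 1 + m),
        add_zero, Finset.Ico_self, Finset.Ico_self, Finset.prod_empty, Finset.prod_empty]
    · exact key i m h hm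

theorem pl_gtMat_bottom {X : ℕ → ℕ → K} (h0 : ∀ a, X a 0 = 1) (hX : ∀ a b, X a b ≠ 0)
    {s : ℕ} (hs : s + k ≤ n) : pl (gtMat k (ratioDiag k X) s) (ico n s (s + k)) = 1 := by
  rw [← basicSet_zero s s, pl_gtMat_basicSet h0 hX hs le_rfl (Nat.zero_le _)]
  simp

end TelescopedMinors

/-! ### Recovering a matrix from its basic minors. -/

section Determinacy

variable {n k : ℕ} {K : Type*} [Field K]

/-- A matrix whose bottom rows form the identity is determined by its basic minors, if these do not
vanish. -/
theorem eq_of_pl_basicSet (hk : k ≤ n) {V V' : Matrix (Fin n) (Fin k) K}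
    (hV : ∀ (p : Fin n) (u : Fin k), n - k + u.val = p.val → V p = Pi.single u 1)
    (hV' : ∀ (p : Fin n) (u : Fin k), n - k + u.val = p.val → V' p = Pi.single u 1)
    (h0 : ∀ i m, i ≤ n - k → m ≤ k → pl V (basicSet n k (n - k) i m) ≠ 0)
    (h : ∀ i m, i ≤ n - k → m ≤ k →
      pl V (basicSet n k (n - k) i m) = pl V' (basicSet n k (n - k) i m)) : V = V' := by
  suffices H : ∀ (d : ℕ) (p : Fin n), n - p.val ≤ d → V p = V' p from
    funext fun p => H _ p le_rfl
  intro d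
  induction d with
  | zero => intro p hp; omega
  | succ d ih =>
    intro p hp
    rcases Nat.lt_or_ge p.val (n - k) with hpk | hpk
    swap
    · have := hV p ⟨p - (n - k), by omega⟩ (by simp only; omega)
      rw [this, hV' p ⟨p - (n - k), by omega⟩ (by simp only; omega)]
    -- Take for `c` the cofactors of the first row in the basic minor for `(p, m + 1)`. They involve
    -- only lower rows, where `V` and `V'` agree. The unit rows at the bottom kill the coordinates
    -- beyond `m`, and the coordinate `m` is nonzero because the basic minor for `(p + 1, m)` is.
    -- The coordinates of the row `p` are then determined successively.
    have key : ∀ m (hm : m < k), ∃ c : Fin k → K, (∀ u : Fin k, m < u.val → c u = 0) ∧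
        c ⟨m, hm⟩ ≠ 0 ∧ V p ⬝ᵥ c = V' p ⬝ᵥ c := by
      intro m hm
      obtain ⟨f, hf, hfi, hfv⟩ := exists_strictMono_basicSet (n := n) (k := k) (s := n - k)
        (by omega) hpk.le (Nat.succ_le_of_lt hm)
      obtain ⟨f', hf', hfi', hfv'⟩ := exists_strictMono_basicSet (n := n) (k := k) (s := n - k)
        (i := p + 1) (by omega) hpk hm.le
      set A := V.submatrix f id with hA
      have hA0 : A.det ≠ 0 := by
        rw [hA, ← pl_image _ hf, ← hfi]
        exact h0 _ _ hpk.le hm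
      set o : Fin k := ⟨0, by omega⟩ with ho
      have hfo : f o = p := Fin.ext (by rw [hfv, if_pos (by simp [ho])]; simp [ho])
      have hA' : V'.submatrix f id = A.updateRow o (V' p) := by
        ext u v
        rw [Matrix.updateRow_apply]
        split_ifs with hu
        · rw [hu, Matrix.submatrix_apply, hfo, id]
        · have hu' : 0 < u.val := Nat.pos_of_ne_zero fun h => hu (Fin.ext h)
          rw [hA, Matrix.submatrix_apply, Matrix.submatrix_apply, ih (f u)]
          have := hfv u
          split_ifs at this <;> omega
      have hdet : (A.updateRow o (V' p)).det = A.det := by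
        rw [← hA', hA, ← pl_image _ hf, ← pl_image _ hf, ← hfi]
        exact (h _ _ hpk.le hm).symm
      set c : Fin k → K := fun v => A.adjugate v o with hc
      have hcd : ∀ b : Fin k → K, (A.updateRow o b).det = b ⬝ᵥ c := fun b => by
        rw [← Matrix.cramer_transpose_apply, Matrix.cramer_eq_adjugate_mulVec,
          ← Matrix.adjugate_transpose, Matrix.mulVec, dotProduct_comm]
        rfl
      have hcu : ∀ u, u ≠ o → V (f u) ⬝ᵥ c = 0 := fun u hu => by
        rw [← hcd]
        refine Matrix.det_zero_of_row_eq hu ?_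
        rw [Matrix.updateRow_ne hu, Matrix.updateRow_self]
        rfl
      have hcz : ∀ u : Fin k, m < u.val → c u = 0 := fun u hu => by
        have h1 := hcu u fun h => by rw [h, ho] at hu; simp at hu
        rw [hV (f u) u (by rw [hfv, if_neg (by omega)])] at h1
        simpa using h1
      refine ⟨c, hcz, fun hcm => ?_, ?_⟩
      · have hB : (V.submatrix f' id).det ≠ 0 := by
          rw [← pl_image _ hf', ← hfi']
          exact h0 _ _ hpk hm.le
        have hBc : (V.submatrix f' id).mulVec c = 0 := by
          ext u
          change V (f' u) ⬝ᵥ c = 0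
          by_cases hu : u.val < m
          · have e : f' u = f ⟨u + 1, by omega⟩ := by
              refine Fin.ext ?_
              rw [hfv', hfv, if_pos hu, if_pos (by simp only; omega)]
              simp only
              omega
            rw [e]
            exact hcu _ fun h => by simp [ho, Fin.ext_iff] at h
          · rw [hV (f' u) u (by rw [hfv', if_neg hu])]
            rcases Nat.lt_or_ge m u.val with h | h
            · simpa using hcz u h
            · obtain rfl : m = u.val := by omega
              simpa using hcm
        have hc0 := Matrix.eq_zero_of_mulVec_eq_zero hB hBc
        have h1 := hcd (A o)
        rw [Matrix.updateRow_eq_self, hc0, dotProduct_zero] at h1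
        exact hA0 h1
      · rw [← hcd, ← hcd, hdet]
        congr 1
        ext u v
        rw [Matrix.updateRow_apply]
        split_ifs with hu
        · rw [hu, hA, Matrix.submatrix_apply, hfo, id]
        · rfl
    ext u
    obtain ⟨u, hu⟩ := u
    induction u using Nat.strong_induction_on with
    | _ u ihu =>
      obtain ⟨c, hc, hcu, hd⟩ := key u hu
      have h1 : (V p - V' p) ⬝ᵥ c = 0 := by rw [sub_dotProduct, hd, sub_self]
      rw [dotProduct, Finset.sum_eq_single ⟨u, hu⟩] at h1
      · exact sub_eq_zero.1 ((mul_eq_zero.1 h1).resolve_right hcu)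
      · intro v _ hv
        rcases Nat.lt_or_ge u v.val with h | h
        · rw [hc v h, mul_zero]
        · have : v.val ≠ u := fun h => hv (Fin.ext h)
          rw [Pi.sub_apply, ihu v.val (by omega) v.2, sub_self, zero_mul]
      · simp

end Determinacy

/-! ### Plücker coordinates of points of the Grassmannian, normalised by the last one. -/

section Grassmannian

variable {n k : ℕ}

theorem Gr.plucker_eq_pl (N : Gr k n) (S : Finset (Fin n)) : N.plucker S = pl N.rep S := rfl

theorem Gr.span_rep (N : Gr k n) : Submodule.span ℂ (Set.range N.rep.col) = N.1 := by
  have h := (Module.finBasisOfFinrankEq ℂ N.1 N.2).span_eq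
  have h2 := congrArg (Submodule.map N.1.subtype) h
  rw [Submodule.map_span, Submodule.map_top, Submodule.range_subtype, ← Set.range_comp] at h2
  exact h2

theorem linearIndependent_col_of_pl {V : Matrix (Fin n) (Fin k) ℂ} {S : Finset (Fin n)}
    (h : pl V S ≠ 0) : LinearIndependent ℂ V.col := by
  have hS : S.card = k := by
    by_contra hS
    exact h (pl_of_card_ne hS)
  rw [pl_of_card hS] at h
  rw [← Matrix.mulVec_injective_iff]
  intro a b hab
  rw [← sub_eq_zero]
  refine Matrix.eq_zero_of_mulVec_eq_zero h ?_
  rw [Matrix.mulVec_sub, sub_eq_zero]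
  ext u
  exact congrFun hab (S.orderEmbOfFin hS u)

theorem finrank_span_col {V : Matrix (Fin n) (Fin k) ℂ} {S : Finset (Fin n)}
    (h : pl V S ≠ 0) : Module.finrank ℂ (Submodule.span ℂ (Set.range V.col)) = k := by
  rw [finrank_span_eq_card (linearIndependent_col_of_pl h), Fintype.card_fin]

theorem exists_eq_mul_of_col_mem {k' : ℕ} {V : Matrix (Fin n) (Fin k') ℂ}
    {W : Matrix (Fin n) (Fin k) ℂ}
    (h : ∀ u, V.col u ∈ Submodule.span ℂ (Set.range W.col)) :
    ∃ B : Matrix (Fin k) (Fin k') ℂ, V = W * B := by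
  simp only [← Matrix.range_mulVecLin, LinearMap.mem_range, Matrix.mulVecLin_apply] at h
  choose b hb using h
  refine ⟨Matrix.of fun s u => b u s, ?_⟩
  ext i u
  exact (congrFun (hb u) i).symm

theorem col_mul_mem {k' : ℕ} (W : Matrix (Fin n) (Fin k) ℂ) (B : Matrix (Fin k) (Fin k') ℂ)
    (u : Fin k') : (W * B).col u ∈ Submodule.span ℂ (Set.range W.col) := by
  rw [← Matrix.range_mulVecLin]
  exact ⟨B.col u, rfl⟩

theorem Gr.pl_eq_mul_plucker {N : Gr k n} {V : Matrix (Fin n) (Fin k) ℂ}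
    (hV : ∀ u, V.col u ∈ N.1) {S₀ : Finset (Fin n)}
    (h : pl V S₀ ≠ 0) : ∃ c : ℂ, c ≠ 0 ∧ ∀ S, pl V S = c * N.plucker S := by
  obtain ⟨B, hB⟩ := exists_eq_mul_of_col_mem (V := V) (W := N.rep) (by rwa [N.span_rep])
  refine ⟨B.det, fun h0 => h ?_, fun S => ?_⟩
  · rw [hB, pl_mul, h0, mul_zero]
  · rw [hB, pl_mul, mul_comm]
    rfl

/-- The Plücker coordinates, normalized by the last one. -/
noncomputable def Gr.normPl (N : Gr k n) (S : Finset (Fin n)) : ℂ :=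
  N.plucker S / N.plucker (ico n (n - k) n)

theorem Gr.normPl_eq {N : Gr k n} {V : Matrix (Fin n) (Fin k) ℂ}
    (hV : ∀ u, V.col u ∈ N.1) (h : pl V (ico n (n - k) n) ≠ 0) :
    N.plucker (ico n (n - k) n) ≠ 0 ∧
      ∀ S, N.normPl S = pl V S / pl V (ico n (n - k) n) := by
  obtain ⟨c, hc, hVN⟩ := N.pl_eq_mul_plucker hV h
  refine ⟨fun h0 => h (by rw [hVN, h0, mul_zero]), fun S => ?_⟩
  rw [hVN, hVN, mul_div_mul_left _ _ hc]
  rfl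

theorem Gr.exists_normalized (hk : k ≤ n) {N : Gr k n} (h : N.plucker (ico n (n - k) n) ≠ 0) :
    ∃ V : Matrix (Fin n) (Fin k) ℂ,
      (∀ (p : Fin n) (u : Fin k), n - k + u.val = p.val → V p = Pi.single u 1) ∧
      (∀ S, pl V S = N.normPl S) ∧ Submodule.span ℂ (Set.range V.col) = N.1 := by
  set f : Fin k → Fin n := fun u => ⟨n - k + u, by omega⟩ with hf
  have hfm : StrictMono f := fun u v huv => by
    rw [Fin.lt_def] at huv ⊢
    simp only [hf]
    omega
  have hfi : ico n (n - k) n = Finset.univ.image f := by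
    ext p
    simp only [mem_ico, Finset.mem_image, Finset.mem_univ, true_and]
    constructor
    · intro hp
      exact ⟨⟨p - (n - k), by omega⟩, Fin.ext (by simp only [hf]; omega)⟩
    · rintro ⟨u, rfl⟩
      simp only [hf]
      omega
  set B := N.rep.submatrix f id with hB
  have hBd : N.plucker (ico n (n - k) n) = B.det := by
    rw [N.plucker_eq_pl, hfi, pl_image _ hfm]
  have hu : IsUnit B.det := by
    rw [← hBd]
    exact isUnit_iff_ne_zero.2 h
  have hpl : ∀ S, pl (N.rep * B⁻¹) S = N.normPl S := fun S => by
    rw [pl_mul, Matrix.det_nonsing_inv, Ring.inverse_eq_inv', ← hBd, ← div_eq_mul_inv]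
    rfl
  refine ⟨N.rep * B⁻¹, fun p u hpu => ?_, hpl, ?_⟩
  · have hp : p = f u := Fin.ext hpu.symm
    have h1 : (N.rep * B⁻¹).submatrix f id = B * B⁻¹ := rfl
    rw [Matrix.mul_nonsing_inv _ hu] at h1
    ext v
    have h2 := congrFun (congrFun h1 u) v
    rw [hp]
    rw [Matrix.submatrix_apply, id] at h2
    rw [h2, Matrix.one_apply, Pi.single_apply]
    simp only [eq_comm]
  · have h1 : pl (N.rep * B⁻¹) (ico n (n - k) n) ≠ 0 := by
      rw [hpl, Gr.normPl, div_self h]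
      exact one_ne_zero
    refine Submodule.eq_of_le_of_finrank_eq ?_ ?_
    · rw [Submodule.span_le]
      rintro _ ⟨u, rfl⟩
      rw [← N.span_rep]
      exact col_mul_mem _ _ u
    · rw [finrank_span_col h1, N.2]

theorem basicSet_top (hk : k ≤ n) (i : ℕ) : basicSet n k (n - k) i 0 = ico n (n - k) n := by
  rw [basicSet_zero, Nat.sub_add_cancel hk]

theorem Gr.ext_of_normPl (hk : k ≤ n) {N N' : Gr k n}
    (h0 : ∀ i m, i ≤ n - k → m ≤ k → N.plucker (basicSet n k (n - k) i m) ≠ 0)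
    (h0' : N'.plucker (ico n (n - k) n) ≠ 0)
    (h : ∀ i m, i ≤ n - k → m ≤ k →
      N.normPl (basicSet n k (n - k) i m) = N'.normPl (basicSet n k (n - k) i m)) : N = N' := by
  have hN := h0 0 0 (Nat.zero_le _) (Nat.zero_le _)
  rw [basicSet_top hk] at hN
  obtain ⟨V, hV1, hV2, hV3⟩ := Gr.exists_normalized hk hN
  obtain ⟨V', hV1', hV2', hV3'⟩ := Gr.exists_normalized hk h0'
  have := eq_of_pl_basicSet hk hV1 hV1' (fun i m hi hm => by
    rw [hV2]
    exact div_ne_zero (h0 i m hi hm) hN) fun i m hi hm => by rw [hV2, hV2', h i m hi hm]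
  refine Subtype.ext ?_
  rw [← hV3, ← hV3', this]

theorem mem_piMap (hk : k ≤ n) {A : Matrix (Fin n) (Fin n) ℂ[X]} {z : ℂˣ}
    {V : Matrix (Fin n) (Fin k) ℂ}
    (hA : ∀ i (u : Fin k), (A i ⟨u, by omega⟩).eval ((-1) ^ (k + 1) * (z : ℂ)) = V i u)
    {S : Finset (Fin n)} (h : pl V S ≠ 0) :
    ∃ N : Gr k n, (N, z) ∈ piMap n k z A ∧ N.1 = Submodule.span ℂ (Set.range V.col) := by
  have e : {v : Fin n → ℂ | ∃ j : Fin n, j.val < k ∧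
      v = fun i => (A i j).eval ((-1) ^ (k + 1) * (z : ℂ))} = Set.range V.col := by
    ext v
    constructor
    · rintro ⟨j, hj, rfl⟩
      exact ⟨⟨j, hj⟩, funext fun i => (hA i ⟨j, hj⟩).symm⟩
    · rintro ⟨u, rfl⟩
      exact ⟨⟨u, by omega⟩, u.2, funext fun i => (hA i u).symm⟩
  have key : ∀ N₁ N₂ : Submodule ℂ (Fin n → ℂ), N₁ = N₂ → ∀ h₂ : Module.finrank ℂ N₂ = k,
      ((⟨N₂, h₂⟩, z) : XVar n k) ∈
        (⟨Module.finrank ℂ N₁ = k, fun h₁ => (⟨N₁, h₁⟩, z)⟩ : Part (XVar n k)) := by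
    rintro N₁ _ rfl h₂
    exact ⟨h₂, rfl⟩
  exact ⟨_, key _ _ (congrArg (Submodule.span ℂ) e) (finrank_span_col h), rfl⟩

end Grassmannian

/-! ### Inversion of the Gelfand–Tsetlin parametrization. -/

section GelfandTsetlin

variable {n k : ℕ}

/-- The coordinates `X_{i,i+b-1}`, extended by one to all `i`. -/
noncomputable def gtXval (w : GTIdx n k → ℂˣ) (a b : ℕ) : ℂ :=
  if h : a < n - k then (gtX w ⟨a, h⟩ b : ℂ) else 1

theorem gtXval_zero (w : GTIdx n k → ℂˣ) (a : ℕ) : gtXval w a 0 = 1 := by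
  rw [gtXval]
  split_ifs <;> simp [gtX]

theorem gtXval_ne_zero (w : GTIdx n k → ℂˣ) (a b : ℕ) : gtXval w a b ≠ 0 := by
  rw [gtXval]
  split_ifs
  · exact Units.ne_zero _
  · exact one_ne_zero

theorem gtXval_succ (w : GTIdx n k → ℂˣ) (a : Fin (n - k)) (b : Fin k) :
    gtXval w a (b + 1) = w (Sum.inl (a, b)) := by
  rw [gtXval, dif_pos a.2, gtX, dif_pos b.2]

theorem chevM_mul_apply (hk : k ≤ n) (w : GTIdx n k → ℂˣ) (a : Fin (n - k))
    (A : Matrix (Fin n) (Fin n) ℂ) (p : Fin n) (u : Fin k) :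
    (chevM w a * A) p ⟨u, by omega⟩ =
      bidiagMul (ratioDiag k (gtXval w) a) (fun p => a.val < p ∧ p ≤ a.val + k)
        (Matrix.of fun p (u : Fin k) => A p ⟨u, by omega⟩) p u := by
  have ha := a.2
  rw [Matrix.mul_apply]
  have h : ∀ q, chevM w a p q = (if p = q then ratioDiag k (gtXval w) a p else 0) +
      if p.val = q.val + 1 ∧ a.val < p.val ∧ p.val ≤ a.val + k then 1 else 0 := fun q => by
    rw [chevM, Matrix.of_apply]
    by_cases hpq : p = q
    · rw [if_pos hpq, if_pos hpq, if_neg (by rw [hpq]; omega : ¬(p.val = q.val + 1 ∧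
        a.val < p.val ∧ p.val ≤ a.val + k)), add_zero, ratioDiag]
      split_ifs
      · rw [gtx, gtXval, gtXval, dif_pos ha, dif_pos ha]
        simp
      · rfl
    · rw [if_neg hpq, if_neg hpq, zero_add]
  simp only [h, add_mul, Finset.sum_add_distrib, ite_mul, zero_mul, one_mul, Finset.sum_ite_eq,
    Finset.mem_univ, if_true, bidiagMul, Matrix.of_apply]
  congr 1
  by_cases hp : a.val < p.val ∧ p.val ≤ a.val + k
  · rw [if_pos ⟨hp, by omega⟩, Finset.sum_eq_single ⟨p - 1, by omega⟩]
    · rw [if_pos ⟨by simp only; omega, hp⟩]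
    · intro q _ hq
      rw [if_neg fun h => hq (Fin.ext (by simp only; omega))]
    · simp
  · rw [if_neg fun h => hp h.1]
    exact Finset.sum_eq_zero fun q _ => by rw [if_neg fun h => hp h.2]

theorem tableauMatrix_apply (hk : k ≤ n) (w : GTIdx n k → ℂˣ) (p : Fin n) (u : Fin k) :
    tableauMatrix w p ⟨u, by omega⟩ = gtMat k (ratioDiag k (gtXval w)) (n - k) p u := by
  have key : ∀ m (hm : m ≤ n - k) (p : Fin n) (u : Fin k),
      ((List.finRange m).reverse.map fun a => chevM w (Fin.castLE hm a)).prod p ⟨u, by omega⟩ =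
        gtMat k (ratioDiag k (gtXval w)) m p u := by
    intro m
    induction m with
    | zero =>
      intro hm p u
      simp [gtMat, topIdentity, Matrix.one_apply, Fin.ext_iff]
    | succ m ih =>
      intro hm p u
      rw [List.finRange_succ_last, List.reverse_append, List.reverse_singleton,
        List.singleton_append, List.map_cons, List.prod_cons, chevM_mul_apply hk, gtMat]
      congr 1
      ext p u
      rw [Matrix.of_apply, ← ih (by omega), ← List.map_reverse, List.map_map]
      rfl
  exact key (n - k) le_rfl p u

theorem ico_last (hk : k ≤ n) : ico n (n - k) n = ico n (n - k) (n - k + k) := by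
  rw [Nat.sub_add_cancel hk]

theorem pl_gtMat_last (hk : k ≤ n) (w : GTIdx n k → ℂˣ) :
    pl (gtMat k (ratioDiag k (gtXval w)) (n - k)) (ico n (n - k) n) = 1 := by
  rw [ico_last hk]
  exact pl_gtMat_bottom (gtXval_zero w) (gtXval_ne_zero w) (by omega)

theorem exists_mem_Theta (hk : k ≤ n) (w : GTIdx n k → ℂˣ) :
    ∃ N : Gr k n, (N, w (Sum.inr ())) ∈ Theta n k w ∧ N.plucker (ico n (n - k) n) ≠ 0 ∧
      ∀ S, N.normPl S = pl (gtMat k (ratioDiag k (gtXval w)) (n - k)) S := by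
  have h1 : pl (gtMat k (ratioDiag k (gtXval w)) (n - k)) (ico n (n - k) n) ≠ 0 := by
    rw [pl_gtMat_last hk]
    exact one_ne_zero
  obtain ⟨N, hN, hNV⟩ := mem_piMap hk (A := (tableauMatrix w).map C) (z := w (Sum.inr ()))
    (V := gtMat k (ratioDiag k (gtXval w)) (n - k)) (fun i u => by
      rw [Matrix.map_apply, eval_C, tableauMatrix_apply hk]) h1
  obtain ⟨h2, h3⟩ := N.normPl_eq (fun u => by rw [hNV]; exact Submodule.subset_span ⟨u, rfl⟩) h1
  refine ⟨N, hN, h2, fun S => ?_⟩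
  rw [h3, pl_gtMat_last hk, div_one]

/-- The Gelfand–Tsetlin coordinates, expressed by the Plücker coordinates; with the value one where
these expressions are not defined. -/
noncomputable def gtInv (p : XVar n k) : GTIdx n k → ℂˣ
  | Sum.inl (a, b) =>
    if h : p.1.normPl (basicSet n k (n - k) a (b + 1)) /
        p.1.normPl (basicSet n k (n - k) (a + 1) b) = 0 then 1 else Units.mk0 _ h
  | Sum.inr _ => p.2

theorem gtInv_inl {p : XVar n k} (hk : k ≤ n)
    (h0 : ∀ i m, i ≤ n - k → m ≤ k → p.1.plucker (basicSet n k (n - k) i m) ≠ 0)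
    (a : Fin (n - k)) (b : Fin k) : (gtInv p (Sum.inl (a, b)) : ℂ) =
      p.1.normPl (basicSet n k (n - k) a (b + 1)) /
        p.1.normPl (basicSet n k (n - k) (a + 1) b) := by
  have hN := h0 0 0 (Nat.zero_le _) (Nat.zero_le _)
  rw [basicSet_top hk] at hN
  rw [gtInv, dif_neg, Units.val_mk0]
  exact div_ne_zero (div_ne_zero (h0 _ _ a.2.le b.2) hN) (div_ne_zero (h0 _ _ a.2 b.2.le) hN)

/-- The product of the ratios defining `gtInv` telescopes back to the basic coordinates. Hence `p`
and the point parametrized by `gtInv p` have the same basic coordinates, and these determine the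
subspace. -/
theorem mem_Theta_gtInv (hk : k ≤ n) {p : XVar n k}
    (h0 : ∀ i m, i ≤ n - k → m ≤ k → p.1.plucker (basicSet n k (n - k) i m) ≠ 0) :
    p ∈ Theta n k (gtInv p) ∧
      ∀ S, p.1.normPl S = pl (gtMat k (ratioDiag k (gtXval (gtInv p))) (n - k)) S := by
  have hN := h0 0 0 (Nat.zero_le _) (Nat.zero_le _)
  rw [basicSet_top hk] at hN
  obtain ⟨N, hN1, hN2, hN3⟩ := exists_mem_Theta hk (gtInv p)
  have h1 : ∀ i m, i ≤ n - k → m ≤ k → p.1.normPl (basicSet n k (n - k) i m) ≠ 0 :=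
    fun i m hi hm => div_ne_zero (h0 i m hi hm) hN
  have hb : p.1.normPl (ico n (n - k) n) = 1 := div_self hN
  have key : ∀ e i m, i + e = min (i + m) (n - k) → i ≤ n - k → m ≤ k →
      ∏ a ∈ Finset.Ico i (i + e), gtXval (gtInv p) a (i + m - a) =
        p.1.normPl (basicSet n k (n - k) i m) := by
    intro e
    induction e with
    | zero =>
      intro i m he hi hm
      rw [add_zero, Finset.Ico_self, Finset.prod_empty, ← hb]
      congr 1
      rcases Nat.eq_zero_or_pos m with rfl | hm0
      · rw [basicSet_top hk]
      · obtain rfl : i = n - k := by omega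
        rw [basicSet_self hm, ico_last hk]
    | succ e ih =>
      intro i m he hi hm
      have h2 := ih (i + 1) (m - 1) (by omega) (by omega) (by omega)
      have e1 : i + 1 + (m - 1) = i + m := by omega
      rw [e1] at h2
      rw [Finset.prod_eq_prod_Ico_succ_bot (by omega), ← add_assoc, add_right_comm, h2]
      have h3 := gtXval_succ (gtInv p) ⟨i, by omega⟩ ⟨m - 1, by omega⟩
      rw [gtInv_inl hk h0] at h3
      simp only at h3
      rw [Nat.sub_add_cancel (by omega)] at h3
      rw [Nat.add_sub_cancel_left, h3, div_mul_cancel₀ _ (h1 _ _ (by omega) (by omega))]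
  have h4 : ∀ i m, i ≤ n - k → m ≤ k → p.1.normPl (basicSet n k (n - k) i m) =
      N.normPl (basicSet n k (n - k) i m) := fun i m hi hm => by
    rw [hN3, pl_gtMat_basicSet (gtXval_zero _) (gtXval_ne_zero _) (by omega) hi hm]
    obtain ⟨e, he⟩ : ∃ e, i + e = min (i + m) (n - k) := ⟨min (i + m) (n - k) - i, by omega⟩
    rw [← he]
    exact (key e i m he hi hm).symm
  have h5 := Gr.ext_of_normPl hk h0 hN2 h4
  refine ⟨?_, fun S => ?_⟩
  · have : p = (N, gtInv p (Sum.inr ())) := Prod.ext h5 rfl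
    rw [← this] at hN1
    exact hN1
  · rw [h5, hN3]

/-- The monomials of the basic coordinates for `(a, b + 1)` and `(a + 1, b)` differ by a single
variable, so their ratio recovers it. -/
theorem eq_gtInv_of_mem_Theta (hk : k ≤ n) {p : XVar n k} {w : GTIdx n k → ℂˣ}
    (h : p ∈ Theta n k w) : w = gtInv p := by
  obtain ⟨N, hN1, hN2, hN3⟩ := exists_mem_Theta hk w
  have hp := Part.mem_unique hN1 h
  obtain rfl : p.1 = N := by rw [← hp]
  have hp2 : w (Sum.inr ()) = p.2 := by rw [← hp]
  have h6 : ∀ i m, i ≤ n - k → m ≤ k → p.1.normPl (basicSet n k (n - k) i m) =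
      ∏ a ∈ Finset.Ico i (min (i + m) (n - k)), gtXval w a (i + m - a) := fun i m hi hm => by
    rw [hN3, pl_gtMat_basicSet (gtXval_zero _) (gtXval_ne_zero _) (by omega) hi hm]
  have h0 : ∀ i m, i ≤ n - k → m ≤ k → p.1.plucker (basicSet n k (n - k) i m) ≠ 0 :=
    fun i m hi hm => (div_ne_zero_iff.1 ((h6 i m hi hm).trans_ne
      (Finset.prod_ne_zero_iff.2 fun _ _ => gtXval_ne_zero _ _ _))).1
  ext i
  rcases i with ⟨a, b⟩ | u
  · have ha := a.2
    have hb := b.2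
    rw [gtInv_inl hk h0, h6 _ _ ha.le hb, h6 _ _ ha hb.le, ← gtXval_succ,
      Finset.prod_eq_prod_Ico_succ_bot (by omega)]
    have e : a.val + 1 + b.val = a.val + (b.val + 1) := by omega
    rw [e, Nat.add_sub_cancel_left]
    refine (mul_div_cancel_right₀ _ ?_).symm
    exact Finset.prod_ne_zero_iff.2 fun _ _ => gtXval_ne_zero _ _ _
  · exact congrArg Units.val hp2

end GelfandTsetlin

/-! ### Positive families of points -/

section PositivePoints

variable {σ : Type} {n k : ℕ}

/-- A family of points of `𝕏_k` whose Gelfand–Tsetlin coordinates are positive. -/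
structure PosPoint (p : (σ → ℂˣ) → XVar n k) : Prop where
  param : PosFam fun z => ((p z).2 : ℂ)
  basic : ∀ i m, i ≤ n - k → m ≤ k →
    PosFam fun z => (p z).1.normPl (basicSet n k (n - k) i m)

variable {p : (σ → ℂˣ) → XVar n k}

theorem PosPoint.plucker_ne_zero (hp : PosPoint p) : ∀ᶠ z in generic σ,
    ∀ i m, i ≤ n - k → m ≤ k → (p z).1.plucker (basicSet n k (n - k) i m) ≠ 0 := by
  have h : ∀ᶠ z in generic σ, ∀ i ∈ Finset.range (n - k + 1), ∀ m ∈ Finset.range (k + 1),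
      (p z).1.normPl (basicSet n k (n - k) i m) ≠ 0 := by
    refine (Filter.eventually_all_finset _).2 fun i hi =>
      (Filter.eventually_all_finset _).2 fun m hm => ?_
    rw [Finset.mem_range] at hi hm
    exact (hp.basic i m (by omega) (by omega)).ne_zero
  filter_upwards [h] with z hz i m hi hm
  exact (div_ne_zero_iff.1 (hz i (by rw [Finset.mem_range]; omega) m
    (by rw [Finset.mem_range]; omega))).1

theorem PosPoint.last_ne_zero (hp : PosPoint p) (hk : k ≤ n) : ∀ᶠ z in generic σ,
    (p z).1.plucker (ico n (n - k) n) ≠ 0 := by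
  filter_upwards [hp.plucker_ne_zero] with z hz
  have h := hz 0 0 (Nat.zero_le _) (Nat.zero_le _)
  rwa [basicSet_top hk] at h

theorem PosPoint.gtInv (hp : PosPoint p) (hk : k ≤ n) (i : GTIdx n k) :
    PosFam fun z => (gtInv (p z) i : ℂ) := by
  rcases i with ⟨a, b⟩ | u
  · refine ((hp.basic a (b + 1) a.2.le b.2).div (hp.basic (a + 1) b a.2 b.2.le)).congr ?_
    filter_upwards [hp.plucker_ne_zero] with z hz
    exact gtInv_inl hk hz a b
  · exact hp.param

theorem posFam_gtXval {w : (σ → ℂˣ) → GTIdx n k → ℂˣ} (hw : ∀ i, PosFam fun z => (w z i : ℂ))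
    (a b : ℕ) : PosFam fun z => gtXval (w z) a b := by
  unfold gtXval
  split_ifs with h
  · cases b with
    | zero => exact posFam_one.congr (.of_forall fun z => by simp [gtX])
    | succ b =>
      simp only [gtX]
      split_ifs
      · exact hw _
      · exact hw _
  · exact posFam_one

theorem posFam_ratioDiag {w : (σ → ℂˣ) → GTIdx n k → ℂˣ} (hw : ∀ i, PosFam fun z => (w z i : ℂ))
    (a : ℕ) (q : Fin n) : PosFam fun z => ratioDiag k (gtXval (w z)) a q := by
  unfold ratioDiag
  split_ifs
  · exact (posFam_gtXval hw _ _).div (posFam_gtXval hw _ _)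
  · exact posFam_one

theorem posFam_pl_gtMat (hk : k ≤ n) {w : (σ → ℂˣ) → GTIdx n k → ℂˣ}
    (hw : ∀ i, PosFam fun z => (w z i : ℂ)) {i m : ℕ} (hi : i ≤ n - k) (hm : m ≤ k) :
    PosFam fun z => pl (gtMat k (ratioDiag k (gtXval (w z))) (n - k))
      (basicSet n k (n - k) i m) :=
  (PosFam.prod (s := Finset.Ico i (min (i + m) (n - k)))
    fun a _ => posFam_gtXval hw a (i + m - a)).congr (.of_forall fun z => by
      rw [pl_gtMat_basicSet (gtXval_zero _) (gtXval_ne_zero _) (by omega) hi hm])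

/-- The cone statement is applied once over the ring of functions on the torus, with the semiring of
non-negative families as coefficients, and then evaluated at each point. -/
theorem plFam_gtMat (hk : k ≤ n) {w : (σ → ℂˣ) → GTIdx n k → ℂˣ}
    (hw : ∀ i, PosFam fun z => (w z i : ℂ)) :
    PlFam (n := n) k fun z => pl (gtMat k (ratioDiag k (gtXval (w z))) (n - k)) where
  tl := by
    have h := isTL_gtMat (n := n) (Q := nonnegFamilies σ) hk
      (x := fun a q z => ratioDiag k (gtXval (w z)) a q)
      (fun a q => (posFam_ratioDiag hw a q).nonneg) (n - k)
    convert h using 1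
    ext S z
    exact (congrArg (pl · S) (gtMat_map (Pi.evalRingHom (fun _ => ℂ) z)
      (fun a q z => ratioDiag k (gtXval (w z)) a q) (n - k))).symm.trans
        (pl_map (Pi.evalRingHom (fun _ => ℂ) z) _ S)
  pos d hd := by
    rcases Nat.le_total d k with h | h
    -- Cyclic intervals are basic sets: those that wrap have `i = 0` and `m = d`, the others `i = d
    -- - k` and `m = k`.
    · convert posFam_pl_gtMat hk hw (Nat.zero_le _) h using 3
      ext q
      have := q.2
      rw [mem_compB, mem_basicSet]
      omega
    · convert posFam_pl_gtMat hk hw (by omega : d - k ≤ n - k) le_rfl using 3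
      ext q
      have := q.2
      rw [mem_compB, mem_basicSet]
      omega
  eq_pl := .of_forall fun _ => ⟨_, rfl⟩

theorem PosPoint.exists_plFam (hp : PosPoint p) (hk : k ≤ n) :
    ∃ P : (σ → ℂˣ) → Finset (Fin n) → ℂ, PlFam k P ∧
      ∀ᶠ z in generic σ, (p z).1.normPl = P z := by
  refine ⟨_, plFam_gtMat hk (hp.gtInv hk), ?_⟩
  filter_upwards [hp.plucker_ne_zero] with z hz
  exact funext (mem_Theta_gtInv hk hz).2

theorem exists_posPoint (hk : k ≤ n) {w : (σ → ℂˣ) → GTIdx n k → ℂˣ}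
    (hw : ∀ i, PosFam fun z => (w z i : ℂ)) :
    ∃ p : (σ → ℂˣ) → XVar n k, PosPoint p ∧ ∀ z, p z ∈ Theta n k (w z) ∧
      (p z).2 = w z (Sum.inr ()) := by
  choose N hN1 hN2 hN3 using fun z => exists_mem_Theta hk (w z)
  refine ⟨fun z => (N z, w z (Sum.inr ())), ⟨hw _, fun i m hi hm => ?_⟩, fun z => ⟨hN1 z, rfl⟩⟩
  exact (posFam_pl_gtMat hk hw hi hm).congr (.of_forall fun z => hN3 z _)

end PositivePoints

/-! ### The matrix `g` as a rescaling of `hMat`. -/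

section RationalMatrix

variable {n k : ℕ}

/-- The matrix `g` attached to a parameter and a list of Plücker coordinates. -/
noncomputable def gMat (k : ℕ) (t : ℂ) (P : Finset (Fin n) → ℂ) : Matrix (Fin n) (Fin n) ℂ[X] :=
  Matrix.of fun i j => (if j.val < k then 1 else if j ≤ i then C t else X) *
    C (P (insert i (arc j (k - 1))) / P (arc j k))

/-- The matrix `g(p)`, regardless of whether it is defined. -/
noncomputable def gVal (p : XVar n k) : Matrix (Fin n) (Fin n) ℂ[X] := gMat k p.2 p.1.normPl

theorem gVal_mem (p : XVar n k) (h : p.1.plucker (ico n (n - k) n) ≠ 0)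
    (h0 : ∀ j, p.1.plucker (arc j k) ≠ 0) : gVal p ∈ g n k p := by
  refine ⟨h0, ?_⟩
  ext1 i j
  simp only [g, gVal, gMat, Matrix.of_apply, Gr.normPl, div_div_div_cancel_right₀ h]

/-- The factors relating the columns of `g` and `hMat`. -/
noncomputable def gScale (k : ℕ) (t : ℂ) (P : Finset (Fin n) → ℂ) (j : Fin n) : ℂ :=
  (if j.val < k then 1 else t) / P (compB n k j j)

/-- Factoring `t` out of a late column replaces `λ` by `λ / t` above the diagonal. In the first `k`
columns the entries above the diagonal are zero, by a repeated index, so the same substitution has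
no effect there. -/
theorem gMat_apply (hk : 1 ≤ k) (hkn : k ≤ n) {t : ℂ} (ht : t ≠ 0) (V : Matrix (Fin n) (Fin k) ℂ)
    (i j : Fin n) : gMat k t (pl V) i j =
      C (gScale k t (pl V) j) * (hMat k (pl V) i j).comp (C t⁻¹ * X) := by
  have h1 : C t * C t⁻¹ = (1 : ℂ[X]) := by rw [← C_mul, mul_inv_cancel₀ ht, C_1]
  rw [gMat, Matrix.of_apply, hMat, Matrix.of_apply, arc_eq_compB hkn,
    arc_eq_compB (by omega : k - 1 ≤ n), gScale]
  have hi := i.2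
  have hj := j.2
  by_cases hjk : j.val < k
  · by_cases hij : i < j
    · have hz : pl V (insert i (compB n (k - 1) j j)) = 0 := by
        refine pl_of_card_ne ?_
        rw [Finset.insert_eq_of_mem, card_compB_self (by omega) j.2.le]
        · omega
        · rw [mem_compB]
          rw [Fin.lt_def] at hij
          omega
      rw [hz]
      simp
    · rw [if_pos hjk, if_neg hij, if_pos hjk, one_mul, one_mul, C_comp, ← C_mul]
      congr 1
      ring
  · by_cases hij : i < j
    · rw [if_neg hjk, if_neg hjk, if_pos hij, if_neg (not_le.2 hij), mul_comp, X_comp, C_comp,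
        div_eq_mul_inv, div_eq_mul_inv, C_mul, C_mul]
      linear_combination (-(X * C (pl V (insert i (compB n (k - 1) j j))) *
        C (pl V (compB n k j j))⁻¹)) * h1
    · rw [if_neg hjk, if_neg hjk, if_neg hij, if_pos (not_lt.1 hij), one_mul, C_comp, ← C_mul,
        ← C_mul]
      congr 1
      ring

theorem minor_gMat (hk : 1 ≤ k) (hkn : k ≤ n) {t : ℂ} (ht : t ≠ 0) (V : Matrix (Fin n) (Fin k) ℂ)
    (I J : Finset (Fin n)) : minor (gMat k t (pl V)) I J =
      C (∏ j ∈ J, gScale k t (pl V) j) * (minor (hMat k (pl V)) I J).comp (C t⁻¹ * X) := by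
  have h : gMat k t (pl V) = Matrix.of fun i j => (1 : Fin n → ℂ[X]) i *
      C (gScale k t (pl V) j) * ((hMat k (pl V)).map (compRingHom (C t⁻¹ * X))) i j := by
    ext1 i j
    rw [gMat_apply hk hkn ht, Matrix.of_apply, Pi.one_apply, one_mul]
    rfl
  rw [h, minor_scale, minor_map, map_prod]
  simp

theorem natDegree_minor_le {A : Matrix (Fin n) (Fin n) ℂ[X]} (hA : ∀ i j, (A i j).natDegree ≤ 1)
    (I J : Finset (Fin n)) : (minor A I J).natDegree ≤ n := by
  by_cases h : J.card = I.card
  · rw [minor_of_card A rfl h, Matrix.det_apply]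
    refine natDegree_sum_le_of_forall_le _ _ fun π _ => ?_
    rw [Units.smul_def]
    refine (natDegree_smul_le _ _).trans ((natDegree_prod_le _ _).trans ?_)
    refine (Finset.sum_le_sum fun i _ => hA _ _).trans ?_
    have := I.card_le_univ
    simpa using this
  · have : minor A I J = 0 := by
      rw [minor, dif_neg]
      exact h
    rw [this, natDegree_zero]
    exact Nat.zero_le _

theorem natDegree_gMat_le (t : ℂ) (P : Finset (Fin n) → ℂ) (i j : Fin n) :
    (gMat k t P i j).natDegree ≤ 1 := by
  rw [gMat, Matrix.of_apply]
  refine (natDegree_mul_C_le _ _).trans ?_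
  split_ifs <;> simp

/-- At `λ = 0` the matrix is lower triangular, so principal minors have constant terms that are
products of diagonal entries. This supplies the nonvanishing that upgrades non-negative to positive.
-/
theorem coeff_zero_minor_gMat_self (hk : 1 ≤ k) (hkn : k ≤ n) (t : ℂ)
    (V : Matrix (Fin n) (Fin k) ℂ) (I : Finset (Fin n)) :
    (minor (gMat k t (pl V)) I I).coeff 0 =
      ∏ i ∈ I, (if i.val < k then 1 else t) *
        (pl V (compB n k (i + 1) (i + 1)) / pl V (compB n k i i)) := by
  rw [coeff_zero_eq_eval_zero, ← coe_evalRingHom, ← minor_map, minor_of_card _ rfl rfl,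
    Matrix.det_of_isLowerTriangular]
  · rw [← prod_orderEmbOfFin (I := I) rfl]
    refine Finset.prod_congr rfl fun s _ => ?_
    rw [Matrix.submatrix_apply, Matrix.map_apply, gMat, Matrix.of_apply, arc_eq_compB hkn,
      arc_eq_compB (by omega : k - 1 ≤ n), insert_compB hk hkn, if_pos le_rfl, coe_evalRingHom,
      eval_mul, eval_C]
    congr 1
    split_ifs <;> simp
  · intro s u hsu
    rw [OrderDual.toDual_lt_toDual] at hsu
    have hlt := (I.orderEmbOfFin rfl).strictMono hsu
    rw [Matrix.submatrix_apply, Matrix.map_apply, gMat, Matrix.of_apply,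
      arc_eq_compB (by omega : k - 1 ≤ n), if_neg (not_le.2 hlt), coe_evalRingHom, eval_mul, eval_C]
    generalize I.orderEmbOfFin rfl s = i at *
    generalize I.orderEmbOfFin rfl u = j at *
    split_ifs with hj
    · have hz : pl V (insert i (compB n (k - 1) j j)) = 0 := by
        refine pl_of_card_ne ?_
        have hi := i.2
        rw [Finset.insert_eq_of_mem, card_compB_self (by omega) j.2.le]
        · omega
        · rw [mem_compB]
          rw [Fin.lt_def] at hlt
          omega
      rw [hz, zero_div, mul_zero]
    · simp

end RationalMatrix

/-! ### Evaluating signed families at `(-1)^(r-1) t` with `t` positive. -/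

section PolynomialFamilies

variable {σ : Type} {r : ℕ}

theorem PolyNonneg.comp_inv_mul_X {F : (σ → ℂˣ) → ℂ[X]} (h : PolyNonneg r F) {t : (σ → ℂˣ) → ℂ}
    (ht : PosFam t) : PolyNonneg r fun z => (F z).comp (C (t z)⁻¹ * X) := fun m =>
  ((h m).mul (ht.inv.pow m).nonneg).congr (.of_forall fun z => by
    rw [Pi.mul_apply, comp_C_mul_X_coeff, mul_assoc])

theorem eval_eq_sum_nonneg {F : ℂ[X]} {d : ℕ} (hd : F.natDegree ≤ d) (t : ℂ) :
    F.eval ((-1) ^ (r + 1) * t) =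
      ∑ m ∈ Finset.range (d + 1), (-1) ^ ((r + 1) * m) * F.coeff m * t ^ m := by
  rw [eval_eq_sum_range' (Nat.lt_succ_of_le hd)]
  refine Finset.sum_congr rfl fun m _ => ?_
  rw [mul_pow, pow_mul]
  ring

theorem PolyNonneg.eval {F : (σ → ℂˣ) → ℂ[X]} (h : PolyNonneg r F) {d : ℕ}
    (hd : ∀ᶠ z in generic σ, (F z).natDegree ≤ d) {t : (σ → ℂˣ) → ℂ} (ht : PosFam t) :
    NonnegFam fun z => (F z).eval ((-1) ^ (r + 1) * t z) := by
  refine (NonnegFam.sum (s := Finset.range (d + 1))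
    fun m _ => (h m).mul (ht.pow m).nonneg).congr ?_
  filter_upwards [hd] with z hz
  exact eval_eq_sum_nonneg hz _

theorem PolyNonneg.eval_pos {F : (σ → ℂˣ) → ℂ[X]} (h : PolyNonneg r F) {d : ℕ}
    (hd : ∀ᶠ z in generic σ, (F z).natDegree ≤ d) {t : (σ → ℂˣ) → ℂ} (ht : PosFam t)
    (h0 : ∀ᶠ z in generic σ, (F z).coeff 0 ≠ 0) :
    PosFam fun z => (F z).eval ((-1) ^ (r + 1) * t z) := by
  have h1 : PosFam fun z => (-1) ^ ((r + 1) * 0) * (F z).coeff 0 := (h 0).pos (by simpa using h0)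
  refine (h1.add_nonneg (NonnegFam.sum (s := Finset.range d)
    fun m _ => (h (m + 1)).mul (ht.pow (m + 1)).nonneg)).congr ?_
  filter_upwards [hd] with z hz
  rw [eval_eq_sum_nonneg hz, Finset.sum_range_succ', add_comm]
  simp

end PolynomialFamilies

/-! ### Minors of `g` at positive families of points. -/

section PointMinors

variable {σ : Type} {n k r : ℕ}

theorem PlFam.arcs_ne_zero {P : (σ → ℂˣ) → Finset (Fin n) → ℂ} (h : PlFam k P) :
    ∀ᶠ z in generic σ, ∀ d ≤ n, P z (compB n k d d) ≠ 0 := by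
  have h' : ∀ᶠ z in generic σ, ∀ d ∈ Finset.range (n + 1), P z (compB n k d d) ≠ 0 :=
    (Filter.eventually_all_finset _).2 fun d hd =>
      (h.pos d (by rw [Finset.mem_range] at hd; omega)).ne_zero
  filter_upwards [h'] with z hz d hd
  exact hz d (by rw [Finset.mem_range]; omega)

theorem posFam_gScale {P : (σ → ℂˣ) → Finset (Fin n) → ℂ} (h : PlFam k P) {t : (σ → ℂˣ) → ℂ}
    (ht : PosFam t) (j : Fin n) : PosFam fun z => gScale k (t z) (P z) j := by
  unfold gScale
  split_ifs
  · exact posFam_one.div (h.pos _ j.2.le)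
  · exact ht.div (h.pos _ j.2.le)

variable {p : (σ → ℂˣ) → XVar n k}

/-- The generic properties of a positive family of points. -/
theorem PosPoint.eventually_pl (hp : PosPoint p) (hk : k ≤ n) : ∀ᶠ z in generic σ,
    ∃ V : Matrix (Fin n) (Fin k) ℂ, (p z).1.normPl = pl V ∧
      (∀ u, V.col u ∈ (p z).1.1) ∧ ∀ d ≤ n, pl V (compB n k d d) ≠ 0 := by
  obtain ⟨P, hP, hpP⟩ := hp.exists_plFam hk
  filter_upwards [hp.last_ne_zero hk, hpP, hP.arcs_ne_zero] with z h1 h2 h3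
  obtain ⟨V, -, hV2, hV3⟩ := Gr.exists_normalized hk h1
  have h4 : (p z).1.normPl = pl V := funext fun S => (hV2 S).symm
  refine ⟨V, h4, fun u => ?_, ?_⟩
  · rw [← hV3]
    exact Submodule.subset_span ⟨u, rfl⟩
  · rwa [← h4, h2]

theorem PosPoint.gVal_mem (hp : PosPoint p) (hk : k ≤ n) :
    ∀ᶠ z in generic σ, gVal (p z) ∈ g n k (p z) := by
  filter_upwards [hp.last_ne_zero hk, hp.eventually_pl hk] with z h1 ⟨V, hV, _, h3⟩
  refine GeomR.gVal_mem _ h1 fun j => ?_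
  have := h3 j j.2.le
  rw [← hV] at this
  rw [arc_eq_compB hk]
  exact (div_ne_zero_iff.1 this).1

/-- The results for `hMat` carry over: column scalings are positive, and the substitution of `λ / t`
turns `1 + (-1)^k λ` into `t⁻¹ (t + (-1)^k λ)`. -/
theorem PosPoint.minor_col (hp : PosPoint p) (hk : 1 ≤ k) (hkn : k < n) {I J : Finset (Fin n)}
    (hI : I.card = r) (hJ : J.card = r) (hJ2 : TwoArc J) : ∃ F : (σ → ℂˣ) → ℂ[X], PolyNonneg r F ∧
      ∀ᶠ z in generic σ, minor (gVal (p z)) I J =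
        (C ((p z).2 : ℂ) + (-1) ^ k * X) ^ (r - k) * F z := by
  obtain ⟨P, hP, hpP⟩ := hp.exists_plFam hkn.le
  obtain ⟨G, hG, hGe⟩ : ∃ G : (σ → ℂˣ) → ℂ[X], PolyNonneg r G ∧
      ∀ᶠ z in generic σ, minor (hMat k (P z)) I J = (1 + (-1) ^ k * X) ^ (r - k) * G z := by
    rcases Nat.le_total r k with h | h
    · refine ⟨_, polyNonneg_minor_of_le hP hk hkn h hI hJ hJ2, .of_forall fun z => ?_⟩
      rw [Nat.sub_eq_zero_of_le h, pow_zero, one_mul]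
    · exact polyNonneg_minor_of_ge hP hk hkn h hI hJ hJ2
  refine ⟨_, (hG.comp_inv_mul_X hp.param).C_mul
    ((PosFam.prod fun j (_ : j ∈ J) => posFam_gScale hP hp.param j).mul
      (hp.param.inv.pow (r - k))).nonneg, ?_⟩
  filter_upwards [hpP, hGe, hP.eq_pl] with z h1 h2 ⟨V, hV⟩
  have ht : ((p z).2 : ℂ) ≠ 0 := Units.ne_zero _
  have e : (C ((p z).2 : ℂ) + (-1) ^ k * X) * C ((p z).2 : ℂ)⁻¹ =
      1 + (-1) ^ k * (C ((p z).2 : ℂ)⁻¹ * X) := by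
    rw [add_mul, ← C_mul, mul_inv_cancel₀ ht, C_1]
    ring
  rw [gVal, h1, hV, minor_gMat hk hkn.le ht, ← hV, h2, mul_comp, pow_comp, add_comp, one_comp,
    mul_comp, X_comp, pow_comp, neg_comp, one_comp, ← e, mul_pow, Pi.mul_apply, C_mul, C_pow]
  ring

theorem PosPoint.coeff_zero_minor_self (hp : PosPoint p) (hk : 1 ≤ k) (hkn : k ≤ n)
    (I : Finset (Fin n)) : ∀ᶠ z in generic σ, (minor (gVal (p z)) I I).coeff 0 ≠ 0 := by
  filter_upwards [hp.eventually_pl hkn] with z ⟨V, hV, _, h3⟩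
  rw [gVal, hV, coeff_zero_minor_gMat_self hk hkn]
  refine Finset.prod_ne_zero_iff.2 fun i _ => mul_ne_zero ?_
    (div_ne_zero (h3 _ i.2) (h3 _ i.2.le))
  split_ifs
  · exact one_ne_zero
  · exact Units.ne_zero _

/-- At this value of `λ` the signs in `hMat_pl` cancel and column `j` becomes a multiple of `om V
j`, which lies in the column space of `V`. So the rank drops to at most `k`. -/
theorem eval_gMat (hk : 1 ≤ k) (hkn : k ≤ n) {t : ℂ} (ht : t ≠ 0) (V : Matrix (Fin n) (Fin k) ℂ) :
    ∃ W : Matrix (Fin k) (Fin n) ℂ,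
      (gMat k t (pl V)).map (evalRingHom ((-1) ^ (k + 1) * t)) = V * W := by
  choose w hw using fun j => exists_om V hk hkn j
  refine ⟨Matrix.of fun s j => gScale k t (pl V) j * w j s, ?_⟩
  ext i j
  have h1 : (V * Matrix.of fun s j => gScale k t (pl V) j * w j s) i j =
      gScale k t (pl V) j * om V j i := by
    rw [hw, Matrix.mul_apply, Matrix.mulVec, dotProduct, Finset.mul_sum]
    refine Finset.sum_congr rfl fun s _ => ?_
    rw [Matrix.of_apply]
    ring
  have h2 : ((-1 : ℂ) ^ (k + 1)) * (-1) ^ (k + 1) = 1 := by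
    rw [← mul_pow, neg_one_mul, neg_neg, one_pow]
  rw [h1, Matrix.map_apply, gMat_apply hk hkn ht, hMat_pl, coe_evalRingHom, eval_mul, eval_C,
    eval_comp, eval_mul, eval_C, eval_mul, eval_C, eval_X]
  congr 1
  split_ifs
  · rw [eval_mul, eval_X, eval_pow, eval_neg, eval_one]
    linear_combination (om V j i * t⁻¹ * t) * h2 + om V j i * inv_mul_cancel₀ ht
  · rw [eval_one, one_mul]

theorem minor_mul_eq {K : Type*} [CommRing K] (V : Matrix (Fin n) (Fin k) K)
    (W : Matrix (Fin k) (Fin n) K) {I J : Finset (Fin n)} (hI : I.card = k) (hJ : J.card = k) :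
    minor (V * W) I J = pl V I * (W.submatrix id (J.orderEmbOfFin hJ)).det := by
  rw [minor_of_card _ hI hJ, pl_of_card hI, ← Matrix.det_mul]
  rfl

theorem natDegree_le_of_mul {A B F : ℂ[X]} {d : ℕ} (h : A = B * F) (hB : B ≠ 0)
    (hA : A.natDegree ≤ d) : F.natDegree ≤ d := by
  by_cases hF : F = 0
  · rw [hF, natDegree_zero]
    exact Nat.zero_le _
  · rw [h, natDegree_mul hB hF] at hA
    omega

theorem C_add_mul_X_ne_zero (t : ℂˣ) (k : ℕ) : (C (t : ℂ) + (-1) ^ k * X : ℂ[X]) ≠ 0 := by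
  intro h
  have := congrArg (coeff · 0) h
  simp at this

theorem natDegree_factor_le {m : ℕ} {q : XVar n k} {I J : Finset (Fin n)} {F : ℂ[X]}
    (h : minor (gVal q) I J = (C (q.2 : ℂ) + (-1) ^ k * X) ^ m * F) : F.natDegree ≤ n :=
  natDegree_le_of_mul h (pow_ne_zero _ (C_add_mul_X_ne_zero _ _))
    (natDegree_minor_le (natDegree_gMat_le _ _) I J)

/-- By the rank-`k` factorisation the value is a Plücker coordinate of the rows times a number
depending only on `J`. That number is nonzero because the principal minor on `J` has a nonzero
constant term, hence a positive value; so the non-negative value for the rows `R` does not vanish.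
-/
theorem PosPoint.minor_eval_pos (hp : PosPoint p) (hk : 1 ≤ k) (hkn : k < n)
    {R J : Finset (Fin n)} (hR : R.card = k) (hJ : J.card = k) (hJ2 : TwoArc J)
    (hR0 : ∀ᶠ z in generic σ, (p z).1.normPl R ≠ 0) :
    PosFam fun z => (minor (gVal (p z)) R J).eval ((-1) ^ (k + 1) * ((p z).2 : ℂ)) := by
  have hdeg : ∀ I, ∀ᶠ z in generic σ, (minor (gVal (p z)) I J).natDegree ≤ n := fun I =>
    .of_forall fun z => natDegree_minor_le (natDegree_gMat_le _ _) I J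
  have hnn : ∀ I : Finset (Fin n), I.card = k →
      PolyNonneg k fun z => minor (gVal (p z)) I J := fun I hI => by
    obtain ⟨F, hF, hFe⟩ := hp.minor_col hk hkn hI hJ hJ2
    refine hF.congr ?_
    filter_upwards [hFe] with z hz
    rw [hz, Nat.sub_self, pow_zero, one_mul]
  have h1 := (hnn J hJ).eval_pos (hdeg J) hp.param (hp.coeff_zero_minor_self hk hkn.le J)
  refine ((hnn R hR).eval (hdeg R) hp.param).pos ?_
  filter_upwards [h1.ne_zero, hR0, hp.eventually_pl hkn.le] with z h1 h2 ⟨V, hV, _, _⟩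
  obtain ⟨W, hW⟩ := eval_gMat hk hkn.le (Units.ne_zero (p z).2) V
  rw [hV] at h2
  rw [gVal, hV, ← coe_evalRingHom, ← minor_map, hW, minor_mul_eq V W hJ hJ] at h1
  rw [gVal, hV, ← coe_evalRingHom, ← minor_map, hW, minor_mul_eq V W hR hJ]
  exact mul_ne_zero h2 (mul_ne_zero_iff.1 h1).2

end PointMinors

/-! ### The flip of `g` is `g` of another point. -/

section Flip

variable {n k : ℕ}

theorem gMat_shape (hk : 1 ≤ k) (hkn : k ≤ n) {t : ℂ} (ht : t ≠ 0) (V : Matrix (Fin n) (Fin k) ℂ)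
    (i j : Fin n) : ∃ a : ℂ, gMat k t (pl V) i j = (if i < j then X else 1) * C a := by
  rw [gMat_apply hk hkn ht, hMat, Matrix.of_apply]
  split_ifs
  · refine ⟨gScale k t (pl V) j * (t⁻¹ * pl V (insert i (compB n (k - 1) j j))), ?_⟩
    rw [mul_comp, X_comp, C_comp, C_mul, C_mul]
    ring
  · refine ⟨gScale k t (pl V) j * pl V (insert i (compB n (k - 1) j j)), ?_⟩
    rw [one_mul, one_mul, C_comp, C_mul]

theorem gMat_apply_of_mem (hk : 1 ≤ k) (hkn : k ≤ n) (t : ℂ) (V : Matrix (Fin n) (Fin k) ℂ)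
    {i j : Fin n} (h : i ∈ compB n (k - 1) j j) : gMat k t (pl V) i j = 0 := by
  rw [gMat, Matrix.of_apply, arc_eq_compB (by omega : k - 1 ≤ n), Finset.insert_eq_of_mem h,
    pl_of_card_ne (by rw [card_compB_self (by omega) j.2.le]; omega)]
  simp

theorem gMat_apply_edge (hk : 1 ≤ k) (hkn : k < n) (t : ℂ) {V : Matrix (Fin n) (Fin k) ℂ}
    {i j : Fin n} (h0 : pl V (compB n k j j) ≠ 0) (h : i.val + k = j.val ∨ i.val + k = n + j.val) :
    gMat k t (pl V) i j = if i < j then X else 1 := by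
  have hi := i.2
  have hj := j.2
  have e : insert i (compB n (k - 1) j j) = compB n k j j := by
    ext x
    have hx := x.2
    rw [Finset.mem_insert, mem_compB, mem_compB, Fin.ext_iff]
    omega
  rw [gMat, Matrix.of_apply, arc_eq_compB hkn.le, arc_eq_compB (by omega : k - 1 ≤ n), e,
    div_self h0, C_1, mul_one]
  by_cases hij : i < j
  · rw [if_pos hij, if_neg (not_le.2 hij), if_neg]
    rw [Fin.lt_def] at hij
    omega
  · rw [if_neg hij, if_pos]
    rw [Fin.lt_def] at hij
    omega

/-- At `λ = (-1)^(k-1) t` both matrices have columns in the column space of `V'`, and their columns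
agree on `k` rows that determine them. As every entry is a constant, or a constant times `λ`, with
the same shape on both sides, equality at this one nonzero value gives equality of polynomials. -/
theorem flip_gMat (hk : 1 ≤ k) (hkn : k < n) {t : ℂ} (ht : t ≠ 0) {V V' : Matrix (Fin n) (Fin k) ℂ}
    (hV : ∀ j : Fin n, pl V (compB n k j j) ≠ 0) (hV' : ∀ j : Fin n, pl V' (compB n k j j) ≠ 0)
    (h : ∀ i (u : Fin k), (flip (gMat k t (pl V)) i ⟨u, by omega⟩).eval ((-1) ^ (k + 1) * t) =
      V' i u) : flip (gMat k t (pl V)) = gMat k t (pl V') := by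
  set l : ℂ := (-1) ^ (k + 1) * t with hl
  have hl0 : l ≠ 0 := mul_ne_zero (pow_ne_zero _ (neg_ne_zero.2 one_ne_zero)) ht
  obtain ⟨W, hW⟩ := eval_gMat hk hkn.le ht V
  obtain ⟨W', hW'⟩ := eval_gMat hk hkn.le ht V'
  rw [← hl] at hW hW'
  set U : Matrix (Fin n) (Fin k) ℂ := Matrix.of fun i s => W s i.rev with hU
  set Z : Matrix (Fin k) (Fin n) ℂ := Matrix.of fun s j => V j.rev s with hZ
  have hUZ : ∀ i j, (flip (gMat k t (pl V)) i j).eval l = (U * Z) i j := fun i j => by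
    have := congrFun (congrFun hW j.rev) i.rev
    rw [Matrix.map_apply, coe_evalRingHom] at this
    rw [flip, Matrix.of_apply, this, Matrix.mul_apply, Matrix.mul_apply]
    exact Finset.sum_congr rfl fun s _ => mul_comm _ _
  set Z₁ : Matrix (Fin k) (Fin k) ℂ := Z.submatrix id (Fin.castLE hkn.le) with hZ₁
  have hV'U : V' = U * Z₁ := by
    ext i u
    rw [← h, hUZ]
    rfl
  have hZu : IsUnit Z₁.det := by
    have h1 := hV' ⟨0, by omega⟩
    rw [hV'U, pl_mul] at h1
    exact isUnit_iff_ne_zero.2 (mul_ne_zero_iff.1 h1).2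
  have hUV : U = V' * Z₁⁻¹ := by
    rw [hV'U, Matrix.mul_assoc, Matrix.mul_nonsing_inv _ hZu, Matrix.mul_one]
  -- On the rows of the cyclic interval of length `k` before `j`, column `j` of either matrix has `k
  -- - 1` zeros and one edge entry equal to `1` or `λ`. The difference of the two columns is in the
  -- column space of `V'` and vanishes on these rows, where the minor of `V'` is nonzero.
  have hev : ∀ i j, (flip (gMat k t (pl V)) i j).eval l = (gMat k t (pl V') i j).eval l := by
    intro i j
    set x : Fin k → ℂ := (Z₁⁻¹ * Z - W').col j with hx
    have hxi : ∀ i, V'.mulVec x i =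
        (flip (gMat k t (pl V)) i j).eval l - (gMat k t (pl V') i j).eval l := fun i => by
      have h2 := congrFun (congrFun hW' i) j
      rw [Matrix.map_apply, coe_evalRingHom] at h2
      rw [hUZ, h2, hUV, Matrix.mul_assoc, ← Matrix.sub_apply, ← Matrix.mul_sub]
      rfl
    have hc := card_compB_self (n := n) (k := k) hkn.le j.2.le
    have hd := hV' j
    rw [pl_of_card hc] at hd
    have hx0 : x = 0 := by
      refine Matrix.eq_zero_of_mulVec_eq_zero hd ?_
      ext s
      change V'.mulVec x ((compB n k j j).orderEmbOfFin hc s) = 0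
      have hm := (compB n k j j).orderEmbOfFin_mem hc s
      generalize (compB n k j j).orderEmbOfFin hc s = a at hm
      rw [hxi]
      have ha := a.2
      have hj := j.2
      by_cases hm' : a ∈ compB n (k - 1) j j
      · rw [gMat_apply_of_mem hk hkn.le t V' hm', flip, Matrix.of_apply,
          gMat_apply_of_mem hk hkn.le t V, sub_self]
        rw [mem_compB] at hm' ⊢
        rw [Fin.val_rev, Fin.val_rev]
        omega
      · rw [mem_compB] at hm hm'
        rw [gMat_apply_edge hk hkn t (hV' j) (by omega), flip, Matrix.of_apply,
          gMat_apply_edge hk hkn t (hV _) (by rw [Fin.val_rev, Fin.val_rev]; omega)]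
        simp only [Fin.rev_lt_rev, sub_self]
    have := hxi i
    rw [hx0, Matrix.mulVec_zero, Pi.zero_apply] at this
    exact (sub_eq_zero.1 this.symm)
  ext1 i j
  obtain ⟨a, ha⟩ := gMat_shape hk hkn.le ht V j.rev i.rev
  obtain ⟨b, hb⟩ := gMat_shape hk hkn.le ht V' i j
  have h3 := hev i j
  rw [flip, Matrix.of_apply, ha, hb] at h3
  rw [flip, Matrix.of_apply, ha, hb]
  simp only [Fin.rev_lt_rev] at h3 ⊢
  split_ifs at h3 ⊢
  · rw [eval_mul, eval_mul, eval_X, eval_C, eval_C] at h3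
    rw [mul_left_cancel₀ hl0 h3]
  · rw [eval_mul, eval_mul, eval_one, eval_C, eval_C, one_mul, one_mul] at h3
    rw [h3]

theorem gMat_div (t : ℂ) (P : Finset (Fin n) → ℂ) {c : ℂ} (hc : c ≠ 0) :
    gMat k t (fun S => P S / c) = gMat k t P := by
  ext1 i j
  simp only [gMat, Matrix.of_apply, div_div_div_cancel_right₀ hc]

end Flip

/-! ### Positivity of the geometric Schützenberger involution. -/

section Schutzenberger

variable {σ : Type} {n k r : ℕ} {p : (σ → ℂˣ) → XVar n k}

theorem card_basicSet {s i m : ℕ} (hs : s + k ≤ n) (hi : i ≤ s) (hm : m ≤ k) :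
    (basicSet n k s i m).card = k := by
  obtain ⟨f, hf, hfi, -⟩ := exists_strictMono_basicSet (n := n) (k := k) hs hi hm
  rw [hfi, card_image_strictMono hf]

theorem card_revSet (S : Finset (Fin n)) : (revSet S).card = S.card := by
  rw [revSet, Finset.card_map]

theorem twoArc_revSet_basicSet (hk : k ≤ n) {i m : ℕ} (hi : i ≤ n - k) (hm : m ≤ k) :
    TwoArc (revSet (basicSet n k (n - k) i m)) := by
  refine ⟨0, k - m, n - i - m, n - i, by omega, by omega, by omega, ?_⟩
  ext x
  rw [pow_zero]
  have e : (twoIco n (k - m) (n - i - m) (n - i)).map (1 : Equiv.Perm (Fin n)).toEmbedding =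
      twoIco n (k - m) (n - i - m) (n - i) := by
    ext y
    rw [Finset.mem_map_equiv]
    rfl
  have hx := x.2
  rw [e, mem_revSet, mem_basicSet, mem_twoIco, Fin.val_rev]
  omega

theorem twoArc_basicSet (hk : k ≤ n) {i m : ℕ} (hi : i ≤ n - k) (hm : m ≤ k) :
    TwoArc (basicSet n k (n - k) i m) := by
  rw [← revSet_revSet (basicSet n k (n - k) i m)]
  exact (twoArc_revSet_basicSet hk hi hm).rev

theorem revSet_ico_zero (hk : k ≤ n) : revSet (ico n 0 k) = ico n (n - k) n := by
  ext x
  have hx := x.2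
  rw [mem_revSet, mem_ico, mem_ico, Fin.val_rev]
  omega

theorem PosPoint.normPl_last (hp : PosPoint p) (hk : k ≤ n) :
    ∀ᶠ z in generic σ, (p z).1.normPl (ico n (n - k) n) = 1 := by
  filter_upwards [hp.last_ne_zero hk] with z hz
  exact div_self hz

/-- A family of full-rank matrices with positive ratios of basic minors spans a positive family of
points. -/
theorem exists_posPoint_of_minors (hk : k ≤ n) {t : (σ → ℂˣ) → ℂˣ}
    (ht : PosFam fun z => (t z : ℂ)) {A : (σ → ℂˣ) → Matrix (Fin n) (Fin n) ℂ[X]}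
    {V : (σ → ℂˣ) → Matrix (Fin n) (Fin k) ℂ}
    (hA : ∀ z i (u : Fin k), (A z i ⟨u, by omega⟩).eval ((-1) ^ (k + 1) * (t z : ℂ)) = V z i u)
    {c : (σ → ℂˣ) → ℂ} {f : ℕ → ℕ → (σ → ℂˣ) → ℂ} (hc : ∀ᶠ z in generic σ, c z ≠ 0)
    (hf : ∀ i m, i ≤ n - k → m ≤ k → PosFam (f i m))
    (h : ∀ i m, i ≤ n - k → m ≤ k →
      ∀ᶠ z in generic σ, pl (V z) (basicSet n k (n - k) i m) = c z * f i m z) :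
    ∃ q : (σ → ℂˣ) → XVar n k, PosPoint q ∧ (∀ z, (q z).2 = t z) ∧
      (∀ᶠ z in generic σ, q z ∈ piMap n k (t z) (A z)) ∧
      ∀ᶠ z in generic σ, pl (V z) (ico n (n - k) n) ≠ 0 ∧
        ∀ S, (q z).1.normPl S = pl (V z) S / pl (V z) (ico n (n - k) n) := by
  have h0 : ∀ᶠ z in generic σ, pl (V z) (ico n (n - k) n) ≠ 0 := by
    filter_upwards [hc, (hf 0 0 (Nat.zero_le _) (Nat.zero_le _)).ne_zero,
      h 0 0 (Nat.zero_le _) (Nat.zero_le _)] with z h1 h2 h3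
    rw [basicSet_top hk] at h3
    rw [h3]
    exact mul_ne_zero h1 h2
  have hN : ∀ z, ∃ N : Gr k n, pl (V z) (ico n (n - k) n) ≠ 0 →
      (N, t z) ∈ piMap n k (t z) (A z) ∧ N.1 = Submodule.span ℂ (Set.range (V z).col) := by
    intro z
    by_cases hz : pl (V z) (ico n (n - k) n) ≠ 0
    · obtain ⟨N, hN⟩ := mem_piMap hk (hA z) hz
      exact ⟨N, fun _ => hN⟩
    · obtain ⟨N, -⟩ := exists_mem_Theta (n := n) (k := k) hk 1
      exact ⟨N, fun h => absurd h hz⟩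
  choose N hN using hN
  have hpl : ∀ᶠ z in generic σ, pl (V z) (ico n (n - k) n) ≠ 0 ∧
      ∀ S, (N z).normPl S = pl (V z) S / pl (V z) (ico n (n - k) n) := by
    filter_upwards [h0] with z hz
    refine ⟨hz, ((N z).normPl_eq (fun u => ?_) hz).2⟩
    rw [(hN z hz).2]
    exact Submodule.subset_span ⟨u, rfl⟩
  refine ⟨fun z => (N z, t z), ⟨ht, fun i m hi hm => ?_⟩, fun z => rfl, ?_, hpl⟩
  -- Normalising by the last coordinate cancels the common factor `c`, about whose positivity
  -- nothing is assumed.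
  · refine ((hf i m hi hm).div (hf 0 0 (Nat.zero_le _) (Nat.zero_le _))).congr ?_
    filter_upwards [hpl, hc, h i m hi hm, h 0 0 (Nat.zero_le _) (Nat.zero_le _)] with z h1 h2 h3 h4
    rw [basicSet_top hk] at h4
    rw [h1.2, h3, h4, mul_div_mul_left _ _ h2]
  · filter_upwards [h0] with z hz
    exact (hN z hz).1

/-- The basic coordinates of the image are values of minors of `g` with the last `k` rows and with a
reversed basic set as columns, hence at most two intervals. The last Plücker coordinate being
nonzero, these values are positive. -/
theorem PosPoint.exists_schutz (hp : PosPoint p) (hk : 1 ≤ k) (hkn : k < n) :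
    ∃ q : (σ → ℂˣ) → XVar n k, PosPoint q ∧ (∀ z, (q z).2 = (p z).2) ∧
      (∀ᶠ z in generic σ, q z ∈ schutz n k (p z)) ∧
      ∀ᶠ z in generic σ, flip (gVal (p z)) = gVal (q z) := by
  have hcI : (ico n (n - k) n).card = k := by rw [card_ico le_rfl (by omega)]; omega
  have hmin : ∀ z S, pl (Matrix.of fun i (u : Fin k) => (flip (gVal (p z)) i ⟨u, by omega⟩).eval
      ((-1) ^ (k + 1) * ((p z).2 : ℂ))) S =
      (minor (gVal (p z)) (ico n (n - k) n) (revSet S)).eval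
        ((-1) ^ (k + 1) * ((p z).2 : ℂ)) := fun z S => by
    rw [← coe_evalRingHom, ← revSet_ico_zero hkn.le, ← minor_flip, ← minor_map,
      ← pl_eq_minor _ hkn.le]
    rfl
  obtain ⟨q, hq, hq2, hqm, hqn⟩ := exists_posPoint_of_minors hkn.le hp.param
    (A := fun z => flip (gVal (p z)))
    (V := fun z => Matrix.of fun i (u : Fin k) => (flip (gVal (p z)) i ⟨u, by omega⟩).eval
      ((-1) ^ (k + 1) * ((p z).2 : ℂ))) (fun z i u => rfl) (c := fun _ => 1)
    (f := fun i m z => (minor (gVal (p z)) (ico n (n - k) n)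
      (revSet (basicSet n k (n - k) i m))).eval ((-1) ^ (k + 1) * ((p z).2 : ℂ)))
    (.of_forall fun z => one_ne_zero) (fun i m hi hm => by
      refine hp.minor_eval_pos hk hkn hcI ?_ (twoArc_revSet_basicSet hkn.le hi hm) ?_
      · rw [card_revSet, card_basicSet (by omega) hi hm]
      · filter_upwards [hp.normPl_last hkn.le] with z hz
        rw [hz]
        exact one_ne_zero)
    (fun i m _ _ => .of_forall fun z => by rw [one_mul, hmin])
  refine ⟨q, hq, hq2, ?_, ?_⟩
  · filter_upwards [hqm, hp.gVal_mem hkn.le] with z h1 h2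
    exact Part.mem_bind h2 h1
  · filter_upwards [hqn, hp.eventually_pl hkn.le, hq.eventually_pl hkn.le]
      with z ⟨h1, h2⟩ ⟨V, hV, _, hV3⟩ ⟨V', hV', _, hV3'⟩
    set Vf : Matrix (Fin n) (Fin k) ℂ := Matrix.of fun i (u : Fin k) =>
      (flip (gVal (p z)) i ⟨u, by omega⟩).eval ((-1) ^ (k + 1) * ((p z).2 : ℂ)) with hVf
    have e : gVal (q z) = gMat k ((p z).2 : ℂ) (pl Vf) := by
      rw [gVal, hq2, funext h2]
      exact gMat_div _ _ h1
    rw [e, gVal, hV]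
    refine flip_gMat hk hkn (Units.ne_zero _) (fun j => hV3 _ j.2.le) (fun j hj => ?_)
      fun i u => ?_
    · refine hV3' j j.2.le ?_
      rw [← hV', h2, hj, zero_div]
    · rw [hVf, Matrix.of_apply, gVal, hV]

/-- If it is the rows that form two intervals, the flip turns them into columns, and the flipped
matrix is that of another positive family with the same parameter. -/
theorem PosPoint.minor (hp : PosPoint p) (hk : 1 ≤ k) (hkn : k < n) {I J : Finset (Fin n)}
    (hI : I.card = r) (hJ : J.card = r) (hIJ : TwoArc I ∨ TwoArc J) :
    ∃ F : (σ → ℂˣ) → ℂ[X], PolyNonneg r F ∧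
      ∀ᶠ z in generic σ, minor (gVal (p z)) I J =
        (C ((p z).2 : ℂ) + (-1) ^ k * X) ^ (r - k) * F z := by
  rcases hIJ with h | h
  swap
  · exact hp.minor_col hk hkn hI hJ h
  obtain ⟨q, hq, hq2, -, hqf⟩ := hp.exists_schutz hk hkn
  obtain ⟨F, hF, hFe⟩ := hq.minor_col hk hkn (r := r) (I := revSet J) (J := revSet I)
    (by rw [card_revSet, hJ]) (by rw [card_revSet, hI]) h.rev
  refine ⟨F, hF, ?_⟩
  filter_upwards [hqf, hFe] with z h1 h2
  rw [← hq2, ← h2, ← h1, GeomR.flip, minor_flip, revSet_revSet, revSet_revSet]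

end Schutzenberger

/-! ### Cauchy–Binet and the positivity of `Ψ`. -/

section CauchyBinet

variable {n k : ℕ} {K : Type*} [CommRing K]

theorem factorial_mul_minor_mul (A B : Matrix (Fin n) (Fin n) K) {I J : Finset (Fin n)}
    (hI : I.card = k) (hJ : J.card = k) :
    (k.factorial : K) * minor (A * B) I J = ∑ f : Fin k → Fin n,
      if Function.Injective f then
        minor A I (Finset.univ.image f) * minor B (Finset.univ.image f) J else 0 := by
  rw [minor_of_card _ hI hJ]
  have e : (A * B).submatrix (I.orderEmbOfFin hI) (J.orderEmbOfFin hJ) =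
      A.submatrix (I.orderEmbOfFin hI) id * B.submatrix id (J.orderEmbOfFin hJ) := rfl
  rw [e, factorial_mul_det_mul]
  refine Finset.sum_congr rfl fun f _ => ?_
  split_ifs with hf
  · have hS : (Finset.univ.image f).card = k := by
      rw [Finset.card_image_of_injective _ hf, Finset.card_univ, Fintype.card_fin]
    set h := (Finset.univ.image f).orderEmbOfFin hS with hh
    have hmem : ∀ s, ∃ u, h u = f s := fun s => by
      have : f s ∈ Finset.univ.image h := by
        rw [hh, image_orderEmbOfFin]
        exact Finset.mem_image_of_mem f (Finset.mem_univ s)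
      obtain ⟨u, -, hu⟩ := Finset.mem_image.1 this
      exact ⟨u, hu⟩
    choose π hπ using hmem
    have hπi : Function.Injective π := fun s u hsu => hf (by rw [← hπ, ← hπ, hsu])
    set ρ : Equiv.Perm (Fin k) := Equiv.ofBijective π (Finite.injective_iff_bijective.1 hπi)
    have hfρ : f = h ∘ ρ := funext fun s => (hπ s).symm
    rw [minor_of_card A hI hS, minor_of_card B hS hJ, ← hh, hfρ]
    have e1 : (A.submatrix (I.orderEmbOfFin hI) id).submatrix id (h ∘ ρ) =
        (A.submatrix (I.orderEmbOfFin hI) h).submatrix id ρ := rfl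
    have e2 : (B.submatrix id (J.orderEmbOfFin hJ)).submatrix (h ∘ ρ) id =
        (B.submatrix h (J.orderEmbOfFin hJ)).submatrix ρ id := rfl
    rw [e1, e2, Matrix.det_permute', Matrix.det_permute]
    have e3 : ((Equiv.Perm.sign ρ : ℤ) : K) * ((Equiv.Perm.sign ρ : ℤ) : K) = 1 := by
      rw [← Int.cast_mul, ← Units.val_mul, Int.units_mul_self, Units.val_one, Int.cast_one]
    linear_combination ((A.submatrix (I.orderEmbOfFin hI) h).det *
      (B.submatrix h (J.orderEmbOfFin hJ)).det) * e3
  · obtain ⟨s, u, hsu, hne⟩ := Function.not_injective_iff.1 hf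
    rw [Matrix.det_zero_of_column_eq hne (fun i => by simp [hsu]), zero_mul]

end CauchyBinet

section Psi

variable {σ : Type} {n k ℓ : ℕ} {p : (σ → ℂˣ) → XVar n ℓ} {q : (σ → ℂˣ) → XVar n k}

/-- In every Cauchy–Binet term the left minor has a two-interval row set and the right minor has the
interval of the first `k` columns, so both are covered, whatever the intermediate set is. The left
minors share the power of `s + (-1)^ℓ λ`; the remaining factors are non-negative at `λ = (-1)^(k-1)
t`. -/
theorem PosPoint.exists_Psi (hp : PosPoint p) (hq : PosPoint q) (hℓ : 1 ≤ ℓ) (hℓn : ℓ < n)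
    (hk : 1 ≤ k) (hkn : k < n)
    (hpq : ∀ᶠ z in generic σ, ((p z).2 : ℂ) ^ 2 ≠ ((q z).2 : ℂ) ^ 2) :
    ∃ v : (σ → ℂˣ) → XVar n k, PosPoint v ∧ (∀ z, (v z).2 = (q z).2) ∧
      ∀ᶠ z in generic σ, v z ∈ Psi n k ℓ (p z, q z) := by
  set l : (σ → ℂˣ) → ℂ := fun z => (-1) ^ (k + 1) * ((q z).2 : ℂ) with hl
  set J := ico n 0 k with hJd
  have hJ : J.card = k := by rw [card_ico hkn.le (Nat.zero_le _), Nat.sub_zero]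
  have hJ2 : TwoArc J := by
    rw [← revSet_revSet J, hJd, revSet_ico_zero hkn.le, ← basicSet_top hkn.le 0]
    exact twoArc_revSet_basicSet hkn.le (Nat.zero_le _) (Nat.zero_le _)
  -- The factor common to all basic minors: the `1/k!` of symmetrised Cauchy–Binet and the power of
  -- `s ± t`. It need not be positive, but it is nonzero when `s² ≠ t²`, and then it drops out of
  -- normalised coordinates. For `k ≤ ℓ` the power is trivial.
  set c : (σ → ℂˣ) → ℂ := fun z =>
    ((k.factorial : ℂ))⁻¹ * (((p z).2 : ℂ) + (-1) ^ ℓ * l z) ^ (k - ℓ) with hc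
  have hk0 : (k.factorial : ℂ) ≠ 0 := by exact_mod_cast k.factorial_ne_zero
  have hc0 : ∀ᶠ z in generic σ, c z ≠ 0 := by
    filter_upwards [hpq] with z hz
    refine mul_ne_zero (inv_ne_zero hk0) (pow_ne_zero _ fun h => hz ?_)
    have h1 : ((p z).2 : ℂ) = -((-1) ^ ℓ * l z) := eq_neg_of_add_eq_zero_left h
    rw [h1, hl, neg_sq, mul_pow, mul_pow, ← pow_mul, ← pow_mul, mul_comm ℓ, mul_comm (k + 1),
      pow_mul, pow_mul (-1 : ℂ) 2, neg_one_sq, one_pow, one_pow, one_mul, one_mul]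
  have key : ∀ I : Finset (Fin n), I.card = k → TwoArc I →
      (∀ᶠ z in generic σ, (q z).1.normPl I ≠ 0) →
      ∃ f : (σ → ℂˣ) → ℂ, PosFam f ∧ ∀ᶠ z in generic σ,
        (GeomR.minor (gVal (p z) * gVal (q z)) I J).eval (l z) = c z * f z := by
    intro I hI hI2 hI0
    choose F hF hFe using fun S : {S : Finset (Fin n) // S.card = k} =>
      hp.minor hℓ hℓn hI S.2 (Or.inl hI2)
    have hdeg : ∀ S, ∀ᶠ z in generic σ, (F S z).natDegree ≤ n := fun S => by
      filter_upwards [hFe S] with z hz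
      exact natDegree_factor_le hz
    choose G hG hGe using fun S : {S : Finset (Fin n) // S.card = k} =>
      hq.minor hk hkn S.2 hJ (Or.inr hJ2)
    have hdegG : ∀ S, ∀ᶠ z in generic σ, (G S z).natDegree ≤ n := fun S => by
      filter_upwards [hGe S] with z hz
      exact natDegree_factor_le hz
    have hcard : ∀ f : Fin k → Fin n, Function.Injective f → (Finset.univ.image f).card = k :=
      fun f hf => by rw [Finset.card_image_of_injective _ hf, Finset.card_univ, Fintype.card_fin]
    set T : (Fin k → Fin n) → (σ → ℂˣ) → ℂ := fun f z =>
      if hf : Function.Injective f then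
        (F ⟨_, hcard f hf⟩ z).eval (l z) * (G ⟨_, hcard f hf⟩ z).eval (l z) else 0 with hT
    have hTnn : ∀ f, NonnegFam (T f) := fun f => by
      by_cases hf : Function.Injective f
      · refine (((hF ⟨_, hcard f hf⟩).eval (hdeg _) hq.param).mul
          ((hG ⟨_, hcard f hf⟩).eval (hdegG _) hq.param)).congr (.of_forall fun z => ?_)
        simp only [hT, dif_pos hf]
        rfl
      · refine nonnegFam_zero.congr (.of_forall fun z => ?_)
        simp only [hT, dif_neg hf]
    -- The intermediate set `I` itself gives a term known to be positive: its left minor is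
    -- principal, with nonzero constant term, and its right minor is a positive value.
    set f₀ : Fin k → Fin n := fun s => I.orderEmbOfFin hI s with hf₀
    have hf₀i : Function.Injective f₀ := (I.orderEmbOfFin hI).injective
    have hf₀I : Finset.univ.image f₀ = I := image_orderEmbOfFin hI
    have hTpos : PosFam (T f₀) := by
      have e : (⟨_, hcard f₀ hf₀i⟩ : {S : Finset (Fin n) // S.card = k}) = ⟨I, hI⟩ :=
        Subtype.ext hf₀I
      have h1 : PosFam fun z => (F ⟨I, hI⟩ z).eval (l z) := by
        refine (hF ⟨I, hI⟩).eval_pos (hdeg _) hq.param ?_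
        filter_upwards [hFe ⟨I, hI⟩, hp.coeff_zero_minor_self hℓ hℓn.le I] with z h2 h3
        rw [h2, mul_coeff_zero] at h3
        exact (mul_ne_zero_iff.1 h3).2
      have h2 : PosFam fun z => (G ⟨I, hI⟩ z).eval (l z) := by
        refine (hq.minor_eval_pos hk hkn hI hJ hJ2 hI0).congr ?_
        filter_upwards [hGe ⟨I, hI⟩] with z hz
        rw [hz, Nat.sub_self, pow_zero, one_mul]
      refine (h1.mul h2).congr (.of_forall fun z => ?_)
      simp only [hT, dif_pos hf₀i, e]
      rfl
    refine ⟨_, hTpos.add_nonneg (NonnegFam.sum (s := Finset.univ.erase f₀) fun f _ => hTnn f), ?_⟩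
    filter_upwards [Filter.eventually_all.2 hFe, Filter.eventually_all.2 hGe] with z hFz hGz
    have h1 := factorial_mul_minor_mul (gVal (p z)) (gVal (q z)) hI hJ
    have h2 := congrArg (eval (l z)) h1
    rw [eval_mul, eval_natCast, eval_finsetSum] at h2
    have h3 : ∀ f : Fin k → Fin n, eval (l z) (if Function.Injective f then
        GeomR.minor (gVal (p z)) I (Finset.univ.image f) *
          GeomR.minor (gVal (q z)) (Finset.univ.image f) J else 0) =
        (((p z).2 : ℂ) + (-1) ^ ℓ * l z) ^ (k - ℓ) * T f z := fun f => by
      by_cases hf : Function.Injective f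
      · rw [if_pos hf, hFz ⟨_, hcard f hf⟩, hGz ⟨_, hcard f hf⟩]
        simp only [hT, dif_pos hf, Nat.sub_self, pow_zero, one_mul, eval_mul, eval_pow, eval_add,
          eval_C, eval_neg, eval_one, eval_X]
        ring
      · simp only [if_neg hf, hT, dif_neg hf, eval_zero, mul_zero]
    rw [Finset.sum_congr rfl fun f _ => h3 f, ← Finset.mul_sum,
      ← Finset.add_sum_erase _ _ (Finset.mem_univ f₀)] at h2
    rw [Pi.add_apply, hc, mul_assoc, ← h2, inv_mul_cancel_left₀ hk0]
  choose f hf hfe using fun (i m : ℕ) (h : i ≤ n - k ∧ m ≤ k) =>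
    key (basicSet n k (n - k) i m) (card_basicSet (by omega) h.1 h.2)
      (twoArc_basicSet hkn.le h.1 h.2) (hq.basic i m h.1 h.2).ne_zero
  have hmin : ∀ z S, pl (Matrix.of fun i (u : Fin k) =>
      ((gVal (p z) * gVal (q z)) i ⟨u, by omega⟩).eval (l z)) S =
      (GeomR.minor (gVal (p z) * gVal (q z)) S J).eval (l z) := fun z S => by
    rw [← coe_evalRingHom, ← minor_map, ← pl_eq_minor _ hkn.le]
    rfl
  obtain ⟨v, hv, hv2, hvm, -⟩ := exists_posPoint_of_minors hkn.le hq.param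
    (A := fun z => gVal (p z) * gVal (q z))
    (V := fun z => Matrix.of fun i (u : Fin k) =>
      ((gVal (p z) * gVal (q z)) i ⟨u, by omega⟩).eval (l z)) (fun z i u => rfl)
    (f := fun i m => if h : i ≤ n - k ∧ m ≤ k then f i m h else 1) hc0
    (fun i m hi hm => by
      rw [dif_pos ⟨hi, hm⟩]
      exact hf i m ⟨hi, hm⟩)
    (fun i m hi hm => by
      filter_upwards [hfe i m ⟨hi, hm⟩] with z hz
      rw [dif_pos ⟨hi, hm⟩, hmin, hz])
  refine ⟨v, hv, hv2, ?_⟩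
  filter_upwards [hvm, hp.gVal_mem hℓn.le, hq.gVal_mem hkn.le] with z h1 h2 h3
  exact Part.mem_bind h2 (Part.mem_bind h3 h1)

end Psi

/-! ### Sets with at most two cyclic intervals -/

section CyclicIntervals

variable {n : ℕ}

theorem mem_arc_rotate (q m : ℕ) (j w : Fin n) :
    ((finRotate n) ^ q : Equiv.Perm (Fin n)) w ∈
      arc (((finRotate n) ^ q : Equiv.Perm (Fin n)) j) m ↔ w ∈ arc j m := by
  simp only [arc, Finset.mem_filter, Finset.mem_univ, true_and, finRotate_pow_val]
  refine exists_congr fun a => and_congr_right fun _ => ?_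
  have h1 : (w.val + q) % n + a + 1 ≡ (w.val + a + 1) + q [MOD n] := by
    have := ((Nat.mod_modEq (w.val + q) n).add_right a).add_right 1
    have e : w.val + q + a + 1 = (w.val + a + 1) + q := by omega
    rwa [e] at this
  have h2 : (j.val + q) % n ≡ j.val + q [MOD n] := Nat.mod_modEq _ _
  constructor
  · intro h
    exact Nat.ModEq.add_right_cancel' q (h1.symm.trans (h.trans h2))
  · intro h
    exact h1.trans ((h.add_right q).trans h2.symm)

theorem arc_eq_univ {m : ℕ} (hm : n ≤ m) (j : Fin n) : arc j m = Finset.univ := by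
  ext x
  have hx : x ∈ arc j n := by
    have := x.2
    have := j.2
    rw [arc_eq_compB le_rfl, mem_compB]
    omega
  simp only [arc, Finset.mem_filter, Finset.mem_univ, true_and, Finset.mem_range, iff_true] at hx ⊢
  obtain ⟨a, ha, h⟩ := hx
  exact ⟨a, by omega, h⟩

/-- If `y` lies in the part of a wrapping arc that reaches the end of `[n]`, everything after `y` is
in the arc; otherwise so is everything between `x` and `y`. -/
theorem arc_convex {j : Fin n} {m : ℕ} {x y : Fin n} (hx : x ∈ arc j m)
    (hy : y ∈ arc j m) : (∀ w, x ≤ w → w ≤ y → w ∈ arc j m) ∨ ∀ w, y ≤ w → w ∈ arc j m := by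
  rcases Nat.le_total n m with h | h
  · left
    intro w _ _
    rw [arc_eq_univ h]
    exact Finset.mem_univ w
  · simp only [arc_eq_compB h, mem_compB, Fin.le_def] at hx hy ⊢
    have := y.2
    by_cases hc : n + j.val ≤ y.val + m
    · right
      intro w _
      omega
    · left
      intro w _ _
      omega

theorem exists_cyclicInterval_mem {J : Finset (Fin n)} {x : Fin n} (hx : x ∈ J) :
    ∃ T ∈ cyclicIntervals J, x ∈ T := by
  have h0 : ({x} : Finset (Fin n)) ⊆ J ∧ ({x} : Finset (Fin n)).Nonempty ∧
      IsCyclicInterval ({x} : Finset (Fin n)) := by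
    refine ⟨Finset.singleton_subset_iff.2 hx, Finset.singleton_nonempty x,
      ⟨(x.val + 1) % n, Nat.mod_lt _ x.pos⟩, 1, ?_⟩
    ext y
    simp only [arc, Finset.mem_singleton, Finset.mem_filter, Finset.mem_univ, true_and,
      Finset.mem_range, Nat.lt_one_iff, exists_eq_left, add_zero]
    constructor
    · rintro rfl
      exact (Nat.mod_modEq _ _).symm
    · intro h
      have h1 := Nat.ModEq.add_right_cancel' 1 (h.trans (Nat.mod_modEq _ _))
      rw [Nat.ModEq, Nat.mod_eq_of_lt y.2, Nat.mod_eq_of_lt x.2] at h1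
      exact Fin.ext h1
  obtain ⟨T, hT, hm⟩ := (Set.toFinite {T : Finset (Fin n) |
    T ⊆ J ∧ T.Nonempty ∧ IsCyclicInterval T}).exists_le_maximal h0
  exact ⟨T, hm, hT (Finset.mem_singleton_self x)⟩

theorem exists_boundary {J : Finset (Fin n)} (h0 : J.Nonempty) (h1 : J ≠ Finset.univ) :
    ∃ i, i ∉ J ∧ finRotate n i ∈ J := by
  by_contra! h
  obtain ⟨y, hy⟩ := h0
  obtain ⟨x, hx⟩ : ∃ x, x ∉ J := by
    by_contra! h2
    exact h1 (Finset.eq_univ_iff_forall.2 h2)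
  have h3 : ∀ q : ℕ, ((finRotate n) ^ q : Equiv.Perm (Fin n)) x ∉ J := fun q => by
    induction q with
    | zero => exact hx
    | succ q ih =>
      rw [pow_succ', Equiv.Perm.mul_apply]
      exact h _ ih
  refine h3 (y + n - x) ?_
  have : ((finRotate n) ^ (y + n - x : ℕ) : Equiv.Perm (Fin n)) x = y := by
    refine Fin.ext ?_
    have hx := x.2
    have e : x.val + (y + n - x) = y + n := by omega
    rw [finRotate_pow_val, e, Nat.add_mod_right, Nat.mod_eq_of_lt y.2]
  rwa [this]

-- After a rotation no run of `J` wraps around, so the runs can be read from left to right and the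
-- first two give `b`, `c`, `d`. A third run would give three distinct maximal cyclic intervals.
open Classical in
theorem twoArc_of_ncard_le {J : Finset (Fin n)} (h : (cyclicIntervals J).ncard ≤ 2) :
    TwoArc J := by
  have build : ∀ q b c d : ℕ, b ≤ c → c ≤ d → d ≤ n →
      (∀ u : Fin n, ((finRotate n) ^ q : Equiv.Perm (Fin n)) u ∈ J ↔
        u.val < b ∨ c ≤ u.val ∧ u.val < d) → TwoArc J := by
    intro q b c d h1 h2 h3 h4
    refine ⟨q, b, c, d, h1, h2, h3, ?_⟩
    ext x
    rw [Finset.mem_map_equiv, mem_twoIco, ← h4, Equiv.apply_symm_apply]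
  rcases J.eq_empty_or_nonempty with rfl | h0
  · exact build 0 0 0 0 le_rfl le_rfl (Nat.zero_le _) fun u => by simp
  by_cases h1 : J = Finset.univ
  · refine build 0 0 0 n le_rfl (Nat.zero_le _) le_rfl fun u => ?_
    simp [h1, u.2]
  -- Counting starts at a point of `J` whose predecessor is outside `J`: in the new positions `0` is
  -- in `J` and `n - 1` is not.
  obtain ⟨i, hi, hs⟩ := exists_boundary h0 h1
  have hn := i.pos
  set s := finRotate n i with hsd
  set ρ : Equiv.Perm (Fin n) := (finRotate n) ^ s.val with hρ
  have hρ0 : ρ ⟨0, hn⟩ = s := by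
    refine Fin.ext ?_
    rw [hρ, finRotate_pow_val]
    simp [Nat.mod_eq_of_lt s.2]
  have hρl : ρ ⟨n - 1, by omega⟩ = i := by
    refine Fin.ext ?_
    rw [hρ, finRotate_pow_val, hsd, finRotate_val]
    have := i.2
    simp only
    split_ifs with h2
    · rw [add_zero, Nat.mod_eq_of_lt (by omega)]
      omega
    · have e : n - 1 + (i.val + 1) = i + n := by omega
      rw [e, Nat.add_mod_right, Nat.mod_eq_of_lt i.2]
  set A : ℕ → Prop := fun u => ∃ hu : u < n, ρ ⟨u, hu⟩ ∈ J with hA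
  have hA0 : A 0 := ⟨hn, by rwa [hρ0]⟩
  have hAl : ¬A (n - 1) := fun ⟨hu, h⟩ => hi (by rwa [hρl] at h)
  have hAu : ∀ u : Fin n, ρ u ∈ J ↔ A u := fun u => ⟨fun h => ⟨u.2, h⟩, fun ⟨_, h⟩ => h⟩
  have hAn : ∀ u, A u → u < n - 1 := fun u hu => by
    have h2 := hu.1
    rcases Nat.lt_or_ge u (n - 1) with h3 | h3
    · exact h3
    · obtain rfl : u = n - 1 := by omega
      exact absurd hu hAl
  have hb : ∃ b, ¬A b := ⟨_, hAl⟩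
  set b := Nat.find hb with hbd
  have hb1 : ¬A b := Nat.find_spec hb
  have hb2 : ∀ u < b, A u := fun u hu => not_not.1 (Nat.find_min hb hu)
  have hbn : b ≤ n - 1 := Nat.find_min' hb hAl
  have hb0 : 0 < b := Nat.pos_of_ne_zero fun h => hb1 (h ▸ hA0)
  by_cases hc : ∃ c, b ≤ c ∧ A c
  swap
  · push Not at hc
    refine build s.val b b b le_rfl le_rfl (by omega) fun u => ?_
    rw [hAu]
    constructor
    · intro h2
      by_contra h3
      exact hc u.val (by omega) h2
    · intro h2
      exact hb2 _ (by omega)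
  set c := Nat.find hc with hcd
  obtain ⟨hbc, hc1⟩ : b ≤ c ∧ A c := Nat.find_spec hc
  have hc2 : ∀ u < c, b ≤ u → ¬A u := fun u hu hbu h2 => Nat.find_min hc hu ⟨hbu, h2⟩
  have hcn := hAn c hc1
  have hd : ∃ d, c ≤ d ∧ ¬A d := ⟨n - 1, hcn.le, hAl⟩
  set d := Nat.find hd with hdd
  obtain ⟨hcd', hd1⟩ : c ≤ d ∧ ¬A d := Nat.find_spec hd
  have hd2 : ∀ u < d, c ≤ u → A u := fun u hu hcu => by
    by_contra h2
    exact Nat.find_min hd hu ⟨hcu, h2⟩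
  have hdn : d ≤ n - 1 := Nat.find_min' hd ⟨hcn.le, hAl⟩
  by_cases he : ∃ e, d ≤ e ∧ A e
  swap
  · push Not at he
    refine build s.val b c d hbc hcd' (by omega) fun u => ?_
    rw [hAu]
    constructor
    · intro h2
      by_contra h3
      rcases Nat.lt_or_ge u.val c with h4 | h4
      · exact hc2 u.val h4 (by omega) h2
      · exact he u.val (by omega) h2
    · rintro (h2 | h2)
      · exact hb2 _ h2
      · exact hd2 _ h2.2 h2.1
  exfalso
  obtain ⟨e, hde, he1⟩ := he
  -- A cyclic interval containing points on both sides of a gap `v` contains either `v` or the last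
  -- position, and neither belongs to `J`.
  have hne : ∀ x y v, A x → A y → ¬A v → x < v → v < y → ∀ T T' : Finset (Fin n),
      T ∈ cyclicIntervals J → (∀ hx : x < n, ρ ⟨x, hx⟩ ∈ T) → (∀ hy : y < n, ρ ⟨y, hy⟩ ∈ T') →
      T ≠ T' := by
    rintro x y v hx hy hv hxv hvy T _ hT hxT hyT rfl
    obtain ⟨hTJ, -, j, m, rfl⟩ := hT.1
    obtain ⟨j', rfl⟩ := ρ.surjective j
    have hx' := hxT hx.1
    have hy' := hyT hy.1
    rw [hρ, mem_arc_rotate] at hx' hy'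
    rcases arc_convex hx' hy' with h2 | h2
    · have h3 := h2 ⟨v, hvy.trans hy.1⟩ hxv.le hvy.le
      rw [← mem_arc_rotate s.val, ← hρ] at h3
      exact hv ⟨_, hTJ h3⟩
    · have h3 := h2 ⟨n - 1, by omega⟩ (by rw [Fin.le_def]; exact (hAn y hy).le)
      rw [← mem_arc_rotate s.val, ← hρ] at h3
      exact hAl ⟨_, hTJ h3⟩
  obtain ⟨T₀, hT₀, h0T⟩ := exists_cyclicInterval_mem hA0.2
  obtain ⟨T₁, hT₁, h1T⟩ := exists_cyclicInterval_mem hc1.2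
  obtain ⟨T₂, hT₂, h2T⟩ := exists_cyclicInterval_mem he1.2
  have hbc' : b < c := lt_of_le_of_ne hbc fun h => hb1 (h ▸ hc1)
  have hcd'' : c < d := lt_of_le_of_ne hcd' fun h => hd1 (h ▸ hc1)
  have hde' : d < e := lt_of_le_of_ne hde fun h => hd1 (h ▸ he1)
  have h3 : 2 < (cyclicIntervals J).ncard := (Set.two_lt_ncard_iff (Set.toFinite _)).2
    ⟨T₀, T₁, T₂, hT₀, hT₁, hT₂,
      hne 0 c b hA0 hc1 hb1 hb0 hbc' T₀ T₁ hT₀ (fun _ => h0T) fun _ => h1T,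
      hne 0 e b hA0 he1 hb1 hb0 (by omega) T₀ T₂ hT₀ (fun _ => h0T) fun _ => h2T,
      hne c e d hc1 he1 hd1 hcd'' hde' T₁ T₂ hT₁ (fun _ => h1T) fun _ => h2T⟩
  omega

end CyclicIntervals

/-! ### Positivity of the `R`-matrix and of the minors. -/

section Assembly

variable {n k ℓ : ℕ}

theorem mem_prodParam {σ τ A B : Type} {f : (σ → ℂˣ) →. A} {h : (τ → ℂˣ) →. B}
    {z : σ ⊕ τ → ℂˣ} {a : A} {b : B} :
    (a, b) ∈ prodParam f h z ↔ a ∈ f (fun i => z (Sum.inl i)) ∧ b ∈ h fun i => z (Sum.inr i) := by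
  simp [prodParam, Part.mem_bind_iff, Part.mem_map_iff]

theorem partialInv_prodParam (hk : k ≤ n) (hℓ : ℓ ≤ n) {p : XVar n k} {q : XVar n ℓ}
    (hp : ∀ i m, i ≤ n - k → m ≤ k → p.1.plucker (basicSet n k (n - k) i m) ≠ 0)
    (hq : ∀ i m, i ≤ n - ℓ → m ≤ ℓ → q.1.plucker (basicSet n ℓ (n - ℓ) i m) ≠ 0) :
    Sum.elim (gtInv p) (gtInv q) ∈ partialInv (prodParam (Theta n k) (Theta n ℓ)) (p, q) := by
  have huniq : ∀ w, (p, q) ∈ prodParam (Theta n k) (Theta n ℓ) w →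
      w = Sum.elim (gtInv p) (gtInv q) := by
    intro w hw
    rw [mem_prodParam] at hw
    ext1 i
    rcases i with i | i
    · exact congrFun (eq_gtInv_of_mem_Theta hk hw.1) i
    · exact congrFun (eq_gtInv_of_mem_Theta hℓ hw.2) i
  have h : ∃! w, (p, q) ∈ prodParam (Theta n k) (Theta n ℓ) w :=
    ⟨Sum.elim (gtInv p) (gtInv q),
      mem_prodParam.2 ⟨(mem_Theta_gtInv hk hp).1, (mem_Theta_gtInv hℓ hq).1⟩, huniq⟩
  exact ⟨h, huniq _ (Classical.choose_spec h).1⟩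

/-- Comparing squares excludes `s = t` and `s = -t` at once, so the common factor of `Ψ` is
generically nonzero whatever the parities of `k` and `ℓ`. -/
theorem eventually_sq_ne {σ : Type} {a b : σ} (hab : a ≠ b) :
    ∀ᶠ z : σ → ℂˣ in generic σ, (z a : ℂ) ^ 2 ≠ (z b : ℂ) ^ 2 := by
  classical
  refine ⟨MvPolynomial.X a ^ 2 - MvPolynomial.X b ^ 2, fun h => ?_, fun z hz h => hz ?_⟩
  · have := congrArg (MvPolynomial.eval (Pi.single a (1 : ℂ))) h
    simp [Pi.single_eq_of_ne hab.symm] at this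
  · simp [h]

/-- The tautological positive families of points on the torus are pushed through `Ψ` and through
`S`, `Ψ`, `S`. Each step yields a positive family and preserves the parameters, so the condition `s²
≠ t²` remains available for the second `Ψ`. -/
theorem isPositiveMap_geomR (hℓ : 1 ≤ ℓ) (hℓn : ℓ < n) (hk : 1 ≤ k) (hkn : k < n) :
    IsPositiveMap (prodParam (Theta n ℓ) (Theta n k)) (prodParam (Theta n k) (Theta n ℓ))
      (geomR n ℓ k) := by
  obtain ⟨p, hp, hpz⟩ := exists_posPoint (σ := GTIdx n ℓ ⊕ GTIdx n k) hℓn.le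
    (w := fun z i => z (Sum.inl i)) fun i => posFam_coord _
  obtain ⟨q, hq, hqz⟩ := exists_posPoint (σ := GTIdx n ℓ ⊕ GTIdx n k) hkn.le
    (w := fun z i => z (Sum.inr i)) fun i => posFam_coord _
  have hpq : ∀ᶠ z in generic (GTIdx n ℓ ⊕ GTIdx n k), ((p z).2 : ℂ) ^ 2 ≠ ((q z).2 : ℂ) ^ 2 := by
    filter_upwards [eventually_sq_ne (a := (Sum.inl (Sum.inr ()) : GTIdx n ℓ ⊕ GTIdx n k))
      (b := Sum.inr (Sum.inr ())) (by simp)] with z hz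
    rwa [(hpz z).2, (hqz z).2]
  obtain ⟨v, hv, -, hvm⟩ := hp.exists_Psi hq hℓ hℓn hk hkn hpq
  obtain ⟨p', hp', hp'2, hp'm, -⟩ := hp.exists_schutz hℓ hℓn
  obtain ⟨q', hq', hq'2, hq'm, -⟩ := hq.exists_schutz hk hkn
  obtain ⟨x, hx, -, hxm⟩ := hq'.exists_Psi hp' hk hkn hℓ hℓn (by
    filter_upwards [hpq] with z hz
    rw [hp'2, hq'2]
    exact hz.symm)
  obtain ⟨u, hu, -, hum, -⟩ := hx.exists_schutz hℓ hℓn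
  have hmem : ∀ᶠ z in generic (GTIdx n ℓ ⊕ GTIdx n k),
      Sum.elim (gtInv (v z)) (gtInv (u z)) ∈
        ((prodParam (Theta n ℓ) (Theta n k) z).bind (geomR n ℓ k)).bind
          (partialInv (prodParam (Theta n k) (Theta n ℓ))) := by
    filter_upwards [hvm, hp'm, hq'm, hxm, hum, hv.plucker_ne_zero, hu.plucker_ne_zero]
      with z h1 h2 h3 h4 h5 h6 h7
    refine Part.mem_bind (Part.mem_bind (mem_prodParam.2 ⟨(hpz z).1, (hqz z).1⟩)
      (Part.mem_bind h1 (Part.mem_map _ (Part.mem_bind (Part.mem_bind ?_ h4) h5))))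
      (partialInv_prodParam hkn.le hℓn.le h6 h7)
    exact Part.mem_bind h3 (Part.mem_map (fun u => (q' z, u)) h2)
  refine ⟨eventually_generic.1 ?_, fun i => ?_⟩
  · filter_upwards [hmem] with z hz
    exact hz.1
  · have hpos : PosFam fun z =>
        ((Sum.elim (gtInv (v z)) (gtInv (u z)) : GTIdx n k ⊕ GTIdx n ℓ → ℂˣ) i : ℂ) := by
      rcases i with i | i
      · exact hv.gtInv hkn.le i
      · exact hu.gtInv hℓn.le i
    refine hpos.isPositiveFun ?_
    filter_upwards [hmem] with z hz
    exact Part.mem_map (fun w : GTIdx n k ⊕ GTIdx n ℓ → ℂˣ => (w i : ℂ)) hz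

theorem isRNonneg_of_family {A : Type} {σ : Type} {Θ : (σ → ℂˣ) →. A} {f : A →. ℂ[X]} {r d : ℕ}
    {F : (σ → ℂˣ) → ℂ[X]} (hF : PolyNonneg r F) (hd : ∀ᶠ z in generic σ, (F z).natDegree ≤ d)
    (hf : ∀ᶠ z in generic σ, F z ∈ (Θ z).bind f) : IsRNonneg Θ r f := by
  refine ⟨⟨d, eventually_generic.1 ?_⟩, fun i => (hF i).isNonnegFun ?_⟩
  · filter_upwards [hd, hf] with z h1 h2
    exact ⟨_, h2, h1⟩
  · filter_upwards [hf] with z h2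
    exact Part.mem_map (fun G : ℂ[X] => (-1) ^ ((r + 1) * i) * G.coeff i) h2

theorem minorG_nonneg (hk : 1 ≤ k) (hkn : k < n) {r : ℕ} {I J : Finset (Fin n)} (hI : I.card = r)
    (hJ : J.card = r) (hIJ : TwoArc I ∨ TwoArc J) :
    (r ≤ k → IsRNonneg (Theta n k) r (minorG n k I J hI hJ)) ∧
    (k < r → ∃ f : XVar n k →. ℂ[X], IsRNonneg (Theta n k) r f ∧
      Generically fun z => ∃ p ∈ Theta n k z, ∃ F ∈ f p,
        (C (p.2 : ℂ) + (-1) ^ k * X) ^ (r - k) * F ∈ minorG n k I J hI hJ p) := by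
  obtain ⟨p, hp, hpz⟩ := exists_posPoint (σ := GTIdx n k) hkn.le
    (w := fun z i => z i) fun i => posFam_coord _
  obtain ⟨F, hF, hFe⟩ := hp.minor hk hkn hI hJ hIJ
  have hdeg : ∀ᶠ z in generic (GTIdx n k), (F z).natDegree ≤ n := by
    filter_upwards [hFe] with z hz
    exact natDegree_factor_le hz
  have hmem : ∀ᶠ z in generic (GTIdx n k), (C ((p z).2 : ℂ) + (-1) ^ k * X) ^ (r - k) * F z ∈
      minorG n k I J hI hJ (p z) := by
    filter_upwards [hFe, hp.gVal_mem hkn.le] with z h1 h2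
    rw [← h1, minor_of_card _ hI hJ]
    exact Part.mem_map (fun A : Matrix (Fin n) (Fin n) ℂ[X] =>
      (A.submatrix (I.orderEmbOfFin hI) (J.orderEmbOfFin hJ)).det) h2
  refine ⟨fun hr => isRNonneg_of_family hF hdeg ?_, fun _ => ?_⟩
  · filter_upwards [hmem] with z hz
    rw [Nat.sub_eq_zero_of_le hr, pow_zero, one_mul] at hz
    exact Part.mem_bind (hpz z).1 hz
  -- The cofactor must be a function on the variety, not only a family on the torus, so it is
  -- defined by polynomial division; the division is exact at generic points.
  · set f : XVar n k →. ℂ[X] := fun x => (minorG n k I J hI hJ x).map fun G =>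
      G / (C (x.2 : ℂ) + (-1) ^ k * X) ^ (r - k) with hf
    have hfm : ∀ᶠ z in generic (GTIdx n k), F z ∈ f (p z) := by
      filter_upwards [hmem] with z hz
      have h1 : (C ((p z).2 : ℂ) + (-1) ^ k * X) ^ (r - k) * F z /
          (C ((p z).2 : ℂ) + (-1) ^ k * X) ^ (r - k) ∈ f (p z) :=
        Part.mem_map (fun G : ℂ[X] => G / (C ((p z).2 : ℂ) + (-1) ^ k * X) ^ (r - k)) hz
      rwa [mul_div_cancel_left₀ _ (pow_ne_zero _ (C_add_mul_X_ne_zero _ _))] at h1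
    refine ⟨f, isRNonneg_of_family hF hdeg ?_, eventually_generic.1 ?_⟩
    · filter_upwards [hfm] with z hz
      exact Part.mem_bind (hpz z).1 hz
    · filter_upwards [hfm, hmem] with z h1 h2
      exact ⟨p z, (hpz z).1, F z, h1, h2⟩

end Assembly

end GeomR

theorem mainTheorem2 (n : ℕ) (hn : 2 ≤ n) :
    (∀ ℓ k : ℕ, 1 ≤ ℓ → ℓ ≤ n - 1 → 1 ≤ k → k ≤ n - 1 →
      GeomR.IsPositiveMap
        (GeomR.prodParam (GeomR.Theta n ℓ) (GeomR.Theta n k))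
        (GeomR.prodParam (GeomR.Theta n k) (GeomR.Theta n ℓ))
        (GeomR.geomR n ℓ k)) ∧
    (∀ k : ℕ, 1 ≤ k → k ≤ n - 1 →
      ∀ (r : ℕ) (I J : Finset (Fin n)) (hI : I.card = r) (hJ : J.card = r),
        ((GeomR.cyclicIntervals I).ncard ≤ 2 ∨ (GeomR.cyclicIntervals J).ncard ≤ 2) →
        (r ≤ k → GeomR.IsRNonneg (GeomR.Theta n k) r (GeomR.minorG n k I J hI hJ)) ∧
        (k < r → ∃ f : GeomR.XVar n k →. Polynomial ℂ,
          GeomR.IsRNonneg (GeomR.Theta n k) r f ∧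
          GeomR.Generically fun z => ∃ p ∈ GeomR.Theta n k z, ∃ F ∈ f p,
            (Polynomial.C (p.2 : ℂ) + (-1) ^ k * Polynomial.X) ^ (r - k) * F ∈
              GeomR.minorG n k I J hI hJ p)) := by
  refine ⟨fun ℓ k hℓ hℓn hk hkn =>
    GeomR.isPositiveMap_geomR hℓ (by omega) hk (by omega), fun k hk hkn r I J hI hJ h => ?_⟩
  exact GeomR.minorG_nonneg hk (by omega) hI hJ
    (h.imp GeomR.twoArc_of_ncard_le GeomR.twoArc_of_ncard_le)
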